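/- Let $k$ be an odd positive integer and $n=2k+1$. Let $a_1,\dots,a_n$ be a basis of $\mathbb R^n$, and let $A$ be the linear map with $A(a_j)=a_{j+1}$ for $j<n-1$, $A(a_{n-1})=-a_1-\dots-a_{n-1}$, $A(a_n)=a_n$. Fix an $A$-invariant scalar product on $\mathbb R^n$ and an orthonormal basis $e_1,\dots,e_n$ with $e_1,\dots,e_{n-1}\in\mathrm{Span}(a_1,\dots,a_{n-1})$, $e_n=a_n$ and, for $1\le j\le k$, $$A(e_{2j-1})=\cos\tfrac{2\pi j}{n}\,e_{2j-1}+\sin\tfrac{2\pi j}{n}\,e_{2j},\qquad A(e_{2j})=-\sin\tfrac{2\pi j}{n}\,e_{2j-1}+\cos\tfrac{2\pi j}{n}\,e_{2j}.$$ Let $g(x)=A(x)+\frac1n a_n$, let $\Gamma$ be the group of isometries of $\mathbb R^n$ generated by the translations by $a_1,\dots,a_{n-1}$ and by $g$, and let $M^n=\mathbb R^n/\Gamma$ (these are the manifolds of the family $\mathcal F_{CHD}$). In the Clifford algebra with $x^2=-\|x\|^2$ put $\alpha=\prod_{j=1}^k\bigl(\cos\frac{j\pi}{n}+e_{2j-1}e_{2j}\sin\frac{j\pi}{n}\bigr)$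 and $\alpha_\pm=\pm(-1)^{k(k+1)/2}\alpha$; these are the two lifts of $A$ to $\mathrm{Spin}(n)$, and $\alpha_\pm^n=\pm1$. The spin structure $\alpha_\pm$ on $M^n$ is the lift $\widehat h:\Gamma\to\mathrm{Spin}(n)$ of the holonomy homomorphism with $\widehat h(a_j)=1$ for $j<n$ and $\widehat h(g)=\alpha_\pm$. The Clifford algebra acts on $\Sigma_{2k}=(\mathbb C^2)^{\otimes k}$ as follows: with $$g_1=\begin{pmatrix}i&0\\0&-i\end{pmatrix},\quad g_2=\begin{pmatrix}0&i\\i&0\end{pmatrix},\quad T=\begin{pmatrix}0&-i\\i&0\end{pmatrix},$$ $e_j$ ($j<n$) acts as $I\otimes\dots\otimes I\otimes g\otimes T\otimes\dots\otimes T$ with $\lfloor\frac{j-1}{2}\rfloor$ factors $T$, where $g=g_1$ for odd $j$ and $g=g_2$ for even $j$, and $e_n$ acts as $i\,T\otimes\dots\otimes T$. The Dirac operator $D=\sum_j e_j\,\partial/\partial x_j$ acts on the smooth sections of the spinor bundle $(\mathbb R^n\times\Sigma_{2k})/\Gamma$, $\gamma(x,v)=(\gamma x,\widehat h(\gamma)v)$,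 that is, on smooth maps $\varphi:\mathbb R^n\to\Sigma_{2k}$ with $\varphi(\gamma x)=\widehat h(\gamma)\varphi(x)$. Its eta invariant is $\eta(0)$, where $\eta$ is the meromorphic continuation to $\mathbb C$, regular at $0$, of $\sum_{\lambda\ne0}\mathrm{sgn}(\lambda)|\lambda|^{-z}$ (sum over the nonzero eigenvalues of $D$, with their finite multiplicities, absolutely convergent for $\mathrm{Re}\,z$ large). Let $c(k)=0$ if $\frac{k(k+1)}2$ is even and $c(k)=\frac12$ if it is odd. For $\epsilon\in\{-1,1\}^k$ let $\mu_\epsilon=\sum_{j=1}^k j\epsilon_j$, and for $r\in\{0,\dots,n-1\}$ let $$A_r^+=2\,\#\bigl\{\epsilon:\ \textstyle\prod_j\epsilon_j=1,\ \tfrac{\mu_\epsilon}2+c(k)n\equiv r \bmod n\bigr\},\qquad A_r^-=2\,\#\bigl\{\epsilon:\ \textstyle\prod_j\epsilon_j=1,\ \tfrac{\mu_\epsilon}2+c(k)n+k\equiv r \bmod n\bigr\}.$$ Then the continuation exists for both spin structures, and $$\eta_{M^n,\alpha_+}(0)=\sum_{r=1}^{n-1}A_r^+\Bigl(1-\frac{2r}{n}\Bigr),\qquad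 \eta_{M^n,\alpha_-}(0)=\sum_{r=0}^{n-1}A_r^-\Bigl(1-\frac{2r+1}{n}\Bigr).$$ -/

import Mathlib

open scoped ContDiff
open CliffordAlgebra

noncomputable section

namespace FlatSpin

/-! ### The spinor module -/

/-- The Clifford algebra of a Euclidean space with the convention `x * x = -‖x‖²`. -/
def cliffordForm (V : Type*) [NormedAddCommGroup V] [InnerProductSpace ℝ V] :
    QuadraticForm ℝ V :=
  -(LinearMap.BilinMap.toQuadraticMap (innerₗ V))

/-- `Σ_{2k}`, the `k`-fold tensor power of `ℂ²`, in the coordinates of the standard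
tensor basis `u_{s 0} ⊗ ⋯ ⊗ u_{s (k-1)}`, `s : Fin k → Fin 2`. -/
abbrev Spinor (k : ℕ) : Type := (Fin k → Fin 2) → ℂ

/-- Complex endomorphisms of `Σ_{2k}`. -/
abbrev SpinorEnd (k : ℕ) : Type := Matrix (Fin k → Fin 2) (Fin k → Fin 2) ℂ

/-- The operator `M 0 ⊗ ⋯ ⊗ M (k-1)` on the `k`-fold tensor power of `ℂ²`. -/
def tensorOp {k : ℕ} (M : Fin k → Matrix (Fin 2) (Fin 2) ℂ) : SpinorEnd k :=
  Matrix.of fun s t => ∏ p, M p (s p) (t p)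

def g₁ : Matrix (Fin 2) (Fin 2) ℂ := !![Complex.I, 0; 0, -Complex.I]

def g₂ : Matrix (Fin 2) (Fin 2) ℂ := !![0, Complex.I; Complex.I, 0]

def matT : Matrix (Fin 2) (Fin 2) ℂ := !![0, -Complex.I; Complex.I, 0]

/-- The factors of the operator of the `i`-th basis vector (counted from `0`, `i < 2k`):
`I ⊗ ⋯ ⊗ I ⊗ g ⊗ T ⊗ ⋯ ⊗ T` with `⌊i/2⌋` factors `T`, where `g = g₁` for even `i` and
`g = g₂` for odd `i`. -/
def cliffordFactor (k : ℕ) (i : ℕ) (p : Fin k) : Matrix (Fin 2) (Fin 2) ℂ :=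
  if (p : ℕ) + i / 2 + 1 < k then 1
  else if (p : ℕ) + i / 2 + 1 = k then (if Even i then g₁ else g₂)
  else matT

/-- Clifford multiplication by the basis vectors `e_1, …, e_{2k+1}` (counted from `0`). -/
def cliffordMatrix (k : ℕ) (i : Fin (2 * k + 1)) : SpinorEnd k :=
  if (i : ℕ) < 2 * k then tensorOp (cliffordFactor k i)
  else Complex.I • tensorOp fun _ => matT

theorem tensorOp_mul {k : ℕ} (M N : Fin k → Matrix (Fin 2) (Fin 2) ℂ) :
    tensorOp M * tensorOp N = tensorOp fun p => M p * N p := by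
  ext s t
  simp only [tensorOp, Matrix.mul_apply, Matrix.of_apply, ← Finset.prod_mul_distrib]
  rw [Finset.prod_univ_sum]
  simp

theorem tensorOp_one {k : ℕ} :
    tensorOp (fun _ : Fin k => (1 : Matrix (Fin 2) (Fin 2) ℂ)) = 1 := by
  ext s t
  simp only [tensorOp, Matrix.of_apply, Matrix.one_apply]
  by_cases h : s = t
  · subst h; simp
  · obtain ⟨p, hp⟩ := Function.ne_iff.1 h
    rw [if_neg h]
    exact Finset.prod_eq_zero (Finset.mem_univ p) (by simp [hp])

theorem tensorOp_neg_one {k : ℕ} (M N : Fin k → Matrix (Fin 2) (Fin 2) ℂ) (p₀ : Fin k)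
    (h₀ : M p₀ = -N p₀) (h : ∀ p, p ≠ p₀ → M p = N p) : tensorOp M = -tensorOp N := by
  ext s t
  simp only [tensorOp, Matrix.of_apply, Matrix.neg_apply]
  rw [← Finset.mul_prod_erase _ _ (Finset.mem_univ p₀),
    ← Finset.mul_prod_erase (a := p₀) _ (fun p => N p (s p) (t p)) (Finset.mem_univ p₀), h₀,
    Finset.prod_congr rfl (fun p hp => by rw [h p (Finset.ne_of_mem_erase hp)])]
  simp

theorem g₁_sq : g₁ * g₁ = -1 := by
  ext i j; fin_cases i <;> fin_cases j <;> simp [g₁]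

theorem g₂_sq : g₂ * g₂ = -1 := by
  ext i j; fin_cases i <;> fin_cases j <;> simp [g₂]

theorem matT_sq : matT * matT = 1 := by
  ext i j; fin_cases i <;> fin_cases j <;> simp [matT]

theorem g₁_g₂ : g₁ * g₂ = -(g₂ * g₁) := by
  ext i j; fin_cases i <;> fin_cases j <;> simp [g₁, g₂]

theorem g₁_T : g₁ * matT = -(matT * g₁) := by
  ext i j; fin_cases i <;> fin_cases j <;> simp [g₁, matT]

theorem g₂_T : g₂ * matT = -(matT * g₂) := by
  ext i j; fin_cases i <;> fin_cases j <;> simp [g₂, matT]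

theorem cliffordMatrix_sq (k : ℕ) (i : Fin (2 * k + 1)) :
    cliffordMatrix k i * cliffordMatrix k i = -1 := by
  unfold cliffordMatrix
  split_ifs with hi
  · rw [tensorOp_mul, ← tensorOp_one]
    refine tensorOp_neg_one _ _ ⟨k - 1 - i / 2, by omega⟩ ?_ ?_
    · have h1 : ¬ (k - 1 - (i : ℕ) / 2 + i / 2 + 1 < k) := by omega
      have h2 : k - 1 - (i : ℕ) / 2 + i / 2 + 1 = k := by omega
      rw [cliffordFactor, if_neg h1, if_pos h2]
      split_ifs
      · exact g₁_sq
      · exact g₂_sq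
    · intro p hp
      have h2 : ¬ ((p : ℕ) + i / 2 + 1 = k) := by
        intro h; apply hp; ext; simp only; omega
      simp only [cliffordFactor, h2, if_false]
      split_ifs
      · simp
      · exact matT_sq
  · rw [smul_mul_smul_comm, tensorOp_mul]
    simp [matT_sq, tensorOp_one]

theorem cliffordMatrix_anticomm_of_lt (k : ℕ) (i j : Fin (2 * k + 1)) (hij : i < j) :
    cliffordMatrix k i * cliffordMatrix k j = -(cliffordMatrix k j * cliffordMatrix k i) := by
  have hij' : (i : ℕ) < j := hij
  have hj' := j.2
  have hi : (i : ℕ) < 2 * k := by omega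
  have key : ∀ N : Fin k → Matrix (Fin 2) (Fin 2) ℂ,
      (cliffordFactor k i ⟨k - 1 - i / 2, by omega⟩ * N ⟨k - 1 - i / 2, by omega⟩ =
        -(N ⟨k - 1 - i / 2, by omega⟩ * cliffordFactor k i ⟨k - 1 - i / 2, by omega⟩)) →
      (∀ p : Fin k, (p : ℕ) ≠ k - 1 - i / 2 →
        cliffordFactor k i p * N p = N p * cliffordFactor k i p) →
      tensorOp (cliffordFactor k i) * tensorOp N =
        -(tensorOp N * tensorOp (cliffordFactor k i)) := by
    intro N h0 h1
    rw [tensorOp_mul, tensorOp_mul]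
    exact tensorOp_neg_one _ _ _ h0 (fun p hp => h1 p (fun h => hp (Fin.ext h)))
  have hc : k - 1 - (i : ℕ) / 2 + i / 2 + 1 = k := by omega
  have hc' : cliffordFactor k i ⟨k - 1 - i / 2, by omega⟩ = if Even (i : ℕ) then g₁ else g₂ := by
    simp [cliffordFactor, hc]
  unfold cliffordMatrix
  rw [if_pos hi]
  split_ifs with hj
  · apply key
    · rw [hc']
      by_cases hs : (i : ℕ) / 2 = j / 2
      · have he : Even (i : ℕ) := by rw [Nat.even_iff]; omega
        have ho : ¬ Even (j : ℕ) := by rw [Nat.even_iff]; omega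
        have hcj : k - 1 - (i : ℕ) / 2 + j / 2 + 1 = k := by omega
        simp [cliffordFactor, hcj, he, ho, g₁_g₂]
      · have h1 : ¬ (k - 1 - (i : ℕ) / 2 + j / 2 + 1 < k) := by omega
        have h2 : ¬ (k - 1 - (i : ℕ) / 2 + j / 2 + 1 = k) := by omega
        simp only [cliffordFactor, h1, h2, if_false]
        split_ifs
        · exact g₁_T
        · exact g₂_T
    · intro p hp
      simp only [cliffordFactor]
      have h2 : ¬ ((p : ℕ) + i / 2 + 1 = k) := by omega
      by_cases h1 : (p : ℕ) + i / 2 + 1 < k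
      · simp [h1]
      · have h3 : ¬ ((p : ℕ) + j / 2 + 1 < k) := by omega
        have h4 : ¬ ((p : ℕ) + j / 2 + 1 = k) := by omega
        simp [h1, h2, h3, h4]
  · rw [mul_smul_comm, smul_mul_assoc, ← smul_neg]
    congr 1
    apply key
    · rw [hc']
      split_ifs
      · exact g₁_T
      · exact g₂_T
    · intro p hp
      have h2 : ¬ ((p : ℕ) + i / 2 + 1 = k) := by omega
      simp only [cliffordFactor, h2, if_false]
      split_ifs <;> simp

theorem cliffordMatrix_anticomm (k : ℕ) (i j : Fin (2 * k + 1)) (hij : i ≠ j) :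
    cliffordMatrix k i * cliffordMatrix k j = -(cliffordMatrix k j * cliffordMatrix k i) := by
  rcases lt_or_gt_of_ne hij with h | h
  · exact cliffordMatrix_anticomm_of_lt k i j h
  · rw [cliffordMatrix_anticomm_of_lt k j i h, neg_neg]

variable {k : ℕ} {V : Type*} [NormedAddCommGroup V] [InnerProductSpace ℝ V]

theorem cliffordForm_apply (v : V) : cliffordForm V v = -(‖v‖ ^ 2) := by
  simp [cliffordForm]

/-- Clifford multiplication of vectors on `Σ_{2k}` relative to an orthonormal basis. -/
def cliffordMul (e : OrthonormalBasis (Fin (2 * k + 1)) ℝ V) : V →ₗ[ℝ] SpinorEnd k :=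
  e.toBasis.constr ℝ (cliffordMatrix k)

theorem cliffordMul_apply (e : OrthonormalBasis (Fin (2 * k + 1)) ℝ V) (v : V) :
    cliffordMul e v = ∑ i, inner ℝ (e i) v • cliffordMatrix k i := by
  simp [cliffordMul, Module.Basis.constr_apply_fintype, OrthonormalBasis.repr_apply_apply]

theorem cliffordMul_sq (e : OrthonormalBasis (Fin (2 * k + 1)) ℝ V) (v : V) :
    cliffordMul e v * cliffordMul e v = algebraMap ℝ (SpinorEnd k) (cliffordForm V v) := by
  have h2 : (2 : ℝ) • (cliffordMul e v * cliffordMul e v) =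
      (2 : ℝ) • algebraMap ℝ (SpinorEnd k) (cliffordForm V v) := by
    have h : cliffordMul e v * cliffordMul e v =
        ∑ i, ∑ j, (inner ℝ (e i) v * inner ℝ (e j) v) •
          (cliffordMatrix k i * cliffordMatrix k j) := by
      simp_rw [cliffordMul_apply, Finset.sum_mul, Finset.mul_sum, smul_mul_smul_comm]
    have h' : cliffordMul e v * cliffordMul e v =
        ∑ i, ∑ j, (inner ℝ (e i) v * inner ℝ (e j) v) •
          (cliffordMatrix k j * cliffordMatrix k i) := by
      rw [h, Finset.sum_comm]
      exact Finset.sum_congr rfl fun i _ => Finset.sum_congr rfl fun j _ => by rw [mul_comm]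
    rw [two_smul]
    nth_rewrite 1 [h]
    rw [h', ← Finset.sum_add_distrib]
    have : ∀ i, (∑ j, (inner ℝ (e i) v * inner ℝ (e j) v) •
          (cliffordMatrix k i * cliffordMatrix k j) + ∑ j, (inner ℝ (e i) v * inner ℝ (e j) v) •
          (cliffordMatrix k j * cliffordMatrix k i)) =
          (-2 * (inner ℝ (e i) v) ^ 2 : ℝ) • (1 : SpinorEnd k) := by
      intro i
      rw [← Finset.sum_add_distrib, Finset.sum_eq_single i]
      · rw [cliffordMatrix_sq, smul_neg, ← neg_smul, ← add_smul]
        congr 1; ring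
      · intro j _ hj
        rw [cliffordMatrix_anticomm k i j hj.symm, smul_neg, neg_add_cancel]
      · simp
    rw [Finset.sum_congr rfl fun i _ => this i, ← Finset.sum_smul, cliffordForm_apply,
      Algebra.algebraMap_eq_smul_one, smul_smul, ← Finset.mul_sum]
    congr 1
    have := e.sum_sq_norm_inner_right v
    simp only [Real.norm_eq_abs, sq_abs] at this
    rw [this]; ring
  exact smul_right_injective _ (two_ne_zero) h2

/-- The representation of the Clifford algebra on `Σ_{2k}`. -/
def spinRep (e : OrthonormalBasis (Fin (2 * k + 1)) ℝ V) :
    CliffordAlgebra (cliffordForm V) →ₐ[ℝ] SpinorEnd k :=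
  CliffordAlgebra.lift (cliffordForm V) ⟨cliffordMul e, cliffordMul_sq e⟩

theorem spinRep_ι (e : OrthonormalBasis (Fin (2 * k + 1)) ℝ V) (v : V) :
    spinRep e (ι _ v) = cliffordMul e v := by
  simp [spinRep]

/-! ### The flat manifolds -/

/-- The linear map `A` with `a_j ↦ a_{j+1}` for `j < n-1`, `a_{n-1} ↦ -a_1 - ⋯ - a_{n-1}`,
`a_n ↦ a_n`, where `n = 2k+1` (the basis is indexed from `0`). -/
def holonomyMap (a : Module.Basis (Fin (2 * k + 1)) ℝ V) : V →ₗ[ℝ] V :=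
  a.constr ℝ fun j : Fin (2 * k + 1) =>
    if h : (j : ℕ) + 1 < 2 * k then a ⟨j + 1, by omega⟩
    else if (j : ℕ) < 2 * k then -∑ i : Fin (2 * k + 1), if (i : ℕ) < 2 * k then a i else 0
    else a j

/-- The index of `e_{2j-1}`, for the plane number `j` (both counted from `0`). -/
def idx₁ (j : Fin k) : Fin (2 * k + 1) := ⟨2 * j, by omega⟩

/-- The index of `e_{2j}`, for the plane number `j` (both counted from `0`). -/
def idx₂ (j : Fin k) : Fin (2 * k + 1) := ⟨2 * j + 1, by omega⟩

/-- The rotation angle `2πj/n` of `A` in the `j`-th plane, `n = 2k+1` (`j` counted from `0`). -/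
def angle (j : Fin k) : ℝ := 2 * Real.pi * ((j : ℝ) + 1) / (2 * k + 1)

variable (k V) in
/-- The data of a flat manifold of dimension `n = 2k+1` with cyclic holonomy of order `n`:
a basis `a` of the Euclidean space such that the scalar product is `A`-invariant, and an
orthonormal basis `e` adapted to `A`. -/
structure CHDManifold where
  a : Module.Basis (Fin (2 * k + 1)) ℝ V
  inner_map : ∀ x y : V, inner ℝ (holonomyMap a x) (holonomyMap a y) = inner ℝ x y
  e : OrthonormalBasis (Fin (2 * k + 1)) ℝ V
  e_mem : ∀ j : Fin (2 * k + 1), (j : ℕ) < 2 * k →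
    e j ∈ Submodule.span ℝ (a '' {i : Fin (2 * k + 1) | (i : ℕ) < 2 * k})
  e_last : e (Fin.last (2 * k)) = a (Fin.last (2 * k))
  rot₁ : ∀ j : Fin k, holonomyMap a (e (idx₁ j)) =
    Real.cos (angle j) • e (idx₁ j) + Real.sin (angle j) • e (idx₂ j)
  rot₂ : ∀ j : Fin k, holonomyMap a (e (idx₂ j)) =
    -Real.sin (angle j) • e (idx₁ j) + Real.cos (angle j) • e (idx₂ j)

namespace CHDManifold

variable (M : CHDManifold k V)

/-- `A` as a linear isometry. -/
def A : V ≃ₗᵢ[ℝ] V :=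
  haveI : FiniteDimensional ℝ V := M.a.finiteDimensional_of_finite
  ((holonomyMap M.a).isometryOfInner M.inner_map).toLinearIsometryEquiv rfl

theorem A_apply (x : V) : M.A x = holonomyMap M.a x := rfl

/-- The translation by `a_j`. -/
def translation (j : Fin (2 * k + 1)) : V ≃ᵃⁱ[ℝ] V :=
  AffineIsometryEquiv.constVAdd ℝ V (M.a j)

/-- The isometry `g x = A x + a_n / n`. -/
def g : V ≃ᵃⁱ[ℝ] V :=
  AffineIsometryEquiv.constVAdd ℝ V ((1 / (2 * k + 1) : ℝ) • M.a (Fin.last (2 * k))) *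
    M.A.toAffineIsometryEquiv

theorem translation_apply (j : Fin (2 * k + 1)) (x : V) : M.translation j x = M.a j + x := rfl

theorem g_apply (x : V) :
    M.g x = (1 / (2 * k + 1) : ℝ) • M.a (Fin.last (2 * k)) + M.A x := rfl

/-- The deck group `Γ = ⟨a_1, …, a_{n-1}, g⟩`; the manifold is `V / Γ`. -/
def Γ : Subgroup (V ≃ᵃⁱ[ℝ] V) :=
  Subgroup.closure ({γ | ∃ j : Fin (2 * k + 1), (j : ℕ) < 2 * k ∧ γ = M.translation j} ∪ {M.g})

/-! ### Spin structures -/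

/-- A spin structure on `V / Γ`: a lift `ĥ : Γ → Spin(n)` of the holonomy homomorphism through
the covering `λ : Spin(n) → SO(n)`, `λ y x = y x y*`, where `*` reverses products. -/
structure SpinStructure where
  lift : M.Γ →* spinGroup (cliffordForm V)
  covers : ∀ (γ : M.Γ) (x : V),
    (lift γ : CliffordAlgebra (cliffordForm V)) * ι _ x * reverse (lift γ : CliffordAlgebra _) =
      ι _ ((γ : V ≃ᵃⁱ[ℝ] V).linearIsometryEquiv x)

/-- `r_j = cos (jπ/n) + e_{2j-1} e_{2j} sin (jπ/n)`. -/
def r (j : Fin k) : CliffordAlgebra (cliffordForm V) :=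
  algebraMap ℝ _ (Real.cos (angle j / 2)) +
    Real.sin (angle j / 2) • (ι _ (M.e (idx₁ j)) * ι _ (M.e (idx₂ j)))

/-- `α = r_1 ⋯ r_k`. -/
def α : CliffordAlgebra (cliffordForm V) := ((List.finRange k).map M.r).prod

theorem ι_unit_mem_pin {u : V} (hu : ‖u‖ = 1) : ι (cliffordForm V) u ∈ pinGroup (cliffordForm V) := by
  have hsq : ι (cliffordForm V) u * ι (cliffordForm V) u = -1 := by
    rw [ι_sq_scalar, cliffordForm_apply, hu]; simp
  refine pinGroup.mem_iff.2 ⟨?_, ?_⟩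
  · refine ⟨⟨ι _ u, -ι _ u, by rw [mul_neg, hsq, neg_neg], by rw [neg_mul, hsq, neg_neg]⟩, ?_, rfl⟩
    exact Subgroup.subset_closure ⟨u, rfl⟩
  · rw [Unitary.mem_iff]
    have hs : star (ι (cliffordForm V) u) = -ι _ u := by simp [CliffordAlgebra.star_def]
    rw [hs]
    constructor
    · rw [neg_mul, hsq, neg_neg]
    · rw [mul_neg, hsq, neg_neg]

theorem ι_mul_ι_mem_spin {u v : V} (hu : ‖u‖ = 1) (hv : ‖v‖ = 1) :
    ι (cliffordForm V) u * ι (cliffordForm V) v ∈ spinGroup (cliffordForm V) :=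
  spinGroup.mem_iff.2 ⟨mul_mem (ι_unit_mem_pin hu) (ι_unit_mem_pin hv),
    ι_mul_ι_mem_evenOdd_zero _ _ _⟩

theorem e_sq (i : Fin (2 * k + 1)) :
    ι (cliffordForm V) (M.e i) * ι (cliffordForm V) (M.e i) = -1 := by
  rw [ι_sq_scalar, cliffordForm_apply, M.e.norm_eq_one]; simp

theorem e_anticomm {i j : Fin (2 * k + 1)} (h : i ≠ j) :
    ι (cliffordForm V) (M.e i) * ι (cliffordForm V) (M.e j) =
      -(ι (cliffordForm V) (M.e j) * ι (cliffordForm V) (M.e i)) := by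
  rw [eq_neg_iff_add_eq_zero, ι_mul_ι_add_swap]
  have h0 : inner ℝ (M.e i) (M.e j) = (0 : ℝ) := M.e.orthonormal.2 h
  have : QuadraticMap.polar (cliffordForm V) (M.e i) (M.e j) = 0 := by
    simp only [QuadraticMap.polar, cliffordForm_apply, norm_add_sq_real, h0]
    ring
  rw [this, map_zero]

theorem idx_ne (j : Fin k) : (idx₁ j : Fin (2 * k + 1)) ≠ idx₂ j := by
  simp [idx₁, idx₂]

theorem r_mem_spin (j : Fin k) : M.r j ∈ spinGroup (cliffordForm V) := by
  have h : M.r j = ι _ (M.e (idx₁ j)) *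
      ι _ (-Real.cos (angle j / 2) • M.e (idx₁ j) + Real.sin (angle j / 2) • M.e (idx₂ j)) := by
    rw [map_add, map_smul, map_smul, mul_add, mul_smul_comm, mul_smul_comm, e_sq, r,
      Algebra.algebraMap_eq_smul_one, smul_neg, neg_smul, neg_neg]
  rw [h]
  apply ι_mul_ι_mem_spin (M.e.norm_eq_one _)
  have h0 : inner ℝ (M.e (idx₁ j)) (M.e (idx₂ j)) = (0 : ℝ) := M.e.orthonormal.2 (idx_ne j)
  have : ‖-Real.cos (angle j / 2) • M.e (idx₁ j) + Real.sin (angle j / 2) • M.e (idx₂ j)‖ ^ 2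
      = 1 := by
    rw [norm_add_sq_real, norm_smul, norm_smul, inner_smul_left, inner_smul_right, h0,
      M.e.norm_eq_one, M.e.norm_eq_one]
    simp
  exact (pow_eq_one_iff_of_nonneg (norm_nonneg _) two_ne_zero).1 this

theorem α_mem_spin : M.α ∈ spinGroup (cliffordForm V) :=
  Submonoid.list_prod_mem _ fun x hx => by
    obtain ⟨j, -, rfl⟩ := List.mem_map.1 hx
    exact M.r_mem_spin j

theorem neg_one_mem_spin (M : CHDManifold k V) :
    (-1 : CliffordAlgebra (cliffordForm V)) ∈ spinGroup (cliffordForm V) := by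
  rw [← M.e_sq (Fin.last _)]
  exact ι_mul_ι_mem_spin (M.e.norm_eq_one _) (M.e.norm_eq_one _)

/-- `α₊ = (-1)^{k(k+1)/2} α`, so that `α₊ ^ n = 1`. -/
def αPlus : spinGroup (cliffordForm V) :=
  ⟨(-1) ^ (k * (k + 1) / 2) * M.α, mul_mem (pow_mem M.neg_one_mem_spin _) M.α_mem_spin⟩

/-- `α₋ = -(-1)^{k(k+1)/2} α`, so that `α₋ ^ n = -1`. -/
def αMinus : spinGroup (cliffordForm V) :=
  ⟨(-1) * ((-1) ^ (k * (k + 1) / 2) * M.α),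
    mul_mem M.neg_one_mem_spin (mul_mem (pow_mem M.neg_one_mem_spin _) M.α_mem_spin)⟩

theorem star_e (i : Fin (2 * k + 1)) :
    star (ι (cliffordForm V) (M.e i)) = -ι (cliffordForm V) (M.e i) := by
  simp [CliffordAlgebra.star_def]

theorem star_r (j : Fin k) : star (M.r j) = algebraMap ℝ _ (Real.cos (angle j / 2)) -
    Real.sin (angle j / 2) • (ι _ (M.e (idx₁ j)) * ι _ (M.e (idx₂ j))) := by
  rw [r, star_add, CliffordAlgebra.star_smul, star_mul, star_e, star_e, CliffordAlgebra.star_algebraMap,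
    neg_mul_neg, M.e_anticomm (idx_ne j).symm, smul_neg, sub_eq_add_neg]

theorem r_conj_other (j : Fin k) (i : Fin (2 * k + 1)) (h₁ : i ≠ idx₁ j) (h₂ : i ≠ idx₂ j) :
    M.r j * ι _ (M.e i) * star (M.r j) = ι _ (M.e i) := by
  have hc : M.r j * ι _ (M.e i) = ι _ (M.e i) * M.r j := by
    rw [r, add_mul, mul_add, Algebra.commutes, smul_mul_assoc, mul_smul_comm, mul_assoc,
      M.e_anticomm h₂.symm, mul_neg, ← mul_assoc, M.e_anticomm h₁.symm, neg_mul, neg_neg, mul_assoc]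
  rw [hc, mul_assoc, spinGroup.mul_star_self_of_mem (M.r_mem_spin j), mul_one]

theorem conj_aux {B : Type*} [Ring B] [Algebra ℝ B] (c s : ℝ) (E F : B) (hE : E * E = -1)
    (hF : F * F = -1) (hEF : F * E = -(E * F)) :
    (algebraMap ℝ B c + s • (E * F)) * E * (algebraMap ℝ B c - s • (E * F)) =
      (c ^ 2 - s ^ 2) • E + (2 * s * c) • F ∧
    (algebraMap ℝ B c + s • (E * F)) * F * (algebraMap ℝ B c - s • (E * F)) =
      (-(2 * s * c)) • E + (c ^ 2 - s ^ 2) • F := by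
  have h1 : E * F * E = F := by
    rw [mul_assoc, hEF, mul_neg, ← mul_assoc, hE, neg_mul, one_mul, neg_neg]
  have h2 : E * (E * F) = -F := by rw [← mul_assoc, hE, neg_mul, one_mul]
  have h3 : E * F * F = -E := by rw [mul_assoc, hF, mul_neg, mul_one]
  have h4 : F * (E * F) = E := by
    rw [← mul_assoc, hEF, neg_mul, h3, neg_neg]
  simp only [Algebra.algebraMap_eq_smul_one, add_mul, mul_sub, smul_mul_assoc, one_mul,
    mul_smul_comm, mul_one, h1, h2, h3, h4, smul_neg, neg_mul]
  constructor <;> module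

theorem r_conj_self (j : Fin k) :
    M.r j * ι _ (M.e (idx₁ j)) * star (M.r j) = ι _ (M.A (M.e (idx₁ j))) ∧
    M.r j * ι _ (M.e (idx₂ j)) * star (M.r j) = ι _ (M.A (M.e (idx₂ j))) := by
  have h := conj_aux (Real.cos (angle j / 2)) (Real.sin (angle j / 2)) _ _ (M.e_sq (idx₁ j))
    (M.e_sq (idx₂ j)) (M.e_anticomm (idx_ne j).symm)
  have hc : Real.cos (angle j) = Real.cos (angle j / 2) ^ 2 - Real.sin (angle j / 2) ^ 2 := by
    rw [← Real.cos_two_mul']; congr 1; ring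
  have hs : Real.sin (angle j) = 2 * Real.sin (angle j / 2) * Real.cos (angle j / 2) := by
    rw [← Real.sin_two_mul]; congr 1; ring
  rw [star_r, A_apply, A_apply, M.rot₁, M.rot₂, hc, hs]
  simp only [map_add, map_smul]
  exact h

theorem prod_conj (L : List (Fin k)) (hL : L.Nodup) (i : Fin (2 * k + 1)) :
    (L.map M.r).prod * ι _ (M.e i) * star (L.map M.r).prod =
      if ∃ j ∈ L, i = idx₁ j ∨ i = idx₂ j then ι _ (M.A (M.e i)) else ι _ (M.e i) := by
  induction L with
  | nil => simp
  | cons j L ih =>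
    obtain ⟨hj, hL'⟩ := List.nodup_cons.1 hL
    have ih := ih hL'
    have e1 : ((j :: L).map M.r).prod * ι _ (M.e i) * star ((j :: L).map M.r).prod =
        M.r j * ((L.map M.r).prod * ι _ (M.e i) * star (L.map M.r).prod) * star (M.r j) := by
      simp only [List.map_cons, List.prod_cons, star_mul, mul_assoc]
    rw [e1, ih]
    by_cases h : ∃ l ∈ L, i = idx₁ l ∨ i = idx₂ l
    · rw [if_pos h, if_pos (by
        obtain ⟨l, hl, hl'⟩ := h
        exact ⟨l, List.mem_cons_of_mem _ hl, hl'⟩)]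
      obtain ⟨l, hl, hl'⟩ := h
      have hne : (l : ℕ) ≠ j := fun h => hj (Fin.ext h ▸ hl)
      have n1 : idx₁ l ≠ idx₁ j := by simp only [idx₁, ne_eq, Fin.mk.injEq]; omega
      have n2 : idx₁ l ≠ idx₂ j := by simp only [idx₁, idx₂, ne_eq, Fin.mk.injEq]; omega
      have n3 : idx₂ l ≠ idx₁ j := by simp only [idx₁, idx₂, ne_eq, Fin.mk.injEq]; omega
      have n4 : idx₂ l ≠ idx₂ j := by simp only [idx₂, ne_eq, Fin.mk.injEq]; omega
      have f1 := M.r_conj_other j _ n1 n2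
      have f2 := M.r_conj_other j _ n3 n4
      rcases hl' with rfl | rfl <;> rw [A_apply] <;> simp only [M.rot₁, M.rot₂, map_add, map_smul,
        mul_add, add_mul, mul_smul_comm, smul_mul_assoc, f1, f2]
    · rw [if_neg h]
      by_cases h1 : i = idx₁ j
      · rw [if_pos ⟨j, List.mem_cons_self, Or.inl h1⟩, h1, (M.r_conj_self j).1]
      by_cases h2 : i = idx₂ j
      · rw [if_pos ⟨j, List.mem_cons_self, Or.inr h2⟩, h2, (M.r_conj_self j).2]
      rw [if_neg (by
        rintro ⟨l, hl, hl'⟩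
        rcases List.mem_cons.1 hl with rfl | hl
        · exact hl'.elim h1 h2
        · exact h ⟨l, hl, hl'⟩)]
      exact M.r_conj_other j i h1 h2

theorem A_last : M.A (M.a (Fin.last (2 * k))) = M.a (Fin.last (2 * k)) := by
  rw [A_apply, holonomyMap, Module.Basis.constr_basis]
  simp

theorem α_conj (x : V) : M.α * ι _ x * star M.α = ι _ (M.A x) := by
  have key : (LinearMap.mulRight ℝ (star M.α) ∘ₗ LinearMap.mulLeft ℝ M.α) ∘ₗ
      ι (cliffordForm V) = ι (cliffordForm V) ∘ₗ (M.A : V →ₗ[ℝ] V) := by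
    refine M.e.toBasis.ext fun i => ?_
    simp only [OrthonormalBasis.coe_toBasis, LinearMap.comp_apply, LinearMap.mulLeft_apply,
      LinearMap.mulRight_apply]
    refine (M.prod_conj _ (List.nodup_finRange k) i).trans ?_
    split_ifs with h
    · rfl
    · have hi : i = Fin.last (2 * k) := by
        by_contra hne
        have hlt : (i : ℕ) < 2 * k := Fin.val_lt_last hne
        apply h
        refine ⟨⟨i / 2, by omega⟩, List.mem_finRange _, ?_⟩
        rcases Nat.even_or_odd' (i : ℕ) with ⟨m, hm | hm⟩
        · left; ext; simp only [idx₁]; omega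
        · right; ext; simp only [idx₂]; omega
      subst hi
      change _ = ι _ (M.A (M.e (Fin.last (2 * k))))
      rw [M.e_last, A_last]
  exact LinearMap.congr_fun key x

theorem αPlus_conj (x : V) :
    (M.αPlus : CliffordAlgebra (cliffordForm V)) * ι _ x *
      star (M.αPlus : CliffordAlgebra (cliffordForm V)) = ι _ (M.A x) := by
  rw [← M.α_conj x, αPlus]
  rcases neg_one_pow_eq_or (CliffordAlgebra (cliffordForm V)) (k * (k + 1) / 2) with h | h <;>
  simp [h]

theorem αMinus_conj (x : V) :
    (M.αMinus : CliffordAlgebra (cliffordForm V)) * ι _ x *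
      star (M.αMinus : CliffordAlgebra (cliffordForm V)) = ι _ (M.A x) := by
  rw [← M.αPlus_conj x, αMinus, αPlus]
  simp

theorem conj_zpow (w : spinGroup (cliffordForm V))
    (hw : ∀ x : V, (w : CliffordAlgebra (cliffordForm V)) * ι _ x * star (w : CliffordAlgebra _) =
      ι _ (M.A x)) (m : ℤ) (x : V) :
    ((w ^ m : spinGroup (cliffordForm V)) : CliffordAlgebra (cliffordForm V)) * ι _ x *
      reverse ((w ^ m : spinGroup (cliffordForm V)) : CliffordAlgebra (cliffordForm V)) =
      ι _ ((M.A ^ m) x) := by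
  have hrev : ∀ y : spinGroup (cliffordForm V), reverse (y : CliffordAlgebra (cliffordForm V)) =
      star (y : CliffordAlgebra (cliffordForm V)) := fun y => by
    rw [CliffordAlgebra.star_def, spinGroup.involute_eq y.2]
  rw [hrev]
  have hinv : ∀ x : V, star (w : CliffordAlgebra (cliffordForm V)) * ι _ x * (w : CliffordAlgebra _) =
      ι _ (M.A⁻¹ x) := fun x => by
    have h := hw (M.A⁻¹ x)
    have hA : M.A (M.A⁻¹ x) = x := M.A.apply_symm_apply x
    rw [hA] at h
    rw [← h]
    simp only [← mul_assoc, spinGroup.coe_star_mul_self, one_mul]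
    rw [mul_assoc, spinGroup.coe_star_mul_self, mul_one]
  induction m using Int.induction_on generalizing x with
  | zero => simp
  | succ m ih =>
    rw [zpow_add_one, zpow_add_one, Submonoid.coe_mul, star_mul]
    have := ih (M.A x)
    rw [← hw x] at this
    change _ = ι _ ((M.A ^ (m : ℤ)) (M.A x))
    simpa only [mul_assoc] using this
  | pred m ih =>
    rw [zpow_sub_one, zpow_sub_one, Submonoid.coe_mul, star_mul]
    have := ih (M.A⁻¹ x)
    rw [← hinv x] at this
    rw [← spinGroup.star_eq_inv w, spinGroup.coe_star, star_star]
    change _ = ι _ ((M.A ^ (-(m : ℤ))) (M.A⁻¹ x))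
    simpa only [mul_assoc] using this

/-- The coordinate of `x` along `a_n`. -/
def height (x : V) : ℝ := M.a.coord (Fin.last (2 * k)) x

theorem height_A (x : V) : M.height (M.A x) = M.height x := by
  have key : M.a.coord (Fin.last (2 * k)) ∘ₗ holonomyMap M.a = M.a.coord (Fin.last (2 * k)) := by
    refine M.a.ext fun j => ?_
    rw [LinearMap.comp_apply, holonomyMap, Module.Basis.constr_basis]
    split_ifs with h1 h2
    · have n1 : (⟨j + 1, by omega⟩ : Fin (2 * k + 1)) ≠ Fin.last (2 * k) := by
        simp only [ne_eq, Fin.ext_iff, Fin.val_last]; omega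
      have n2 : j ≠ Fin.last (2 * k) := by
        simp only [ne_eq, Fin.ext_iff, Fin.val_last]; omega
      simp [Module.Basis.coord_apply, n1, n2]
    · have n2 : j ≠ Fin.last (2 * k) := by
        simp only [ne_eq, Fin.ext_iff, Fin.val_last]; omega
      rw [map_neg, map_sum, Finset.sum_eq_zero]
      · simp [Module.Basis.coord_apply, n2]
      · intro i _
        split_ifs with hi
        · have n3 : i ≠ Fin.last (2 * k) := by
            simp only [ne_eq, Fin.ext_iff, Fin.val_last]; omega
          simp [Module.Basis.coord_apply, n3]
        · simp
    · rfl
  exact LinearMap.congr_fun key x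

theorem exists_level {γ : V ≃ᵃⁱ[ℝ] V} (hγ : γ ∈ M.Γ) :
    ∃ m : ℤ, (∀ x, M.height (γ x) = M.height x + m / (2 * k + 1)) ∧
      γ.linearIsometryEquiv = M.A ^ m := by
  have hadd : ∀ x y, M.height (x + y) = M.height x + M.height y := fun x y => by simp [height]
  induction hγ using Subgroup.closure_induction with
  | mem γ h =>
    rcases h with ⟨j, hj, rfl⟩ | rfl
    · refine ⟨0, fun x => ?_, ?_⟩
      · have n2 : j ≠ Fin.last (2 * k) := by
          simp only [ne_eq, Fin.ext_iff, Fin.val_last]; omega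
        rw [translation_apply, hadd]
        simp [height, n2]
      · ext x
        have := (M.translation j).map_vadd 0 x
        simp only [translation_apply, vadd_eq_add, add_zero] at this
        rw [zpow_zero]
        change _ = x
        rw [add_comm] at this
        exact (add_right_cancel this).symm
    · refine ⟨1, fun x => ?_, ?_⟩
      · rw [g_apply, hadd, height_A]
        simp [height, add_comm]
      · ext x
        have := M.g.map_vadd 0 x
        simp only [g_apply, vadd_eq_add, add_zero, map_zero] at this
        rw [zpow_one]
        rw [add_comm] at this
        exact (add_right_cancel this).symm
  | one => exact ⟨0, fun x => by simp, by ext x; rfl⟩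
  | mul γ δ _ _ hγ hδ =>
    obtain ⟨m, h1, h2⟩ := hγ
    obtain ⟨l, h3, h4⟩ := hδ
    refine ⟨m + l, fun x => ?_, ?_⟩
    · rw [AffineIsometryEquiv.coe_mul, Function.comp_apply, h1, h3]
      push_cast; ring
    · rw [zpow_add, ← h2, ← h4]
      ext x
      rfl
  | inv γ _ hγ =>
    obtain ⟨m, h1, h2⟩ := hγ
    refine ⟨-m, fun x => ?_, ?_⟩
    · have := h1 (γ⁻¹ x)
      have hx : γ (γ⁻¹ x) = x := γ.apply_symm_apply x
      rw [hx] at this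
      rw [this]; push_cast; ring
    · rw [zpow_neg, ← h2]
      rfl

/-- The exponent of `g` in `γ`: the integer `m` for which `γ` moves the `a_n`-coordinate by
`m / n`. -/
def level (γ : V ≃ᵃⁱ[ℝ] V) : ℤ := round ((2 * k + 1) * M.height (γ 0))

theorem level_eq {γ : V ≃ᵃⁱ[ℝ] V} {m : ℤ}
    (h : ∀ x, M.height (γ x) = M.height x + m / (2 * k + 1)) : M.level γ = m := by
  have hk : (2 * k + 1 : ℝ) ≠ 0 := by positivity
  have h0 : M.height 0 = 0 := by simp [height]
  rw [level, h, h0, zero_add, mul_div_cancel₀ _ hk, round_intCast]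

/-- The homomorphism `Γ → Spin(n)` that sends `a_1, …, a_{n-1}` to `1` and `g` to a given lift
`w` of `A`. -/
def spinStructureOf (w : spinGroup (cliffordForm V))
    (hw : ∀ x : V, (w : CliffordAlgebra (cliffordForm V)) * ι _ x * star (w : CliffordAlgebra _) =
      ι _ (M.A x)) : M.SpinStructure where
  lift :=
    { toFun := fun γ => w ^ M.level γ
      map_one' := by
        rw [OneMemClass.coe_one, M.level_eq (m := 0) (fun x => by simp), zpow_zero]
      map_mul' := fun γ δ => by
        obtain ⟨m, h1, -⟩ := M.exists_level γ.2
        obtain ⟨l, h3, -⟩ := M.exists_level δ.2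
        have h5 : ∀ x, M.height (((γ * δ : M.Γ) : V ≃ᵃⁱ[ℝ] V) x) =
            M.height x + ((m + l : ℤ) : ℝ) / (2 * k + 1) := fun x => by
          rw [Subgroup.coe_mul, AffineIsometryEquiv.coe_mul, Function.comp_apply, h1, h3]
          push_cast; ring
        rw [M.level_eq h1, M.level_eq h3, M.level_eq h5, zpow_add] }
  covers := fun γ x => by
    obtain ⟨m, h1, h2⟩ := M.exists_level γ.2
    rw [h2]
    simp only [MonoidHom.coe_mk, OneHom.coe_mk, M.level_eq h1]
    exact M.conj_zpow w hw m x

/-- The spin structure with `ĥ(a_j) = 1` for `j < n` and `ĥ(g) = α₊`. -/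
def spinPlus : M.SpinStructure := M.spinStructureOf M.αPlus M.αPlus_conj

/-- The spin structure with `ĥ(a_j) = 1` for `j < n` and `ĥ(g) = α₋`. -/
def spinMinus : M.SpinStructure := M.spinStructureOf M.αMinus M.αMinus_conj

theorem spinStructureOf_translation (w : spinGroup (cliffordForm V))
    (hw : ∀ x : V, (w : CliffordAlgebra (cliffordForm V)) * ι _ x * star (w : CliffordAlgebra _) =
      ι _ (M.A x)) (j : Fin (2 * k + 1)) (hj : (j : ℕ) < 2 * k) :
    (M.spinStructureOf w hw).lift
      ⟨M.translation j, Subgroup.subset_closure (Or.inl ⟨j, hj, rfl⟩)⟩ = 1 := by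
  have n2 : j ≠ Fin.last (2 * k) := by
    simp only [ne_eq, Fin.ext_iff, Fin.val_last]; omega
  change w ^ M.level (M.translation j) = 1
  rw [M.level_eq (m := 0) (fun x => by rw [translation_apply]; simp [height, n2]), zpow_zero]

theorem spinStructureOf_g (w : spinGroup (cliffordForm V))
    (hw : ∀ x : V, (w : CliffordAlgebra (cliffordForm V)) * ι _ x * star (w : CliffordAlgebra _) =
      ι _ (M.A x)) :
    (M.spinStructureOf w hw).lift ⟨M.g, Subgroup.subset_closure (Or.inr rfl)⟩ = w := by
  have hadd : ∀ x y, M.height (x + y) = M.height x + M.height y := fun x y => by simp [height]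
  change w ^ M.level M.g = w
  rw [M.level_eq (m := 1) (fun x => by
    rw [g_apply, hadd, height_A]; simp [height, add_comm]), zpow_one]

/-! ### The Dirac operator -/

variable {M}

/-- Smooth sections of the spinor bundle `(V × Σ_{2k}) / Γ` over `V / Γ`, where
`γ (x, v) = (γ x, ĥ(γ) v)`: the `Γ`-equivariant smooth maps `V → Σ_{2k}`. -/
def spinors (S : M.SpinStructure) : Submodule ℂ (V → Spinor k) where
  carrier := {φ | ContDiff ℝ ∞ φ ∧ ∀ (γ : M.Γ) (x : V),
    φ ((γ : V ≃ᵃⁱ[ℝ] V) x) = (spinRep M.e (S.lift γ)).mulVec (φ x)}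
  zero_mem' := ⟨contDiff_const, fun γ x => by simp⟩
  add_mem' := fun {φ ψ} hφ hψ => ⟨hφ.1.add hψ.1, fun γ x => by
    simp [hφ.2, hψ.2, Matrix.mulVec_add]⟩
  smul_mem' := fun c φ hφ => ⟨hφ.1.const_smul c, fun γ x => by
    simp [hφ.2, Matrix.mulVec_smul]⟩

variable (M) in
/-- `D φ = ∑_j e_j · ∂φ/∂x_j` for spinors on `V`. -/
def diracFun (φ : V → Spinor k) (x : V) : Spinor k :=
  ∑ j, (cliffordMatrix k j).mulVec (fderiv ℝ φ x (M.e j))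

/-- The contraction of a bilinear map with an orthonormal basis does not depend on the basis. -/
theorem sum_bilin_eq {ι' W : Type*} [Fintype ι'] [AddCommGroup W] [Module ℝ W]
    (e f : OrthonormalBasis ι' ℝ V) (B : V →ₗ[ℝ] V →ₗ[ℝ] W) :
    ∑ j, B (e j) (e j) = ∑ j, B (f j) (f j) := by
  classical
  have h1 : ∀ j, B (e j) (e j) =
      ∑ i, ∑ l, (inner ℝ (f i) (e j) * inner ℝ (f l) (e j)) • B (f i) (f l) := fun j => by
    conv_lhs => rw [← f.sum_repr' (e j)]
    simp only [map_sum, map_smul, LinearMap.sum_apply, LinearMap.smul_apply, Finset.smul_sum,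
      smul_smul]
    rw [Finset.sum_comm]
    exact Finset.sum_congr rfl fun i _ => Finset.sum_congr rfl fun l _ => by rw [mul_comm]
  rw [Finset.sum_congr rfl fun j _ => h1 j, Finset.sum_comm]
  refine Finset.sum_congr rfl fun i _ => ?_
  rw [Finset.sum_comm]
  have h2 : ∀ l, ∑ j, (inner ℝ (f i) (e j) * inner ℝ (f l) (e j)) • B (f i) (f l) =
      (if i = l then (1 : ℝ) else 0) • B (f i) (f l) := fun l => by
    rw [← Finset.sum_smul, ← f.inner_eq_ite, ← e.sum_inner_mul_inner]
    simp only [real_inner_comm]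
  rw [Finset.sum_congr rfl fun l _ => h2 l]
  simp

theorem cliffordMul_e (j : Fin (2 * k + 1)) : cliffordMul M.e (M.e j) = cliffordMatrix k j := by
  rw [cliffordMul, ← OrthonormalBasis.coe_toBasis, Module.Basis.constr_basis]

theorem diracFun_contDiff {φ : V → Spinor k} (hφ : ContDiff ℝ ∞ φ) :
    ContDiff ℝ ∞ (M.diracFun φ) := by
  refine ContDiff.sum fun j _ => ?_
  have h : ContDiff ℝ ∞ fun x => fderiv ℝ φ x (M.e j) :=
    (hφ.fderiv_right (m := ∞) (by simp)).clm_apply contDiff_const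
  exact (((cliffordMatrix k j).mulVecLin.restrictScalars ℝ).toContinuousLinearMap.contDiff).comp h

theorem diracFun_equivariant (S : M.SpinStructure) {φ : V → Spinor k} (hφ : φ ∈ spinors S)
    (γ : M.Γ) (x : V) : M.diracFun φ ((γ : V ≃ᵃⁱ[ℝ] V) x) =
      (spinRep M.e (S.lift γ)).mulVec (M.diracFun φ x) := by
  set h := (γ : V ≃ᵃⁱ[ℝ] V).linearIsometryEquiv with hh
  set R := spinRep M.e (S.lift γ) with hR
  have hd : Differentiable ℝ φ := hφ.1.differentiable (by simp)
  have hder : ∀ v, fderiv ℝ φ ((γ : V ≃ᵃⁱ[ℝ] V) x) (h v) = R.mulVec (fderiv ℝ φ x v) := by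
    intro v
    have hγ : HasFDerivAt (fun y => (γ : V ≃ᵃⁱ[ℝ] V) y)
        (h.toContinuousLinearEquiv : V →L[ℝ] V) x := by
      have : (fun y => (γ : V ≃ᵃⁱ[ℝ] V) y) = fun y => h y + (γ : V ≃ᵃⁱ[ℝ] V) 0 := by
        funext y
        have := (γ : V ≃ᵃⁱ[ℝ] V).map_vadd 0 y
        simpa using this
      rw [this]
      exact (h.toContinuousLinearEquiv.hasFDerivAt).add_const _
    have h1 := (hd ((γ : V ≃ᵃⁱ[ℝ] V) x)).hasFDerivAt.comp x hγ
    have h2 := ((R.mulVecLin.restrictScalars ℝ).toContinuousLinearMap.hasFDerivAt).comp x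
      (hd x).hasFDerivAt
    have h3 : φ ∘ (fun y => (γ : V ≃ᵃⁱ[ℝ] V) y) =
        (R.mulVecLin.restrictScalars ℝ).toContinuousLinearMap ∘ φ := by
      funext y
      exact hφ.2 γ y
    rw [h3] at h1
    exact DFunLike.congr_fun (h1.unique h2) v
  have hcl : ∀ v, cliffordMul M.e (h v) * R = R * cliffordMul M.e v := by
    intro v
    have h1 := congrArg (fun y => y * (S.lift γ : CliffordAlgebra (cliffordForm V))) (S.covers γ v)
    have hrev : reverse (S.lift γ : CliffordAlgebra (cliffordForm V)) *
        (S.lift γ : CliffordAlgebra (cliffordForm V)) = 1 := by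
      have := spinGroup.coe_star_mul_self (S.lift γ)
      rwa [CliffordAlgebra.star_def, spinGroup.involute_eq (S.lift γ).2] at this
    simp only [mul_assoc, hrev, mul_one] at h1
    have h2 := congrArg (spinRep M.e) h1
    rw [map_mul, map_mul, spinRep_ι, spinRep_ι] at h2
    exact h2.symm
  let B : V →ₗ[ℝ] V →ₗ[ℝ] Spinor k := LinearMap.mk₂ ℝ
    (fun u v => (cliffordMul M.e u).mulVec (fderiv ℝ φ ((γ : V ≃ᵃⁱ[ℝ] V) x) v))
    (fun u u' v => by simp [Matrix.add_mulVec]) (fun c u v => by simp [Matrix.smul_mulVec])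
    (fun u v v' => by simp [Matrix.mulVec_add]) (fun c u v => by simp [Matrix.mulVec_smul])
  have hB := sum_bilin_eq M.e (M.e.map h) B
  simp only [B, LinearMap.mk₂_apply, OrthonormalBasis.map_apply] at hB
  simp only [diracFun]
  simp_rw [← cliffordMul_e (M := M)]
  rw [hB, Matrix.mulVec_sum]
  refine Finset.sum_congr rfl fun j _ => ?_
  rw [hder, Matrix.mulVec_mulVec, hcl, Matrix.mulVec_mulVec]

/-- The Dirac operator on the smooth sections of the spinor bundle. -/
def dirac (S : M.SpinStructure) : Module.End ℂ (spinors S) where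
  toFun φ := ⟨M.diracFun φ, diracFun_contDiff φ.2.1, diracFun_equivariant S φ.2⟩
  map_add' φ ψ := by
    ext1; funext x
    have h1 : DifferentiableAt ℝ (φ : V → Spinor k) x := (φ.2.1.differentiable (by simp)) x
    have h2 : DifferentiableAt ℝ (ψ : V → Spinor k) x := (ψ.2.1.differentiable (by simp)) x
    simp [diracFun, fderiv_add h1 h2, Matrix.mulVec_add, Finset.sum_add_distrib]
  map_smul' c φ := by
    ext1; funext x
    have h1 : DifferentiableAt ℝ (φ : V → Spinor k) x := (φ.2.1.differentiable (by simp)) x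
    simp [diracFun, fderiv_const_smul h1, Matrix.mulVec_smul, Finset.smul_sum]

/-- `v` is the eta invariant of the Dirac operator: the eigenspaces are finite-dimensional, the
series `∑_{λ ≠ 0} sgn λ |λ|^{-z}` over the nonzero (real) eigenvalues, repeated according to
multiplicity, converges (absolutely) for `Re z` large, and its sum extends to a meromorphic
function on `ℂ` that is regular at `0` with value `v` there. -/
def HasEtaInvariant (S : M.SpinStructure) (v : ℝ) : Prop :=
  (∀ l : ℝ, FiniteDimensional ℂ ((dirac S).eigenspace (l : ℂ))) ∧
  ∃ (σ : ℝ) (η : ℂ → ℂ),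
    (∀ z : ℂ, σ < z.re → HasSum (fun l : {l : ℝ // l ≠ 0} =>
      (Module.finrank ℂ ((dirac S).eigenspace ((l : ℝ) : ℂ)) : ℂ) *
        ((Real.sign l : ℝ) : ℂ) * ((|(l : ℝ)| : ℝ) : ℂ) ^ (-z)) (η z)) ∧
    Meromorphic η ∧ AnalyticAt ℂ η 0 ∧ η 0 = v

end CHDManifold

/-! ### The combinatorial invariants -/

/-- `c(k) = 0` if `k(k+1)/2` is even and `1/2` otherwise. -/
def c (k : ℕ) : ℚ := if Even (k * (k + 1) / 2) then 0 else 1 / 2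

/-- `μ_ε = ∑_j j ε_j` (`j = 1, …, k`). -/
def mu {k : ℕ} (ε : Fin k → ℤˣ) : ℤ := ∑ j, (ε j : ℤ) * ((j : ℤ) + 1)

/-- `A_r⁺`. -/
def countPlus (k r : ℕ) : ℕ :=
  2 * {ε : Fin k → ℤˣ | ∏ j, ε j = 1 ∧
    (mu ε : ℚ) / 2 + c k * (2 * k + 1) ≡ (r : ℚ) [PMOD (2 * k + 1 : ℚ)]}.ncard

/-- `A_r⁻`. -/
def countMinus (k r : ℕ) : ℕ :=
  2 * {ε : Fin k → ℤˣ | ∏ j, ε j = 1 ∧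
    (mu ε : ℚ) / 2 + c k * (2 * k + 1) + k ≡ (r : ℚ) [PMOD (2 * k + 1 : ℚ)]}.ncard

end FlatSpin

end

/-! Write n = 2k+1 and let w be one of the two lifts of A. The isometry g^{2n} is the translation by
2a_n and w^{2n} acts trivially on spinors, so every section is periodic for the lattice spanned by
a_1, …, a_{n-1}, 2a_n and has a Fourier expansion over the dual lattice. On e^{2πi⟨u,x⟩}v the Dirac
operator is Clifford multiplication by 2πi u, whose square is 4π²‖u‖². An eigenspinor with
eigenvalue l therefore has all its frequencies on the sphere 2π‖u‖ = |l|; it is a finite sum of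
plane waves, and the eigenspace becomes the finite linear algebra of `spectralModel`
(`nonempty_spectralModel_equiv`).

Since A fixes the axis a_n, frequencies on and off the axis decouple
(`finrank_spectralModel_eq_add`). Off the axis there is a nonzero vector in the plane of u and a_n,
orthogonal to u and chosen A-equivariantly; Clifford multiplication by it anticommutes with u and
exchanges the eigenvalues l and -l. This part of the spectrum is symmetric (`finrank_off_axis_neg`)
and cancels in the eta series (`hasSum_off_axis`).

On the axis all conditions are diagonal in the joint eigenbasis `eigVec ε` of the bivectors
e_{2j-1}e_{2j}. Each ε contributes an arithmetic progression 2πn s_ε (q + a_ε), q ∈ ℤ, of simple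
eigenvalues, with s_ε = ∏ ε_j and a_ε = `axisShift h ε` (`finrank_axis`, `axisEigenvalue_eq`). Its
eta function is s_ε (2πn)^{-z} times twice an odd Hurwitz zeta function. This is entire; with a ∈
[0,1) congruent to a_ε modulo 1, its value at 0 is s_ε (1 - 2a) if a > 0 and 0 if a = 0
(`hurwitzZetaOdd_zero`).

For odd k the change ε ↦ -ε reverses s_ε and a_ε modulo 1, so ε and -ε contribute equally. This is
the factor 2 in the counts and the reason to keep only s_ε = 1 (`sum_axisEta_zero`). Modulo 1, a_ε
is r/n for the first spin structure and (r + 1/2)/n for the second, r being the residue counted in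
A_r^±; grouping by r gives the formulas. -/

noncomputable section

namespace FlatSpin

/-! ### Fourier series of periodic functions -/

section Fourier

open MeasureTheory Complex

variable {ι : Type*}

/-- The half-open unit cube with corner `a`. -/
def unitCube (a : ι → ℝ) : Set (ι → ℝ) := {x | ∀ i, x i ∈ Set.Ioc (a i) (a i + 1)}

theorem unitCube_subset (a : ι → ℝ) : unitCube a ⊆ Set.Icc a (a + 1) := fun _ hx =>
  ⟨fun i => (hx i).1.le, fun i => (hx i).2⟩

/-- Invariance under translation by integer vectors. -/
def IntPeriodic {E : Type*} (F : (ι → ℝ) → E) : Prop :=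
  ∀ (m : ι → ℤ) (x : ι → ℝ), F (x + fun i => (m i : ℝ)) = F x

/-- The function on the torus that an integer-periodic function descends to. -/
def descend {E : Type*} (F : (ι → ℝ) → E) (θ : UnitAddTorus ι) : E :=
  F fun i => Quotient.out (θ i)

/-- `Quotient.out` picks an arbitrary representative of each coordinate; it differs from `x i` by an
integer, which periodicity absorbs. -/
theorem descend_coe {E : Type*} {F : (ι → ℝ) → E} (hF : IntPeriodic F) (x : ι → ℝ) :
    descend F (fun i => (x i : UnitAddCircle)) = F x := by
  have h : ∀ i, ∃ m : ℤ, Quotient.out ((x i : ℝ) : UnitAddCircle) = x i + m := fun i => by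
    have h1 : ((Quotient.out ((x i : ℝ) : UnitAddCircle) : ℝ) : UnitAddCircle) = x i :=
      QuotientAddGroup.out_eq' _
    rw [← sub_eq_zero, ← AddCircle.coe_sub, AddCircle.coe_eq_zero_iff] at h1
    obtain ⟨m, hm⟩ := h1
    exact ⟨m, by simp only [zsmul_eq_mul, mul_one] at hm; linarith⟩
  choose m hm using h
  rw [descend, ← hF m x]
  congr 1
  funext i
  exact hm i

theorem continuous_descend {F : (ι → ℝ) → ℂ} (hF : IntPeriodic F) (hc : Continuous F) :
    Continuous (descend F) := by
  have hq : IsOpenQuotientMap (Pi.map fun (_ : ι) (x : ℝ) => (x : UnitAddCircle)) :=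
    IsOpenQuotientMap.piMap fun _ => QuotientAddGroup.isOpenQuotientMap_mk
  refine hq.isQuotientMap.continuous_iff.2 ?_
  convert hc using 1
  funext x
  exact descend_coe hF x

variable [Fintype ι]

theorem measurableSet_unitCube (a : ι → ℝ) : MeasurableSet (unitCube a) :=
  MeasurableSet.univ_pi' fun _ => measurableSet_Ioc

theorem integrableOn_unitCube {E : Type*} [NormedAddCommGroup E] {F : (ι → ℝ) → E}
    (hF : Continuous F) (a : ι → ℝ) : IntegrableOn F (unitCube a) :=
  (hF.continuousOn.integrableOn_compact isCompact_Icc).mono_set (unitCube_subset a)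

/-- Both integrals compute the zeroth Fourier coefficient of the descended function, which does not
see the corner of the cube. -/
theorem setIntegral_unitCube_eq {F : (ι → ℝ) → ℂ} (hF : IntPeriodic F) (a : ι → ℝ) :
    ∫ x in unitCube a, F x = ∫ x in unitCube 0, F x := by
  have h : ∀ a : ι → ℝ,
      UnitAddTorus.mFourierCoeff (descend F) 0 = ∫ x in unitCube a, F x := fun a => by
    rw [UnitAddTorus.mFourierCoeff_eq_integral _ _ a]
    refine setIntegral_congr_fun (measurableSet_unitCube a) fun x _ => ?_
    simp only [descend_coe hF, neg_zero, UnitAddTorus.mFourier_zero, ContinuousMap.one_apply,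
      one_smul]
  rw [← h, ← h]

theorem setIntegral_unitCube_add {F : (ι → ℝ) → ℂ} (hF : IntPeriodic F) (c : ι → ℝ) :
    ∫ x in unitCube 0, F (x + c) = ∫ x in unitCube 0, F x := by
  have hset : unitCube (0 : ι → ℝ) = (fun x => x + c) ⁻¹' unitCube c := by
    ext x
    simp only [unitCube, Set.mem_preimage, Set.mem_ofPred_eq, Set.mem_Ioc, Pi.add_apply,
      Pi.zero_apply, zero_add]
    refine forall_congr' fun i => ?_
    constructor <;> rintro ⟨h1, h2⟩ <;> constructor <;> linarith
  rw [← setIntegral_unitCube_eq hF c, hset]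
  exact (measurePreserving_add_right volume c).setIntegral_preimage_emb
    (MeasurableEquiv.addRight c).measurableEmbedding F (unitCube c)

theorem IntPeriodic.fderiv {F : (ι → ℝ) → ℂ} (hF : IntPeriodic F) (v : ι → ℝ) :
    IntPeriodic fun x => fderiv ℝ F x v := fun m x => by
  have h : (fun x => F (x + fun i => (m i : ℝ))) = F := funext (hF m)
  simp only
  rw [← fderiv_comp_add_right, h]

/-- The integral is unchanged when the integrand is translated by `s • e`, so it may be averaged
over `s ∈ [0,1]`. After Fubini the inner integral along `e` vanishes. -/
theorem setIntegral_fderiv_single [DecidableEq ι] {F : (ι → ℝ) → ℂ} (hF : IntPeriodic F)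
    (hc : ContDiff ℝ 1 F) (i : ι) :
    ∫ x in unitCube 0, fderiv ℝ F x (Pi.single i 1) = 0 := by
  set e : ι → ℝ := Pi.single i 1 with he
  have hF' : Continuous fun x => fderiv ℝ F x e := (hc.continuous_fderiv one_ne_zero).clm_apply
    continuous_const
  -- The fundamental theorem of calculus on a segment whose endpoints differ by an integer vector.
  have h1 : ∀ x, ∫ s in (0 : ℝ)..1, fderiv ℝ F (x + s • e) e = 0 := fun x => by
    have hd : ∀ s ∈ Set.uIcc (0 : ℝ) 1,
        HasDerivAt (fun s : ℝ => F (x + s • e)) (fderiv ℝ F (x + s • e) e) s := fun s _ => by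
      have h2 : HasDerivAt (fun s : ℝ => x + s • e) e s := by
        simpa using ((hasDerivAt_id s).smul_const e).const_add x
      exact ((hc.differentiable one_ne_zero) _).hasFDerivAt.comp_hasDerivAt s h2
    rw [intervalIntegral.integral_eq_sub_of_hasDerivAt hd
      (Continuous.intervalIntegrable (hF'.comp (by fun_prop)) _ _), sub_eq_zero]
    have := hF (Pi.single i 1) (x + (0 : ℝ) • e)
    rw [← this]
    congr 1
    funext j
    by_cases hj : j = i
    · subst hj; simp [he]
    · simp [he, hj]
  have h2 : ∀ s : ℝ, ∫ x in unitCube 0, fderiv ℝ F (x + s • e) e =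
      ∫ x in unitCube 0, fderiv ℝ F x e := fun s =>
    setIntegral_unitCube_add (hF.fderiv e) (s • e)
  have h3 : ∫ s in Set.Ioc (0 : ℝ) 1, ∫ x in unitCube 0, fderiv ℝ F (x + s • e) e =
      ∫ x in unitCube 0, fderiv ℝ F x e := by
    simp_rw [h2]
    simp
  rw [← h3, integral_integral_swap]
  · simp_rw [← intervalIntegral.integral_of_le (zero_le_one' ℝ), h1]
    simp
  · rw [Measure.prod_restrict]
    have hcc : Continuous (Function.uncurry fun (s : ℝ) (x : ι → ℝ) => fderiv ℝ F (x + s • e) e) :=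
      hF'.comp (by fun_prop)
    exact (hcc.continuousOn.integrableOn_compact
      ((isCompact_Icc (a := (0 : ℝ)) (b := 1)).prod (isCompact_Icc (a := (0 : ι → ℝ))
        (b := 0 + 1)))).mono_set (Set.prod_mono Set.Ioc_subset_Icc_self (unitCube_subset 0))

/-- The character `x ↦ e^{2πi ⟨m, x⟩}` of the torus. -/
def torusChar (m : ι → ℤ) (x : ι → ℝ) : ℂ := cexp (2 * Real.pi * I * (∑ i, m i * x i : ℝ))

theorem torusChar_contDiff (m : ι → ℤ) : ContDiff ℝ 1 (torusChar m) := by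
  unfold torusChar
  refine ContDiff.cexp (contDiff_const.mul (ofRealCLM.contDiff.comp ?_))
  exact ContDiff.sum fun i _ => contDiff_const.mul (contDiff_apply ℝ ℝ i)

theorem torusChar_periodic (m : ι → ℤ) : IntPeriodic (torusChar m) := fun p x => by
  unfold torusChar
  rw [Complex.exp_eq_exp_iff_exists_int]
  refine ⟨∑ i, m i * p i, ?_⟩
  simp only [Pi.add_apply, mul_add, Finset.sum_add_distrib]
  push_cast
  ring

theorem fderiv_torusChar (m : ι → ℤ) (x v : ι → ℝ) :
    fderiv ℝ (torusChar m) x v = 2 * Real.pi * I * (∑ i, m i * v i : ℝ) * torusChar m x := by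
  let L : (ι → ℝ) →L[ℝ] ℝ := ∑ i, (m i : ℝ) • ContinuousLinearMap.proj i
  have hL : ∀ v, L v = ∑ i, m i * v i := fun v => by simp [L]
  have h : HasFDerivAt (torusChar m)
      (cexp (2 * Real.pi * I * (L x : ℝ)) • ((2 * Real.pi * I : ℂ) • (ofRealCLM.comp L))) x := by
    have := ((ofRealCLM.comp L).hasFDerivAt (x := x)).const_mul (2 * Real.pi * I : ℂ)
    have h2 := this.cexp
    have h3 : torusChar m = fun y => cexp (2 * Real.pi * I * (ofRealCLM.comp L) y) := by
      funext y
      simp [torusChar, ← hL]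
    rw [h3]
    exact h2
  rw [h.fderiv]
  simp only [smul_apply, ContinuousLinearMap.comp_apply, smul_eq_mul,
    ofRealCLM_apply, hL, torusChar]
  ring

/-- The Fourier coefficients of an integer-periodic function. -/
def cubeCoeff (F : (ι → ℝ) → ℂ) (m : ι → ℤ) : ℂ :=
  ∫ x in unitCube 0, torusChar (-m) x * F x

theorem mFourier_coe (m : ι → ℤ) (x : ι → ℝ) :
    UnitAddTorus.mFourier m (fun i => (x i : UnitAddCircle)) = torusChar m x := by
  simp only [UnitAddTorus.mFourier, ContinuousMap.coe_mk, fourier_coe_apply, torusChar]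
  rw [← Complex.exp_sum]
  push_cast
  rw [Finset.mul_sum]
  congr 1
  refine Finset.sum_congr rfl fun i _ => ?_
  ring

theorem mFourierCoeff_descend {F : (ι → ℝ) → ℂ} (hF : IntPeriodic F) (m : ι → ℤ) :
    UnitAddTorus.mFourierCoeff (descend F) m = cubeCoeff F m := by
  rw [UnitAddTorus.mFourierCoeff_eq_integral _ _ 0]
  refine setIntegral_congr_fun (measurableSet_unitCube 0) fun x _ => ?_
  simp only [mFourier_coe, descend_coe hF, smul_eq_mul]

/-- With finitely many nonzero coefficients the Fourier series is summable at once, so continuity of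
`F` is enough for pointwise equality. -/
theorem eq_sum_cubeCoeff {F : (ι → ℝ) → ℂ} (hF : IntPeriodic F) (hc : Continuous F)
    (S : Finset (ι → ℤ)) (hS : ∀ m ∉ S, cubeCoeff F m = 0) (x : ι → ℝ) :
    F x = ∑ m ∈ S, cubeCoeff F m * torusChar m x := by
  let f : C(UnitAddTorus ι, ℂ) := ⟨descend F, continuous_descend hF hc⟩
  have hco : ∀ m, UnitAddTorus.mFourierCoeff f m = cubeCoeff F m := mFourierCoeff_descend hF
  have hsum : Summable (UnitAddTorus.mFourierCoeff f) :=
    summable_of_ne_finset_zero (s := S) fun m hm => by rw [hco, hS m hm]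
  have h := UnitAddTorus.hasSum_mFourier_series_apply_of_summable hsum
    (fun i => (x i : UnitAddCircle))
  have h2 : HasSum (fun m => UnitAddTorus.mFourierCoeff f m •
      UnitAddTorus.mFourier m (fun i => (x i : UnitAddCircle)))
      (∑ m ∈ S, cubeCoeff F m * torusChar m x) := by
    convert hasSum_sum_of_ne_finset_zero (s := S) ?_ using 1
    · refine Finset.sum_congr rfl fun m _ => ?_
      rw [hco, mFourier_coe, smul_eq_mul]
    · intro m hm
      rw [hco, hS m hm, zero_smul]
    · infer_instance
  rw [← h.unique h2]
  exact (descend_coe hF x).symm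

/-- Integration by parts: the derivative of `torusChar (-m) * F` in a coordinate direction has
integral zero over a period. General `v` follows by linearity. -/
theorem cubeCoeff_fderiv {F : (ι → ℝ) → ℂ} (hF : IntPeriodic F) (hc : ContDiff ℝ 1 F)
    (v : ι → ℝ) (m : ι → ℤ) : cubeCoeff (fun x => fderiv ℝ F x v) m =
      2 * Real.pi * I * (∑ i, m i * v i : ℝ) * cubeCoeff F m := by
  classical
  have key : ∀ i, cubeCoeff (fun x => fderiv ℝ F x (Pi.single i 1)) m =
      2 * Real.pi * I * m i * cubeCoeff F m := fun i => by
    have hG : IntPeriodic fun x => torusChar (-m) x * F x := fun p x => by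
      simp only [torusChar_periodic (-m) p x, hF p x]
    have h := setIntegral_fderiv_single hG ((torusChar_contDiff _).mul hc) i
    have hd : ∀ x, fderiv ℝ (fun x => torusChar (-m) x * F x) x (Pi.single i 1) =
        torusChar (-m) x * fderiv ℝ F x (Pi.single i 1) -
          2 * Real.pi * I * m i * (torusChar (-m) x * F x) := fun x => by
      rw [fderiv_fun_mul (((torusChar_contDiff _).differentiable one_ne_zero) x)
        ((hc.differentiable one_ne_zero) x)]
      simp only [add_apply, smul_apply, smul_eq_mul,
        fderiv_torusChar]
      simp [Pi.single_apply]
      ring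
    simp_rw [hd] at h
    rw [integral_sub, integral_const_mul, sub_eq_zero] at h
    · exact h
    · exact integrableOn_unitCube ((torusChar_contDiff _).continuous.mul
        ((hc.continuous_fderiv one_ne_zero).clm_apply continuous_const)) 0
    · exact (integrableOn_unitCube ((torusChar_contDiff _).continuous.mul
        hc.continuous) 0).const_mul _
  have hv : ∀ x, fderiv ℝ F x v = ∑ i, (v i : ℂ) * fderiv ℝ F x (Pi.single i 1) := fun x => by
    conv_lhs => rw [pi_eq_sum_univ' v]
    simp
  have : cubeCoeff (fun x => fderiv ℝ F x v) m =
      ∑ i, (v i : ℂ) * cubeCoeff (fun x => fderiv ℝ F x (Pi.single i 1)) m := by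
    simp only [cubeCoeff, ← integral_const_mul]
    rw [← integral_finsetSum]
    · refine integral_congr_ae (Filter.Eventually.of_forall fun x => ?_)
      simp only [hv, Finset.mul_sum]
      exact Finset.sum_congr rfl fun i _ => by ring
    · intro i _
      exact (integrableOn_unitCube ((torusChar_contDiff _).continuous.mul
        ((hc.continuous_fderiv one_ne_zero).clm_apply continuous_const)) 0).const_mul _
  rw [this]
  simp only [key]
  push_cast
  rw [Finset.mul_sum, Finset.sum_mul]
  exact Finset.sum_congr rfl fun i _ => by ring

end Fourier
end FlatSpin

/-! ### Plane waves and Fourier coefficients for a lattice in a Euclidean space -/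

namespace FlatSpin

section PlaneWaves

open MeasureTheory Complex

variable {V : Type*} [NormedAddCommGroup V] [InnerProductSpace ℝ V]

/-- The character `x ↦ e^{2πi ⟨u, x⟩}`. -/
def planeWave (u x : V) : ℂ := cexp (2 * Real.pi * I * (inner ℝ u x : ℝ))

theorem planeWave_add (u x y : V) : planeWave u (x + y) = planeWave u x * planeWave u y := by
  rw [planeWave, planeWave, planeWave, ← Complex.exp_add, inner_add_right]
  push_cast
  ring_nf

theorem planeWave_zero_right (u : V) : planeWave u 0 = 1 := by simp [planeWave]

theorem planeWave_hasFDerivAt (u x : V) : HasFDerivAt (planeWave u)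
    (planeWave u x • ((2 * Real.pi * I : ℂ) • (ofRealCLM.comp (innerSL ℝ u)))) x := by
  have := ((ofRealCLM.comp (innerSL ℝ u)).hasFDerivAt (x := x)).const_mul (2 * Real.pi * I : ℂ)
  exact this.cexp

theorem planeWave_contDiff (u : V) : ContDiff ℝ ∞ (planeWave u) :=
  ContDiff.cexp (contDiff_const.mul (ofRealCLM.contDiff.comp (innerSL ℝ u).contDiff))

/-- The character of `V` with frequency `u`, as a monoid homomorphism. -/
def planeWaveHom (u : V) : Multiplicative V →* ℂ where
  toFun x := planeWave u x.toAdd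
  map_one' := planeWave_zero_right u
  map_mul' x y := planeWave_add u x.toAdd y.toAdd

/-- Differentiating both characters at 0 in the direction `u - w` gives ⟨u, u - w⟩ = ⟨w, u - w⟩,
hence ‖u - w‖² = 0. -/
theorem planeWaveHom_injective : Function.Injective (planeWaveHom (V := V)) := by
  intro u w h
  have h1 : ∀ x : V, planeWave u x = planeWave w x := fun x =>
    DFunLike.congr_fun h (Multiplicative.ofAdd x)
  have h2 : fderiv ℝ (planeWave u) 0 (u - w) = fderiv ℝ (planeWave w) 0 (u - w) := by
    rw [funext h1]
  rw [(planeWave_hasFDerivAt u 0).fderiv, (planeWave_hasFDerivAt w 0).fderiv] at h2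
  simp only [planeWave_zero_right, one_smul, smul_apply, ContinuousLinearMap.comp_apply,
    innerSL_apply_apply, ofRealCLM_apply, smul_eq_mul] at h2
  have h3 := mul_left_cancel₀ two_pi_I_ne_zero h2
  rw [ofReal_inj, ← sub_eq_zero, ← inner_sub_left, inner_self_eq_zero, sub_eq_zero] at h3
  exact h3

/-- Dedekind's independence of characters, applied to each coordinate of the coefficients. -/
theorem planeWave_independent {κ : Type*} (S : Finset V) (v : V → κ → ℂ)
    (h : ∀ x, ∑ u ∈ S, planeWave u x • v u = 0) : ∀ u ∈ S, v u = 0 := by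
  have hli := (linearIndependent_monoidHom (Multiplicative V) ℂ).comp _
    (planeWaveHom_injective (V := V))
  intro u hu
  funext s
  refine linearIndependent_iff'.1 hli S (fun u => v u s) ?_ u hu
  funext x
  have := congrFun (h x.toAdd) s
  simp only [Finset.sum_apply, Pi.smul_apply, smul_eq_mul, Pi.zero_apply] at this ⊢
  rw [← this]
  refine Finset.sum_congr rfl fun u _ => ?_
  rw [mul_comm]
  rfl

variable {ι : Type*} [Fintype ι] {κ : Type*}

/-- The Fourier coefficients of a function that is periodic for the lattice spanned by `b`. -/
def latticeCoeff (b : Module.Basis ι ℝ V) (φ : V → κ → ℂ) (m : ι → ℤ) : κ → ℂ :=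
  fun s => cubeCoeff (fun y => φ (b.equivFun.symm y) s) m

theorem intPeriodic_of_periodic (b : Module.Basis ι ℝ V) {φ : V → κ → ℂ}
    (hφ : ∀ i x, φ (b i + x) = φ x) (s : κ) : IntPeriodic fun y => φ (b.equivFun.symm y) s := by
  intro m y
  have hz : ∀ (i : ι) (p : ℤ) (x : V), φ ((p : ℝ) • b i + x) = φ x := fun i p => by
    induction p using Int.induction_on with
    | zero => intro x; simp
    | succ p ih =>
      intro x
      rw [← ih x, ← hφ i (((p : ℤ) : ℝ) • b i + x), ← add_assoc]
      congr 2
      push_cast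
      module
    | pred p ih =>
      intro x
      rw [← ih x, ← hφ i (((-(p : ℤ) - 1 : ℤ) : ℝ) • b i + x), ← add_assoc]
      congr 2
      push_cast
      module
  have hs : ∀ (T : Finset ι) (x : V), φ (∑ i ∈ T, (m i : ℝ) • b i + x) = φ x := fun T => by
    classical
    induction T using Finset.induction_on with
    | empty => intro x; simp
    | insert i T hi ih => intro x; rw [Finset.sum_insert hi, add_assoc, hz, ih]
  simp only
  rw [map_add, Module.Basis.equivFun_symm_apply b (fun i => (m i : ℝ)), add_comm, hs]

/-- The index set `J` serves the sum over `j` in the Dirac operator; a one-point `J` with a scalar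
matrix gives compatibility with scalars. -/
theorem latticeCoeff_sum_mulVec [Fintype κ] {J : Type*} [Fintype J] (b : Module.Basis ι ℝ V)
    (N : J → Matrix κ κ ℂ) {φ : J → V → κ → ℂ} (hc : ∀ j, Continuous (φ j)) (m : ι → ℤ) :
    latticeCoeff b (fun x => ∑ j, (N j).mulVec (φ j x)) m =
      ∑ j, (N j).mulVec (latticeCoeff b (φ j) m) := by
  have : FiniteDimensional ℝ V := b.finiteDimensional_of_finite
  let L : (ι → ℝ) →L[ℝ] V := b.equivFun.symm.toLinearMap.toContinuousLinearMap
  have hi : ∀ j s, IntegrableOn (fun y => torusChar (-m) y * φ j (b.equivFun.symm y) s)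
      (unitCube 0) := fun j s =>
    integrableOn_unitCube ((torusChar_contDiff _).continuous.mul
      (((continuous_apply s).comp (hc j)).comp L.continuous)) 0
  funext s
  simp only [latticeCoeff, cubeCoeff, Finset.sum_apply, Matrix.mulVec, dotProduct, Finset.mul_sum,
    ← integral_const_mul]
  rw [integral_finsetSum]
  · refine Finset.sum_congr rfl fun j _ => ?_
    rw [integral_finsetSum]
    · refine Finset.sum_congr rfl fun t _ => ?_
      refine integral_congr_ae (Filter.Eventually.of_forall fun y => ?_)
      simp only
      ring
    · intro t _
      refine ((hi j t).const_mul (N j s t)).congr (Filter.Eventually.of_forall fun y => ?_)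
      simp only
      ring
  · intro j _
    refine integrable_finsetSum _ fun t _ => ?_
    refine ((hi j t).const_mul (N j s t)).congr (Filter.Eventually.of_forall fun y => ?_)
    simp only
    ring

variable [DecidableEq ι]

theorem innerₗ_nondegenerate : (innerₗ V : LinearMap.BilinForm ℝ V).Nondegenerate := by
  constructor
  · intro x hx
    simpa using hx x
  · intro x hx
    simpa using hx x

/-- The basis dual to `b` for the scalar product. -/
def innerDual (b : Module.Basis ι ℝ V) : Module.Basis ι ℝ V :=
  haveI : FiniteDimensional ℝ V := b.finiteDimensional_of_finite
  LinearMap.BilinForm.dualBasis (innerₗ V) innerₗ_nondegenerate b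

theorem inner_innerDual (b : Module.Basis ι ℝ V) (i j : ι) :
    inner ℝ (innerDual b i) (b j) = (if i = j then 1 else 0 : ℝ) := by
  have : FiniteDimensional ℝ V := b.finiteDimensional_of_finite
  have := LinearMap.BilinForm.apply_dualBasis_left (B := innerₗ V) innerₗ_nondegenerate b i j
  rw [innerDual]
  simp only [innerₗ_apply_apply] at this
  rw [this]
  simp [eq_comm]

/-- The vector of the dual lattice with coordinates `m`. -/
def dualFreq (b : Module.Basis ι ℝ V) (m : ι → ℤ) : V := ∑ i, (m i : ℝ) • innerDual b i

/-- Thus `planeWave (dualFreq b m)` is `torusChar m` read in the coordinates of `b`. -/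
theorem inner_dualFreq (b : Module.Basis ι ℝ V) (m : ι → ℤ) (x : V) :
    inner ℝ (dualFreq b m) x = ∑ i, m i * b.equivFun x i := by
  conv_lhs => rw [← b.sum_equivFun x]
  simp only [dualFreq, sum_inner, inner_sum, inner_smul_left, inner_smul_right, inner_innerDual]
  simp
  exact Finset.sum_congr rfl fun i _ => mul_comm _ _

theorem dualFreq_injective (b : Module.Basis ι ℝ V) : Function.Injective (dualFreq b) := by
  intro m p h
  funext i
  have := congrArg (fun u => inner ℝ u (b i)) h
  simpa [inner_dualFreq, Module.Basis.equivFun_apply, Finsupp.single_apply] using this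

theorem latticeCoeff_fderiv [Fintype κ] (b : Module.Basis ι ℝ V) {φ : V → κ → ℂ}
    (hφ : ∀ i x, φ (b i + x) = φ x) (hc : ContDiff ℝ 1 φ) (v : V) (m : ι → ℤ) :
    latticeCoeff b (fun x => fderiv ℝ φ x v) m =
      (2 * Real.pi * I * (inner ℝ (dualFreq b m) v : ℝ)) • latticeCoeff b φ m := by
  have : FiniteDimensional ℝ V := b.finiteDimensional_of_finite
  funext s
  let L : (ι → ℝ) →L[ℝ] V := b.equivFun.symm.toLinearMap.toContinuousLinearMap
  have hF : ContDiff ℝ 1 fun y => φ (b.equivFun.symm y) s :=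
    ((contDiff_apply ℝ ℂ s).comp hc).comp L.contDiff
  have h := cubeCoeff_fderiv (intPeriodic_of_periodic b hφ s) hF (b.equivFun v) m
  rw [← inner_dualFreq] at h
  simp only [latticeCoeff, Pi.smul_apply, smul_eq_mul]
  rw [← h]
  congr 1
  funext y
  have h1 : HasFDerivAt (fun y => φ (b.equivFun.symm y))
      ((fderiv ℝ φ (L y)).comp L) y :=
    ((hc.differentiable one_ne_zero) (L y)).hasFDerivAt.comp y L.hasFDerivAt
  have h2 := hasFDerivAt_pi'.1 h1 s
  rw [h2.fderiv]
  simp [L]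

theorem eq_sum_latticeCoeff [Fintype κ] (b : Module.Basis ι ℝ V) {φ : V → κ → ℂ}
    (hφ : ∀ i x, φ (b i + x) = φ x) (hc : Continuous φ) (S : Finset (ι → ℤ))
    (hS : ∀ m ∉ S, latticeCoeff b φ m = 0) (x : V) :
    φ x = ∑ m ∈ S, planeWave (dualFreq b m) x • latticeCoeff b φ m := by
  have : FiniteDimensional ℝ V := b.finiteDimensional_of_finite
  funext s
  let L : (ι → ℝ) →L[ℝ] V := b.equivFun.symm.toLinearMap.toContinuousLinearMap
  have hF : Continuous fun y => φ (b.equivFun.symm y) s :=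
    ((continuous_apply s).comp hc).comp L.continuous
  have h := eq_sum_cubeCoeff (intPeriodic_of_periodic b hφ s) hF S
    (fun m hm => congrFun (hS m hm) s) (b.equivFun x)
  simp only [LinearEquiv.symm_apply_apply] at h
  rw [h]
  simp only [Finset.sum_apply, Pi.smul_apply, smul_eq_mul]
  refine Finset.sum_congr rfl fun m _ => ?_
  rw [mul_comm, planeWave, inner_dualFreq]
  rfl

end PlaneWaves
end FlatSpin

/-! ### The odd Hurwitz zeta function at 0 -/

namespace FlatSpin

section Hurwitz

open Complex HurwitzZeta

/-- Three uses of the mean value inequality. The derivative of x^{-z} varies by at most K on the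
unit interval, hence stays within K of the unit difference, and this bounds the derivative of x^{-z}
minus the linear function with that slope. The condition -2 ≤ Re z makes the size of the second
derivative largest at `N`. -/
theorem norm_cpow_second_difference_le {N : ℝ} (hN : 0 < N) {z : ℂ} (hz : -2 ≤ z.re) {s t : ℝ}
    (hs : s ∈ Set.Icc N (N + 1)) (ht : t ∈ Set.Icc N (N + 1)) :
    ‖((t : ℂ) ^ (-z) - (s : ℂ) ^ (-z)) -
      (t - s) * (((N + 1 : ℝ) : ℂ) ^ (-z) - (N : ℂ) ^ (-z))‖ ≤
      ‖z‖ * ‖z + 1‖ * N ^ (-z.re - 2) * |t - s| := by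
  set K := ‖z‖ * ‖z + 1‖ * N ^ (-z.re - 2) with hK
  have hd : ∀ w : ℂ, ∀ x ∈ Set.Icc N (N + 1), HasDerivAt (fun x : ℝ => (x : ℂ) ^ w)
      (w * (x : ℂ) ^ (w - 1)) x := fun w x hx => by
    by_cases hw : w = 0
    · subst hw
      simpa using hasDerivAt_const x (1 : ℂ)
    · exact hasDerivAt_ofReal_cpow_const (by linarith [hx.1]) hw
  set f' : ℝ → ℂ := fun x => -z * (x : ℂ) ^ (-z - 1) with hf'
  have h2 : ∀ x ∈ Set.Icc N (N + 1), ∀ y ∈ Set.Icc N (N + 1), ‖f' y - f' x‖ ≤ K := by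
    intro x hx y hy
    have h := (convex_Icc N (N + 1)).norm_image_sub_le_of_norm_hasDerivWithin_le (f := f')
      (f' := fun x => -z * ((-z - 1) * (x : ℂ) ^ (-z - 1 - 1))) (C := K)
      (fun x hx => ((hd (-z - 1) x hx).const_mul (-z)).hasDerivWithinAt) (fun x hx => by
        have hx0 : 0 < x := by linarith [hx.1]
        rw [norm_mul, norm_mul, norm_neg, norm_cpow_eq_rpow_re_of_pos hx0, hK, mul_assoc,
          show -z - 1 = -(z + 1) by ring, norm_neg]
        gcongr
        have : (-(z + 1) - 1).re = -z.re - 2 := by simp; ring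
        rw [this]
        exact Real.rpow_le_rpow_of_nonpos hN hx.1 (by linarith)) hx hy
    refine h.trans ?_
    have hK0 : 0 ≤ K := by positivity
    have : ‖y - x‖ ≤ 1 := by
      rw [Real.norm_eq_abs, abs_le]; constructor <;> linarith [hx.1, hx.2, hy.1, hy.2]
    nlinarith
  have hN0 : N ∈ Set.Icc N (N + 1) := ⟨le_rfl, by linarith⟩
  have hN1 : N + 1 ∈ Set.Icc N (N + 1) := ⟨by linarith, le_rfl⟩
  have hlin : ∀ (c : ℂ) (x : ℝ), HasDerivAt (fun x : ℝ => (x : ℂ) * c) c x := fun c x => by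
    simpa using (ofRealCLM.hasDerivAt (x := x)).mul_const c
  have h1 : ∀ x ∈ Set.Icc N (N + 1),
      ‖f' x - (((N + 1 : ℝ) : ℂ) ^ (-z) - (N : ℂ) ^ (-z))‖ ≤ K := by
    intro x hx
    have h := (convex_Icc N (N + 1)).norm_image_sub_le_of_norm_hasDerivWithin_le
      (f := fun y : ℝ => (y : ℂ) ^ (-z) - y * f' x)
      (f' := fun y => -z * (y : ℂ) ^ (-z - 1) - f' x) (C := K)
      (fun y hy => ((hd (-z) y hy).sub (hlin _ y)).hasDerivWithinAt)
      (fun y hy => h2 x hx y hy) hN0 hN1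
    rw [norm_sub_rev]
    simp only [add_sub_cancel_left, norm_one, mul_one] at h
    refine le_of_eq_of_le (congrArg norm ?_) h
    push_cast
    ring
  have h := (convex_Icc N (N + 1)).norm_image_sub_le_of_norm_hasDerivWithin_le
      (f := fun y : ℝ => (y : ℂ) ^ (-z) - y * (((N + 1 : ℝ) : ℂ) ^ (-z) - (N : ℂ) ^ (-z)))
      (C := K) (fun y hy => ((hd (-z) y hy).sub (hlin _ y)).hasDerivWithinAt)
      (fun y hy => h1 y hy) hs ht
  rw [Real.norm_eq_abs] at h
  refine le_of_eq_of_le (congrArg norm ?_) h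
  ring

/-- The value at `0` of the odd Hurwitz zeta function. -/
theorem hurwitzZetaOdd_zero {a : ℝ} (ha : a ∈ Set.Ioo (0 : ℝ) 1) :
    hurwitzZetaOdd (a : UnitAddCircle) 0 = 1 / 2 - a := by
  -- The defining series does not reach z = 0. The two base points differ by -(1 - 2a), so adding (1
  -- - 2a) times a telescoping series turns each term into a second difference, of order n^{-Re z -
  -- 2}.
  set h : ℕ → ℂ → ℂ := fun n z =>
    (((n + 1 + a : ℝ) : ℂ) ^ (-z) - ((n + 1 + (1 - a) : ℝ) : ℂ) ^ (-z)) +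
      (1 - 2 * a) * (((n + 1 + 1 : ℝ) : ℂ) ^ (-z) - ((n + 1 : ℝ) : ℂ) ^ (-z)) with hh
  -- On the half-plane the terms have a common summable bound once ‖z‖ is bounded, which the ball
  -- ensures; the region contains 0 and also 2, where the original series converges.
  set U : Set ℂ := {z | -(1 / 2) < z.re} ∩ Metric.ball 0 3 with hU
  have hUo : IsOpen U := (isOpen_lt continuous_const continuous_re).inter Metric.isOpen_ball
  have hUc : IsPreconnected U :=
    ((convex_halfSpace_re_gt _).inter (convex_ball 0 3)).isPreconnected
  have hb : ∀ (n : ℕ), ∀ z ∈ U, ‖h n z‖ ≤ 12 * ((n : ℝ) + 1) ^ (-(3 / 2) : ℝ) := by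
    intro n z hz
    have hz1 : -(1 / 2) < z.re := hz.1
    have hz2 : ‖z‖ < 3 := by simpa using hz.2
    have hN : (0 : ℝ) < n + 1 := by positivity
    have := norm_cpow_second_difference_le (N := (n : ℝ) + 1) hN (z := z) (by linarith)
      (s := n + 1 + (1 - a)) (t := n + 1 + a) ⟨by linarith [ha.2], by linarith [ha.1]⟩
      ⟨by linarith [ha.1], by linarith [ha.2]⟩
    refine le_trans (le_of_eq ?_) (this.trans ?_)
    · rw [hh]
      congr 1
      push_cast
      ring
    · have e1 : ‖z + 1‖ ≤ 4 := (norm_add_le _ _).trans (by simp; linarith)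
      have e2 : |(n + 1 + a) - (n + 1 + (1 - a))| ≤ 1 := by
        rw [abs_le]; constructor <;> linarith [ha.1, ha.2]
      have e3 : ((n : ℝ) + 1) ^ (-z.re - 2) ≤ ((n : ℝ) + 1) ^ (-(3 / 2) : ℝ) :=
        Real.rpow_le_rpow_of_exponent_le (by linarith [n.cast_nonneg (α := ℝ)]) (by linarith)
      calc _ ≤ 3 * 4 * ((n : ℝ) + 1) ^ (-(3 / 2) : ℝ) * 1 := by gcongr
        _ = _ := by ring
  have hu : Summable fun n : ℕ => 12 * ((n : ℝ) + 1) ^ (-(3 / 2) : ℝ) := by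
    refine Summable.mul_left _ ?_
    have := (summable_nat_add_iff 1).2 (Real.summable_nat_rpow (p := -(3 / 2)).2 (by norm_num))
    simpa using this
  have hpow : ∀ x : ℝ, 0 < x → Differentiable ℂ fun z : ℂ => (x : ℂ) ^ (-z) := fun x hx =>
    differentiable_id.neg.const_cpow (Or.inl (by exact_mod_cast hx.ne'))
  have hdiff : DifferentiableOn ℂ (fun z => ∑' n, h n z) U := by
    refine differentiableOn_tsum_of_summable_norm hu (fun n => ?_) hUo hb
    have hn : (0 : ℝ) ≤ n := n.cast_nonneg
    exact (((hpow _ (by linarith [ha.1])).sub (hpow _ (by linarith [ha.2]))).add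
      (((hpow _ (by linarith)).sub (hpow _ (by linarith))).const_mul _)).differentiableOn
  -- The first pair is the term of index 0 of the zeta series; the constant 1 - 2a compensates the
  -- telescoping series, whose sum is -1.
  set G : ℂ → ℂ := fun z => ((a : ℂ) ^ (-z) - ((1 - a : ℝ) : ℂ) ^ (-z)) + (1 - 2 * a) +
    ∑' n, h n z with hG
  have hGd : DifferentiableOn ℂ G U :=
    (((hpow _ ha.1).sub (hpow _ (by linarith [ha.2]))).add_const _).differentiableOn.add hdiff
  have hGa : AnalyticOnNhd ℂ G U := hGd.analyticOnNhd hUo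
  have hFa : AnalyticOnNhd ℂ (fun z => 2 * hurwitzZetaOdd (a : UnitAddCircle) z) U :=
    ((differentiable_hurwitzZetaOdd _).const_mul 2).differentiableOn.analyticOnNhd hUo
  have heq : ∀ z ∈ U, 1 < z.re → 2 * hurwitzZetaOdd (a : UnitAddCircle) z = G z := by
    intro z hz hz1
    have s1 : HasSum (fun n => h n z) (∑' n, h n z) :=
      (Summable.of_norm_bounded hu fun n => hb n z hz).hasSum
    have s2 := (hasSum_nat_add_iff' 1).2 ((hasSum_nat_hurwitzZetaOdd_of_mem_Icc
      ⟨ha.1.le, ha.2.le⟩ hz1).mul_left 2)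
    have hs : Summable fun n : ℕ => ((n + 1 : ℝ) : ℂ) ^ (-z) := by
      have := (summable_nat_add_iff 1).2 (Complex.summable_one_div_nat_cpow.2 hz1)
      refine this.congr fun n => ?_
      rw [cpow_neg]
      push_cast
      rw [one_div]
    have s3 := ((hasSum_nat_add_iff' 1).2 hs.hasSum).sub hs.hasSum
    have s4 := s2.add (s3.mul_left (1 - 2 * a : ℂ))
    have hfun : (fun n : ℕ => h n z) = fun n : ℕ =>
        2 * ((1 / (((n + 1 : ℕ) : ℂ) + a) ^ z - 1 / (((n + 1 : ℕ) : ℂ) + 1 - a) ^ z) / 2) +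
        (1 - 2 * a) * ((((n + 1 : ℕ) : ℝ) + 1 : ℝ) ^ (-z) - ((n + 1 : ℝ) : ℂ) ^ (-z)) := by
      funext n
      simp only [hh, cpow_neg]
      push_cast
      ring_nf
    have := s1.unique (hfun ▸ s4)
    rw [hG]
    simp only
    rw [this]
    simp [cpow_neg]
    ring
  have h2U : (2 : ℂ) ∈ U := ⟨by simp; norm_num, by simp; norm_num⟩
  have h0U : (0 : ℂ) ∈ U := ⟨by simp, by simp⟩
  have := hFa.eqOn_of_preconnected_of_eventuallyEq hGa hUc h2U (by
    filter_upwards [hUo.mem_nhds h2U,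
      (isOpen_lt continuous_const continuous_re).mem_nhds (show (1 : ℝ) < (2 : ℂ).re by simp)]
      with z hz hz1
    exact heq z hz hz1) h0U
  -- All powers equal 1 at z = 0, so only the constant 1 - 2a survives in `G 0`.
  have hh0 : ∀ n, h n 0 = 0 := fun n => by simp [hh]
  simp only [hG, hh0, neg_zero, cpow_zero, tsum_zero] at this
  linear_combination this / 2

theorem hurwitzZetaOdd_zero_zero : hurwitzZetaOdd 0 0 = 0 := by
  have := hurwitzZetaOdd_neg 0 0
  rw [neg_zero] at this
  linear_combination this / 2

end Hurwitz
end FlatSpin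

/-! ### The joint eigenbasis of the bivectors on the spinor module -/

namespace FlatSpin

section SpinorBasis

open Complex

variable {k : ℕ}

/-- The decomposable tensor `f 0 ⊗ ⋯ ⊗ f (k-1)`. -/
def tensorVec (f : Fin k → Fin 2 → ℂ) : Spinor k := fun s => ∏ p, f p (s p)

theorem tensorOp_mulVec_tensorVec (N : Fin k → Matrix (Fin 2) (Fin 2) ℂ) (f : Fin k → Fin 2 → ℂ) :
    (tensorOp N).mulVec (tensorVec f) = tensorVec fun p => (N p).mulVec (f p) := by
  funext s
  simp only [Matrix.mulVec, dotProduct, tensorOp, Matrix.of_apply, tensorVec,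
    ← Finset.prod_mul_distrib]
  rw [Finset.prod_univ_sum]
  simp

theorem tensorVec_smul (c : Fin k → ℂ) (f : Fin k → Fin 2 → ℂ) :
    tensorVec (fun p => c p • f p) = (∏ p, c p) • tensorVec f := by
  funext s
  simp [tensorVec, Finset.prod_mul_distrib]

/-- The eigenvector of `T` with eigenvalue `e`. -/
def eigFactor (e : ℤˣ) : Fin 2 → ℂ := ![1, I * (e : ℤ)]

theorem matT_mulVec_eigFactor (e : ℤˣ) :
    matT.mulVec (eigFactor e) = ((e : ℤ) : ℂ) • eigFactor e := by
  funext i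
  have h : (((e : ℤ) : ℂ)) * ((e : ℤ) : ℂ) = 1 := by
    rcases Int.units_eq_one_or e with rfl | rfl <;> simp
  fin_cases i
  · simp [matT, eigFactor, Matrix.mulVec, dotProduct, ← mul_assoc]
  · simp [matT, eigFactor, Matrix.mulVec, dotProduct]
    linear_combination -I * h

theorem g₁_g₂_eq : g₁ * g₂ = (-I) • matT := by
  ext i j; fin_cases i <;> fin_cases j <;> simp [g₁, g₂, matT]

/-- The joint eigenvectors of the bivectors `e_{2j-1} e_{2j}`. -/
def eigVec (ε : Fin k → ℤˣ) : Spinor k := tensorVec fun p => eigFactor (ε p.rev)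

theorem cliffordMatrix_last_mulVec (ε : Fin k → ℤˣ) :
    (cliffordMatrix k (Fin.last (2 * k))).mulVec (eigVec ε) =
      (I * ((∏ j, ε j : ℤˣ) : ℤ)) • eigVec ε := by
  have h : ¬ ((Fin.last (2 * k) : Fin (2 * k + 1)) : ℕ) < 2 * k := by simp
  rw [cliffordMatrix, if_neg h, Matrix.smul_mulVec, eigVec, tensorOp_mulVec_tensorVec]
  simp only [matT_mulVec_eigFactor]
  rw [tensorVec_smul, smul_smul]
  congr 2
  rw [← Equiv.prod_comp Fin.revPerm]
  simp

/-- In the tensor slot `j.rev` the product is g₁g₂ = -iT; in every other slot it is the identity or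
T² = 1. Planes are numbered from the last slot, whence the reversal in `eigVec`. -/
theorem cliffordMatrix_plane_mulVec (ε : Fin k → ℤˣ) (j : Fin k) :
    (cliffordMatrix k (idx₁ j) * cliffordMatrix k (idx₂ j)).mulVec (eigVec ε) =
      (-I * ((ε j : ℤ) : ℂ)) • eigVec ε := by
  have h1 : ((idx₁ j : Fin (2 * k + 1)) : ℕ) < 2 * k := by simp only [idx₁]; omega
  have h2 : ((idx₂ j : Fin (2 * k + 1)) : ℕ) < 2 * k := by simp only [idx₂]; omega
  have hp : ∀ p : Fin k, cliffordFactor k (idx₁ j : Fin (2 * k + 1)) p *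
      cliffordFactor k (idx₂ j : Fin (2 * k + 1)) p =
        if p = j.rev then (-I) • matT else 1 := by
    intro p
    have d1 : 2 * (j : ℕ) / 2 = j := by omega
    have d2 : (2 * (j : ℕ) + 1) / 2 = j := by omega
    have e1 : Even (2 * (j : ℕ)) := even_two_mul _
    have e2 : ¬ Even (2 * (j : ℕ) + 1) := by rw [Nat.even_add_one]; simp
    simp only [cliffordFactor, idx₁, idx₂, d1, d2, e1, e2, if_true, if_false]
    have hr : p = j.rev ↔ (p : ℕ) + j + 1 = k := by
      rw [Fin.ext_iff, Fin.val_rev]; omega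
    simp only [hr]
    split_ifs with q1 q2 q3
    · omega
    · simp
    · exact g₁_g₂_eq
    · exact matT_sq
  rw [cliffordMatrix, if_pos h1, cliffordMatrix, if_pos h2, tensorOp_mul, eigVec,
    tensorOp_mulVec_tensorVec]
  have : (fun p => (cliffordFactor k (idx₁ j : Fin (2 * k + 1)) p *
      cliffordFactor k (idx₂ j : Fin (2 * k + 1)) p).mulVec (eigFactor (ε p.rev))) =
      fun p => (if p = j.rev then -I * ((ε j : ℤ) : ℂ) else 1) • eigFactor (ε p.rev) := by
    funext p
    rw [hp]
    split_ifs with q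
    · subst q
      rw [Matrix.smul_mulVec, matT_mulVec_eigFactor, smul_smul, Fin.rev_rev]
    · simp
  rw [this, tensorVec_smul]
  congr 1
  simp

/-- The Hermitian product factors over the slots, and a slot where the signs differ contributes 1 +
ε_j δ_j = 0. -/
theorem eigVec_orthogonal {ε δ : Fin k → ℤˣ} (h : ε ≠ δ) : star (eigVec ε) ⬝ᵥ eigVec δ = 0 := by
  simp only [dotProduct, eigVec, tensorVec, Pi.star_apply, star_prod, ← Finset.prod_mul_distrib]
  have := (Finset.prod_univ_sum (fun _ : Fin k => (Finset.univ : Finset (Fin 2)))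
    (fun p i => star (eigFactor (ε p.rev) i) * eigFactor (δ p.rev) i)).symm
  rw [Fintype.piFinset_univ] at this
  rw [this]
  obtain ⟨j, hj⟩ := Function.ne_iff.1 h
  refine Finset.prod_eq_zero (Finset.mem_univ j.rev) ?_
  rw [Fin.rev_rev]
  rcases Int.units_eq_one_or (ε j) with h1 | h1 <;> rcases Int.units_eq_one_or (δ j) with h2 | h2 <;>
    first
    | exact absurd (h1.trans h2.symm) hj
    | (rw [h1, h2]; simp [eigFactor])

theorem eigVec_ne_zero (ε : Fin k → ℤˣ) : eigVec ε ≠ 0 := by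
  intro h
  have := congrFun h (fun _ => 0)
  simp [eigVec, tensorVec, eigFactor] at this

theorem eigVec_linearIndependent : LinearIndependent ℂ (eigVec (k := k)) := by
  rw [Fintype.linearIndependent_iff]
  intro c hc ε
  have h := congrArg (fun v => star (eigVec ε) ⬝ᵥ v) hc
  simp only [dotProduct_sum, dotProduct_smul, dotProduct_zero] at h
  rw [Finset.sum_eq_single ε (fun δ _ hδ => by rw [eigVec_orthogonal hδ.symm, smul_zero])
    (by simp)] at h
  refine (smul_eq_zero.1 h).resolve_right fun h0 => eigVec_ne_zero ε ?_
  open scoped ComplexOrder in exact dotProduct_star_self_eq_zero.1 h0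

/-- The basis of `Σ_{2k}` that consists of the vectors `eigVec ε`. -/
def eigBasis (k : ℕ) : Module.Basis (Fin k → ℤˣ) ℂ (Spinor k) :=
  basisOfLinearIndependentOfCardEqFinrank eigVec_linearIndependent (by simp)

theorem eigBasis_apply (ε : Fin k → ℤˣ) : eigBasis k ε = eigVec ε := by simp [eigBasis]

/-- Turns an equation between spinors involving a diagonal operator into scalar equations, one for
each `ε`. -/
theorem mulVec_eigBasis_repr {N : SpinorEnd k} {c : (Fin k → ℤˣ) → ℂ}
    (h : ∀ ε, N.mulVec (eigVec ε) = c ε • eigVec ε) (v : Spinor k) (ε : Fin k → ℤˣ) :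
    (eigBasis k).repr (N.mulVec v) ε = c ε * (eigBasis k).repr v ε := by
  have : (Finsupp.lapply ε ∘ₗ (eigBasis k).repr.toLinearMap) ∘ₗ N.mulVecLin =
      c ε • (Finsupp.lapply ε ∘ₗ (eigBasis k).repr.toLinearMap) := by
    refine (eigBasis k).ext fun δ => ?_
    rw [LinearMap.comp_apply, Matrix.mulVecLin_apply, eigBasis_apply, h, ← eigBasis_apply]
    simp only [LinearMap.comp_apply, LinearMap.smul_apply, LinearEquiv.coe_coe, map_smul,
      Module.Basis.repr_self, Finsupp.lapply_apply, Finsupp.single_apply, smul_eq_mul]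
    split_ifs with hδ
    · rw [hδ]
    · simp
  exact LinearMap.congr_fun this v

end SpinorBasis

/-! ### The action of the two lifts of A on the eigenbasis -/

namespace CHDManifold

open Complex

variable {k : ℕ} {V : Type*} [NormedAddCommGroup V] [InnerProductSpace ℝ V]
  (M : CHDManifold k V)

theorem spinRep_r_mulVec (j : Fin k) (ε : Fin k → ℤˣ) :
    (spinRep M.e (M.r j)).mulVec (eigVec ε) =
      cexp (-(I * ((ε j : ℤ) : ℂ) * (angle j / 2 : ℝ))) • eigVec ε := by
  rw [r, map_add, AlgHom.commutes, map_smul, map_mul, spinRep_ι, spinRep_ι, cliffordMul_e,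
    cliffordMul_e, Matrix.add_mulVec, Matrix.smul_mulVec, cliffordMatrix_plane_mulVec,
    Algebra.algebraMap_eq_smul_one, Matrix.smul_mulVec, Matrix.one_mulVec]
  have h : cexp (-(I * ((ε j : ℤ) : ℂ) * (angle j / 2 : ℝ))) =
      (Real.cos (angle j / 2) : ℂ) + (Real.sin (angle j / 2) : ℂ) * (-I * ((ε j : ℤ) : ℂ)) := by
    rcases Int.units_eq_one_or (ε j) with h | h <;> rw [h]
    · rw [show -(I * (((1 : ℤˣ) : ℤ) : ℂ) * (angle j / 2 : ℝ)) = (-(angle j / 2 : ℝ) : ℂ) * I by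
        simp; ring, Complex.exp_mul_I, Complex.cos_neg, Complex.sin_neg]
      push_cast
      simp
    · rw [show -(I * (((-1 : ℤˣ) : ℤ) : ℂ) * (angle j / 2 : ℝ)) = ((angle j / 2 : ℝ) : ℂ) * I by
        simp; ring, Complex.exp_mul_I]
      push_cast
      simp
  rw [h, add_smul, mul_smul _ (-I * _), Complex.coe_smul, Complex.coe_smul]

/-- The factor `r j` acts by e^{-iε_jθ} with θ = `angle j / 2` = π(j+1)/n, and these exponents add
up to -πi μ_ε/n. -/
theorem spinRep_α_mulVec (ε : Fin k → ℤˣ) :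
    (spinRep M.e M.α).mulVec (eigVec ε) =
      cexp (-(Real.pi * I * mu ε / (2 * k + 1))) • eigVec ε := by
  have h : ∀ L : List (Fin k), (spinRep M.e (L.map M.r).prod).mulVec (eigVec ε) =
      cexp (L.map fun j => -(I * ((ε j : ℤ) : ℂ) * (angle j / 2 : ℝ))).sum • eigVec ε := fun L => by
    induction L with
    | nil => simp
    | cons j L ih =>
      rw [List.map_cons, List.prod_cons, map_mul, ← Matrix.mulVec_mulVec, ih, Matrix.mulVec_smul,
        spinRep_r_mulVec, smul_smul, List.map_cons, List.sum_cons, Complex.exp_add, mul_comm]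
  rw [α, h]
  congr 2
  rw [← List.ofFn_eq_map, List.sum_ofFn, mu]
  push_cast
  rw [Finset.mul_sum, Finset.sum_div, ← Finset.sum_neg_distrib]
  refine Finset.sum_congr rfl fun j _ => ?_
  rw [angle]
  push_cast
  ring

/-- The lift `w` of `A` acts on the spinor `eigVec ε` by `e^{πi (h - μ_ε / n)}`. -/
def ActsWithParity (w : spinGroup (cliffordForm V)) (h : ℤ) : Prop :=
  ∀ ε : Fin k → ℤˣ, (spinRep M.e (w : CliffordAlgebra (cliffordForm V))).mulVec (eigVec ε) =
    cexp (Real.pi * I * (h - mu ε / (2 * k + 1))) • eigVec ε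

theorem αPlus_actsWithParity : M.ActsWithParity M.αPlus (k * (k + 1) / 2 : ℕ) := fun ε => by
  have h1 : ∀ N : ℕ, cexp (Real.pi * I * (((N : ℤ) : ℂ) - mu ε / (2 * k + 1))) =
      (-1) ^ N * cexp (-(Real.pi * I * mu ε / (2 * k + 1))) := fun N => by
    rw [← Complex.exp_pi_mul_I, ← Complex.exp_nat_mul, ← Complex.exp_add]
    congr 1
    push_cast
    ring
  rw [h1, mul_smul, ← M.spinRep_α_mulVec, αPlus]
  simp only [map_mul, map_pow, map_neg, map_one]
  rcases Nat.even_or_odd (k * (k + 1) / 2) with h | h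
  · rw [h.neg_one_pow, h.neg_one_pow, one_mul, one_smul]
  · rw [h.neg_one_pow, h.neg_one_pow, neg_one_mul, Matrix.neg_mulVec, neg_one_smul]

theorem αMinus_actsWithParity : M.ActsWithParity M.αMinus ((k * (k + 1) / 2 : ℕ) + 1) := fun ε => by
  have h := M.αPlus_actsWithParity ε
  have h1 : cexp (Real.pi * I *
      (((((k * (k + 1) / 2 : ℕ) : ℤ) + 1 : ℤ) : ℂ) - mu ε / (2 * k + 1))) =
      -cexp (Real.pi * I * ((((k * (k + 1) / 2 : ℕ) : ℤ) : ℂ) - mu ε / (2 * k + 1))) := by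
    rw [neg_eq_neg_one_mul, ← Complex.exp_pi_mul_I, ← Complex.exp_add]
    congr 1
    push_cast
    ring
  have h2 : (M.αMinus : CliffordAlgebra (cliffordForm V)) =
      -(M.αPlus : CliffordAlgebra (cliffordForm V)) := by
    simp [αMinus, αPlus]
  rw [h1, neg_smul, ← h, h2, map_neg, Matrix.neg_mulVec]

end CHDManifold
end FlatSpin

/-! ### The isometry g, the axis, and periodicity of spinors -/

namespace FlatSpin
namespace CHDManifold

open Complex

variable {k : ℕ} {V : Type*} [NormedAddCommGroup V] [InnerProductSpace ℝ V]
  (M : CHDManifold k V)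

theorem holonomyMap_pow_plane (j : Fin k) (m : ℕ) :
    (holonomyMap M.a ^ m) (M.e (idx₁ j)) =
      Real.cos (m * angle j) • M.e (idx₁ j) + Real.sin (m * angle j) • M.e (idx₂ j) ∧
    (holonomyMap M.a ^ m) (M.e (idx₂ j)) =
      -Real.sin (m * angle j) • M.e (idx₁ j) + Real.cos (m * angle j) • M.e (idx₂ j) := by
  induction m with
  | zero => simp
  | succ m ih =>
    rw [pow_succ', Module.End.mul_apply, Module.End.mul_apply, ih.1, ih.2]
    simp only [map_add, map_smul, M.rot₁, M.rot₂]
    have h : ((m + 1 : ℕ) : ℝ) * angle j = m * angle j + angle j := by push_cast; ring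
    rw [h, Real.cos_add, Real.sin_add]
    constructor <;> module

theorem fin_cases_plane (i : Fin (2 * k + 1)) :
    i = Fin.last (2 * k) ∨ ∃ j : Fin k, i = idx₁ j ∨ i = idx₂ j := by
  by_cases hi : i = Fin.last (2 * k)
  · exact Or.inl hi
  · have hlt : (i : ℕ) < 2 * k := Fin.val_lt_last hi
    refine Or.inr ⟨⟨i / 2, by omega⟩, ?_⟩
    rcases Nat.even_or_odd' (i : ℕ) with ⟨m, hm | hm⟩
    · left; ext; simp only [idx₁]; omega
    · right; ext; simp only [idx₂]; omega

/-- In each plane n times the rotation angle is a multiple of 2π, and the axis is fixed. -/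
theorem A_pow_card (x : V) : (M.A^[2 * k + 1]) x = x := by
  have h1 : ∀ m : ℕ, M.A^[m] x = (holonomyMap M.a ^ m) x := fun m => by
    rw [Module.End.pow_apply]
    rfl
  rw [h1]
  have key : holonomyMap M.a ^ (2 * k + 1) = 1 := by
    refine M.e.toBasis.ext fun i => ?_
    rw [OrthonormalBasis.coe_toBasis, Module.End.one_apply]
    rcases fin_cases_plane i with rfl | ⟨j, hj⟩
    · rw [Module.End.pow_apply, Function.iterate_fixed]
      rw [M.e_last]
      exact M.A_last
    · have ha : ((2 * k + 1 : ℕ) : ℝ) * angle j = ((j + 1 : ℕ) : ℝ) * (2 * Real.pi) := by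
        rw [angle]; push_cast; field_simp
      have h2 := M.holonomyMap_pow_plane j (2 * k + 1)
      rw [ha, Real.cos_nat_mul_two_pi,
        show Real.sin (((j + 1 : ℕ) : ℝ) * (2 * Real.pi)) = 0 by
          have := Real.sin_nat_mul_pi ((j + 1) * 2)
          rw [← this]; congr 1; push_cast; ring] at h2
      rcases hj with rfl | rfl
      · simpa using h2.1
      · simpa using h2.2
  rw [key, Module.End.one_apply]

/-- The axis direction `e_n = a_n`. -/
def axis : V := M.a (Fin.last (2 * k))

theorem norm_axis : ‖M.axis‖ = 1 := by
  rw [axis, ← M.e_last, M.e.norm_eq_one]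

theorem inner_axis_self : inner ℝ M.axis M.axis = (1 : ℝ) := by
  rw [real_inner_self_eq_norm_sq, norm_axis, one_pow]

theorem A_axis : M.A M.axis = M.axis := M.A_last

theorem inner_A (x y : V) : inner ℝ (M.A x) (M.A y) = inner ℝ x y := M.A.inner_map_map x y

theorem inner_A_axis (x : V) : inner ℝ (M.A x) M.axis = inner ℝ x M.axis := by
  conv_lhs => rw [← M.A_axis, inner_A]

/-- Since A is an isometry fixing the axis, the product with the axis is a constant c along the
chain a_1, …, a_{n-1}; the relation for A(a_{n-1}) gives c = -2k c. -/
theorem inner_a_axis (j : Fin (2 * k + 1)) (hj : (j : ℕ) < 2 * k) :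
    inner ℝ (M.a j) M.axis = (0 : ℝ) := by
  have hk : 0 < 2 * k := by omega
  have hstep : ∀ (i : ℕ) (hi : i + 1 < 2 * k),
      inner ℝ (M.a ⟨i + 1, by omega⟩) M.axis = inner ℝ (M.a ⟨i, by omega⟩) M.axis := fun i hi => by
    rw [← M.inner_A_axis (M.a ⟨i, _⟩), A_apply, holonomyMap, Module.Basis.constr_basis, dif_pos hi]
  have hall : ∀ (i : ℕ) (hi : i < 2 * k),
      inner ℝ (M.a ⟨i, by omega⟩) M.axis = inner ℝ (M.a ⟨0, by omega⟩) M.axis := fun i => by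
    induction i with
    | zero => intro _; rfl
    | succ i ih => intro hi; rw [hstep i hi, ih (by omega)]
  have hlast := M.inner_A_axis (M.a ⟨2 * k - 1, by omega⟩)
  rw [A_apply, holonomyMap, Module.Basis.constr_basis, dif_neg (by simp only; omega),
    if_pos (by simp only; omega), hall _ (by omega), inner_neg_left, sum_inner,
    Fin.sum_univ_castSucc] at hlast
  simp only [Fin.val_castSucc, Fin.is_lt, if_true, Fin.val_last, lt_irrefl, if_false,
    inner_zero_left, add_zero] at hlast
  have hc : ∀ i : Fin (2 * k),
      inner ℝ (M.a i.castSucc) M.axis = inner ℝ (M.a ⟨0, by omega⟩) M.axis := fun i => hall i i.2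
  rw [Finset.sum_congr rfl fun i _ => hc i, Finset.sum_const, Finset.card_univ, Fintype.card_fin,
    nsmul_eq_mul] at hlast
  have h0 : inner ℝ (M.a ⟨0, by omega⟩) M.axis = (0 : ℝ) := by
    have : ((2 * k : ℕ) + 1 : ℝ) * inner ℝ (M.a ⟨0, by omega⟩) M.axis = 0 := by linarith
    exact (mul_eq_zero.1 this).resolve_left (by positivity)
  have := hall j hj
  rw [h0] at this
  exact this

theorem g_eq (x : V) : M.g x = (1 / (2 * k + 1) : ℝ) • M.axis + M.A x := rfl

theorem g_iterate (m : ℕ) (x : V) :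
    M.g^[m] x = (m / (2 * k + 1) : ℝ) • M.axis + M.A^[m] x := by
  induction m with
  | zero => simp
  | succ m ih =>
    rw [Function.iterate_succ_apply', ih, g_eq, map_add, map_smul, A_axis, ← add_assoc,
      ← add_smul, Function.iterate_succ_apply']
    congr 2
    push_cast
    ring

theorem g_iterate_two_card (x : V) : M.g^[2 * (2 * k + 1)] x = (2 : ℝ) • M.axis + x := by
  have h : M.A^[2 * (2 * k + 1)] x = x := by
    rw [two_mul (2 * k + 1), Function.iterate_add_apply, A_pow_card, A_pow_card]
  rw [g_iterate, h]
  congr 2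
  push_cast
  field_simp

-- The 2n-th power of e^{πi(h - μ/n)} is e^{2πi(nh - μ)} = 1. The n-th power is only a sign, which
-- is why the period along the axis is taken to be 2a_n.
variable {M} in
theorem ActsWithParity.pow_two_card {w : spinGroup (cliffordForm V)} {h : ℤ}
    (hp : M.ActsWithParity w h) (v : Spinor k) :
    ((spinRep M.e (w : CliffordAlgebra (cliffordForm V))).mulVec^[2 * (2 * k + 1)]) v = v := by
  set N := spinRep M.e (w : CliffordAlgebra (cliffordForm V))
  have h1 : ∀ (m : ℕ) (u : Spinor k), N.mulVec^[m] u = (N ^ m).mulVec u := fun m u => by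
    induction m with
    | zero => simp
    | succ m ih => rw [Function.iterate_succ_apply', ih, pow_succ', Matrix.mulVec_mulVec]
  rw [h1]
  have key : (N ^ (2 * (2 * k + 1))).mulVecLin = LinearMap.id := by
    refine (eigBasis k).ext fun ε => ?_
    have h2 : ∀ m : ℕ, (N ^ m).mulVec (eigVec ε) =
        cexp (m * (Real.pi * I * (h - mu ε / (2 * k + 1)))) • eigVec ε := fun m => by
      induction m with
      | zero => simp
      | succ m ih =>
        rw [pow_succ', ← Matrix.mulVec_mulVec, ih, Matrix.mulVec_smul, hp ε, smul_smul,
          ← Complex.exp_add]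
        congr 2
        push_cast
        ring
    have hk : (2 * k + 1 : ℂ) ≠ 0 := by exact_mod_cast (by omega : 2 * k + 1 ≠ 0)
    rw [Matrix.mulVecLin_apply, eigBasis_apply, h2, LinearMap.id_apply]
    have : (((2 * (2 * k + 1) : ℕ) : ℂ) * (Real.pi * I * (h - mu ε / (2 * k + 1)))) =
        ((((2 * k + 1 : ℕ) : ℤ) * h - mu ε : ℤ) : ℂ) * (2 * Real.pi * I) := by
      push_cast
      field_simp
    rw [this, Complex.exp_int_mul_two_pi_mul_I, one_smul]
  exact LinearMap.congr_fun key v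

-- Equivariance passes to products and inverses, so it has to be tested on the generators of Γ only.
variable {M} in
theorem mem_spinors_spinStructureOf {w : spinGroup (cliffordForm V)}
    (hw : ∀ x : V, (w : CliffordAlgebra (cliffordForm V)) * ι _ x * star (w : CliffordAlgebra _) =
      ι _ (M.A x)) {φ : V → Spinor k} :
    φ ∈ spinors (M.spinStructureOf w hw) ↔ ContDiff ℝ ∞ φ ∧
      (∀ j : Fin (2 * k + 1), (j : ℕ) < 2 * k → ∀ x, φ (M.a j + x) = φ x) ∧
      ∀ x, φ (M.g x) = (spinRep M.e (w : CliffordAlgebra (cliffordForm V))).mulVec (φ x) := by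
  constructor
  · rintro ⟨hs, he⟩
    refine ⟨hs, fun j hj x => ?_, fun x => ?_⟩
    · have := he ⟨M.translation j, Subgroup.subset_closure (Or.inl ⟨j, hj, rfl⟩)⟩ x
      rw [M.spinStructureOf_translation w hw j hj] at this
      simpa [translation_apply] using this
    · have := he ⟨M.g, Subgroup.subset_closure (Or.inr rfl)⟩ x
      rwa [M.spinStructureOf_g w hw] at this
  · rintro ⟨hs, ha, hg⟩
    refine ⟨hs, ?_⟩
    have key : ∀ (γ : V ≃ᵃⁱ[ℝ] V) (hγ : γ ∈ M.Γ), ∀ x, φ (γ x) =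
        (spinRep M.e ((M.spinStructureOf w hw).lift ⟨γ, hγ⟩ :
          CliffordAlgebra (cliffordForm V))).mulVec (φ x) := by
      intro γ hγ
      induction hγ using Subgroup.closure_induction with
      | mem γ h =>
        intro x
        rcases h with ⟨j, hj, rfl⟩ | rfl
        · rw [M.spinStructureOf_translation w hw j hj, translation_apply, ha j hj]
          simp
        · rw [hg, M.spinStructureOf_g w hw]
      | one =>
        intro x
        have : (⟨1, one_mem _⟩ : M.Γ) = 1 := rfl
        rw [this, map_one]
        simp
      | mul γ δ hγ hδ ih1 ih2 =>
        intro x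
        have : (⟨γ * δ, mul_mem hγ hδ⟩ : M.Γ) = ⟨γ, hγ⟩ * ⟨δ, hδ⟩ := rfl
        rw [this, map_mul, AffineIsometryEquiv.coe_mul, Function.comp_apply, ih1, ih2,
          Matrix.mulVec_mulVec, Submonoid.coe_mul, map_mul]
      | inv γ hγ ih =>
        intro x
        have hx : γ (γ⁻¹ x) = x := γ.apply_symm_apply x
        have := ih (γ⁻¹ x)
        rw [hx] at this
        rw [this, Matrix.mulVec_mulVec, ← map_mul, ← Submonoid.coe_mul, ← map_mul]
        have h1 : (⟨γ⁻¹, inv_mem hγ⟩ : M.Γ) * ⟨γ, hγ⟩ = 1 := inv_mul_cancel (⟨γ, hγ⟩ : M.Γ)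
        rw [h1, map_one]
        simp
    exact fun γ x => key γ γ.2 x

/-- The lattice basis `a_1, …, a_{n-1}, 2 a_n`, under which all spinors are periodic. -/
def periodBasis : Module.Basis (Fin (2 * k + 1)) ℝ V :=
  M.a.isUnitSMul (w := fun j => if (j : ℕ) < 2 * k then 1 else 2) fun j => by
    split_ifs <;> simp

theorem periodBasis_of_lt {j : Fin (2 * k + 1)} (hj : (j : ℕ) < 2 * k) :
    M.periodBasis j = M.a j := by
  simp [periodBasis, Module.Basis.isUnitSMul_apply, hj]

theorem periodBasis_last : M.periodBasis (Fin.last (2 * k)) = (2 : ℝ) • M.axis := by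
  simp [periodBasis, Module.Basis.isUnitSMul_apply, axis]

variable {M} in
theorem periodic_of_mem_spinors {w : spinGroup (cliffordForm V)}
    {hw : ∀ x : V, (w : CliffordAlgebra (cliffordForm V)) * ι _ x * star (w : CliffordAlgebra _) =
      ι _ (M.A x)} {h : ℤ} (hp : M.ActsWithParity w h) {φ : V → Spinor k}
    (hφ : φ ∈ spinors (M.spinStructureOf w hw)) (j : Fin (2 * k + 1)) (x : V) :
    φ (M.periodBasis j + x) = φ x := by
  obtain ⟨-, ha, hg⟩ := (mem_spinors_spinStructureOf hw).1 hφ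
  by_cases hj : (j : ℕ) < 2 * k
  · rw [periodBasis_of_lt M hj, ha j hj]
  · have : j = Fin.last (2 * k) := by ext; simp; omega
    rw [this, periodBasis_last, ← g_iterate_two_card]
    have hm : ∀ m : ℕ, φ (M.g^[m] x) =
        (spinRep M.e (w : CliffordAlgebra (cliffordForm V))).mulVec^[m] (φ x) := fun m => by
      induction m with
      | zero => rfl
      | succ m ih => rw [Function.iterate_succ_apply', hg, ih, Function.iterate_succ_apply']
    rw [hm, hp.pow_two_card]

end CHDManifold
end FlatSpin

/-! ### Eigenspaces of the Dirac operator in terms of Fourier coefficients -/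

namespace FlatSpin
namespace CHDManifold

open Complex

variable {k : ℕ} {V : Type*} [NormedAddCommGroup V] [InnerProductSpace ℝ V]
  (M : CHDManifold k V)

/-- The families `v` of Fourier coefficients of the eigenspinors `∑_u e^{2πi ⟨u, x⟩} v_u` with
eigenvalue `l`. -/
def spectralModel (w : spinGroup (cliffordForm V)) (l : ℝ) : Submodule ℂ (V → Spinor k) where
  carrier := {v |
    (∀ j : Fin (2 * k + 1), (j : ℕ) < 2 * k → ∀ u, planeWave u (M.a j) • v u = v u) ∧
    (∀ u, (2 * Real.pi * I : ℂ) • (cliffordMul M.e u).mulVec (v u) = (l : ℂ) • v u) ∧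
    ∀ u, planeWave u ((1 / (2 * k + 1) : ℝ) • M.axis) • v (M.A u) =
      (spinRep M.e (w : CliffordAlgebra (cliffordForm V))).mulVec (v u)}
  zero_mem' := by simp
  add_mem' := fun {v v'} hv hv' => ⟨fun j hj u => by
      rw [Pi.add_apply, smul_add, hv.1 j hj, hv'.1 j hj], fun u => by
      rw [Pi.add_apply, Matrix.mulVec_add, smul_add, hv.2.1, hv'.2.1, smul_add], fun u => by
      rw [Pi.add_apply, smul_add, hv.2.2, hv'.2.2, Pi.add_apply, Matrix.mulVec_add]⟩
  smul_mem' := fun c v hv => ⟨fun j hj u => by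
      rw [Pi.smul_apply, smul_comm, hv.1 j hj], fun u => by
      rw [Pi.smul_apply, Matrix.mulVec_smul, smul_comm, hv.2.1, smul_comm], fun u => by
      rw [Pi.smul_apply, smul_comm, hv.2.2, Pi.smul_apply, Matrix.mulVec_smul]⟩

theorem cliffordMul_mulVec_mulVec (u : V) (v : Spinor k) :
    (cliffordMul M.e u).mulVec ((cliffordMul M.e u).mulVec v) = (-(‖u‖ ^ 2 : ℝ) : ℂ) • v := by
  rw [Matrix.mulVec_mulVec, cliffordMul_sq, cliffordForm_apply, Algebra.algebraMap_eq_smul_one,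
    Matrix.smul_mulVec, Matrix.one_mulVec, ← ofReal_neg, Complex.coe_smul]

/-- Applying 2πi u twice multiplies `v` by 4π²‖u‖², which must equal l². -/
theorem norm_eq_of_clifford_eigen {u : V} {v : Spinor k} {l : ℝ}
    (h : (2 * Real.pi * I : ℂ) • (cliffordMul M.e u).mulVec v = (l : ℂ) • v) (hv : v ≠ 0) :
    2 * Real.pi * ‖u‖ = |l| := by
  have h1 := congrArg (fun y => (2 * Real.pi * I : ℂ) • (cliffordMul M.e u).mulVec y) h
  simp only [Matrix.mulVec_smul, cliffordMul_mulVec_mulVec] at h1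
  rw [smul_comm (2 * Real.pi * I : ℂ) (l : ℂ), h, smul_smul, smul_smul, smul_smul] at h1
  have h2 := smul_left_injective ℂ hv h1
  have h3 : (2 * Real.pi * ‖u‖) ^ 2 = |l| ^ 2 := by
    rw [sq_abs]
    have : (((2 * Real.pi * ‖u‖) ^ 2 : ℝ) : ℂ) = ((l ^ 2 : ℝ) : ℂ) := by
      push_cast
      push_cast at h2
      linear_combination h2 + 4 * (Real.pi : ℂ) ^ 2 * (‖u‖ : ℂ) ^ 2 * I_sq
    exact_mod_cast this
  exact (sq_eq_sq₀ (by positivity) (abs_nonneg _)).1 h3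

theorem finite_frequencies (l : ℝ) : (Metric.closedBall (0 : V) (|l| / (2 * Real.pi)) ∩
    (Submodule.span ℤ (Set.range (innerDual M.periodBasis)) : Set V)).Finite := by
  have : FiniteDimensional ℝ V := M.a.finiteDimensional_of_finite
  have : ProperSpace V := FiniteDimensional.proper ℝ V
  exact ZSpan.setFinite_inter _ Metric.isBounded_closedBall

/-- The frequencies of the eigenspinors with eigenvalue `l`. -/
def eigenFreq (l : ℝ) : Finset V := by
  classical exact (M.finite_frequencies l).toFinset.filter fun u => 2 * Real.pi * ‖u‖ = |l|

theorem mem_eigenFreq {l : ℝ} {u : V} : u ∈ M.eigenFreq l ↔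
    u ∈ Submodule.span ℤ (Set.range (innerDual M.periodBasis)) ∧ 2 * Real.pi * ‖u‖ = |l| := by
  rw [eigenFreq, Finset.mem_filter, Set.Finite.mem_toFinset, Set.mem_inter_iff,
    mem_closedBall_zero_iff]
  constructor
  · rintro ⟨⟨-, h⟩, h'⟩
    exact ⟨h, h'⟩
  · rintro ⟨h, h'⟩
    refine ⟨⟨le_of_eq ?_, h⟩, h'⟩
    rw [← h']
    field_simp

theorem dualFreq_mem_span (m : Fin (2 * k + 1) → ℤ) : dualFreq M.periodBasis m ∈
    Submodule.span ℤ (Set.range (innerDual M.periodBasis)) := by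
  refine Submodule.sum_mem _ fun i _ => ?_
  rw [Int.cast_smul_eq_zsmul]
  exact Submodule.smul_mem _ _ (Submodule.subset_span ⟨i, rfl⟩)

/-- The products of `u` with the lattice basis are integers, and they are the dual coordinates of
`u`. -/
theorem exists_dualFreq_of_planeWave {u : V}
    (h : ∀ j, planeWave u (M.periodBasis j) = 1) : ∃ m, u = dualFreq M.periodBasis m := by
  have h1 : ∀ j, ∃ m : ℤ, inner ℝ u (M.periodBasis j) = m := fun j => by
    obtain ⟨m, hm⟩ := Complex.exp_eq_one_iff.1 (h j)
    refine ⟨m, ?_⟩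
    rw [mul_comm] at hm
    exact_mod_cast mul_right_cancel₀ two_pi_I_ne_zero hm
  choose m hm using h1
  refine ⟨m, ?_⟩
  refine ext_inner_right ℝ fun x => ?_
  rw [inner_dualFreq]
  conv_lhs => rw [← M.periodBasis.sum_equivFun x]
  rw [inner_sum]
  refine Finset.sum_congr rfl fun j _ => ?_
  rw [inner_smul_right, hm, mul_comm]

variable {M} {w : spinGroup (cliffordForm V)} {h : ℤ} {l : ℝ}

/-- Finite support is not imposed on the model. It follows because a nonzero coefficient forces
`planeWave u` to be trivial on the period lattice, which puts `u` in the dual lattice, and on a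
sphere. -/
theorem mem_eigenFreq_of_spectralModel (hp : M.ActsWithParity w h) {v : V → Spinor k}
    (hv : v ∈ M.spectralModel w l) {u : V} (hu : v u ≠ 0) : u ∈ M.eigenFreq l := by
  obtain ⟨h1, h2, h3⟩ := hv
  refine M.mem_eigenFreq.2 ⟨?_, M.norm_eq_of_clifford_eigen (h2 u) hu⟩
  have hper : ∀ j, planeWave u (M.periodBasis j) = 1 := by
    intro j
    have hone : ∀ c : ℂ, c • v u = v u → c = 1 := fun c hc =>
      smul_left_injective ℂ hu (by simpa using hc)
    by_cases hj : (j : ℕ) < 2 * k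
    · rw [periodBasis_of_lt M hj]
      exact hone _ (h1 j hj u)
    · have : j = Fin.last (2 * k) := by ext; simp; omega
      rw [this, periodBasis_last]
      apply hone
      -- Iterating the g-condition 2n times returns to the frequency `u` and to the identity on
      -- spinors; what is left is the character at 2a_n.
      have hm : ∀ m : ℕ, planeWave u ((m / (2 * k + 1) : ℝ) • M.axis) • v (M.A^[m] u) =
          (spinRep M.e (w : CliffordAlgebra (cliffordForm V))).mulVec^[m] (v u) := fun m => by
        induction m with
        | zero => simp [planeWave_zero_right]
        | succ m ih =>
          have e1 : (((m + 1 : ℕ) : ℝ) / (2 * k + 1) : ℝ) • M.axis =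
              (m / (2 * k + 1) : ℝ) • M.axis + (1 / (2 * k + 1) : ℝ) • M.axis := by
            rw [← add_smul]; congr 1; push_cast; ring
          have e2 : planeWave u ((1 / (2 * k + 1) : ℝ) • M.axis) =
              planeWave (M.A^[m] u) ((1 / (2 * k + 1) : ℝ) • M.axis) := by
            have : inner ℝ (M.A^[m] u) M.axis = inner ℝ u M.axis := by
              clear ih e1
              induction m with
              | zero => rfl
              | succ m ih => rw [Function.iterate_succ_apply', inner_A_axis, ih]
            rw [planeWave, planeWave, inner_smul_right, inner_smul_right, this]
          rw [e1, planeWave_add, mul_smul, Function.iterate_succ_apply', e2, h3,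
            ← Matrix.mulVec_smul, ih, Function.iterate_succ_apply']
      have := hm (2 * (2 * k + 1))
      rw [hp.pow_two_card, two_mul (2 * k + 1), Function.iterate_add_apply, A_pow_card,
        A_pow_card] at this
      have e : (((2 * k + 1 + (2 * k + 1) : ℕ) : ℝ) / (2 * k + 1) : ℝ) = 2 := by
        push_cast
        field_simp
        ring
      rwa [e] at this
  obtain ⟨m, rfl⟩ := M.exists_dualFreq_of_planeWave hper
  exact M.dualFreq_mem_span m

/-- The spinor with Fourier coefficients `v`. -/
def synthesis (v : V → Spinor k) (x : V) : Spinor k := ∑ᶠ u, planeWave u x • v u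

theorem synthesis_eq_sum {S : Finset V} {v : V → Spinor k} (hS : ∀ u, v u ≠ 0 → u ∈ S) (x : V) :
    synthesis v x = ∑ u ∈ S, planeWave u x • v u :=
  finsum_eq_sum_of_support_subset _ fun u hu => hS u fun h0 => hu (by simp [h0])

theorem eq_zero_of_synthesis_eq_zero {S : Finset V} {v : V → Spinor k}
    (hS : ∀ u, v u ≠ 0 → u ∈ S) (h0 : ∀ x, synthesis v x = 0) : v = 0 := by
  funext u
  by_contra hu
  exact hu (planeWave_independent S v (fun x => by rw [← synthesis_eq_sum hS, h0]) u (hS u hu))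

theorem synthesis_contDiff {S : Finset V} {v : V → Spinor k} (hS : ∀ u, v u ≠ 0 → u ∈ S) :
    ContDiff ℝ ∞ (synthesis v) := by
  rw [show synthesis v = fun x => ∑ u ∈ S, planeWave u x • v u from
    funext (synthesis_eq_sum hS)]
  exact ContDiff.sum fun u _ => (planeWave_contDiff u).smul contDiff_const

/-- Differentiating a plane wave along e_j brings down 2πi⟨u, e_j⟩, and ∑ ⟨u, e_j⟩ e_j = u. -/
theorem diracFun_synthesis {S : Finset V} {v : V → Spinor k} (hS : ∀ u, v u ≠ 0 → u ∈ S) :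
    M.diracFun (synthesis v) =
      synthesis fun u => (2 * Real.pi * I : ℂ) • (cliffordMul M.e u).mulVec (v u) := by
  funext x
  have hS' : ∀ u, (2 * Real.pi * I : ℂ) • (cliffordMul M.e u).mulVec (v u) ≠ 0 → u ∈ S :=
    fun u hu => hS u fun h0 => hu (by simp [h0])
  rw [synthesis_eq_sum hS', diracFun]
  have hd : ∀ y, fderiv ℝ (synthesis v) x y =
      ∑ u ∈ S, planeWave u x • (2 * Real.pi * I * (inner ℝ u y : ℝ) : ℂ) • v u := fun y => by
    rw [show synthesis v = fun x => ∑ u ∈ S, planeWave u x • v u from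
      funext (synthesis_eq_sum hS)]
    have := HasFDerivAt.fun_sum (u := S) fun u _ =>
      (planeWave_hasFDerivAt u x).smul_const (v u)
    rw [this.fderiv]
    simp [mul_smul]
  simp only [hd, Matrix.mulVec_sum, Matrix.mulVec_smul]
  rw [Finset.sum_comm]
  refine Finset.sum_congr rfl fun u _ => ?_
  rw [cliffordMul_apply, Matrix.sum_mulVec, Finset.smul_sum, Finset.smul_sum]
  refine Finset.sum_congr rfl fun j _ => ?_
  rw [Matrix.smul_mulVec, mul_smul, Complex.coe_smul, real_inner_comm]

/-- Reindex the frequencies by A and use ⟨Au, Ax⟩ = ⟨u, x⟩ and ⟨Au, a_n⟩ = ⟨u, a_n⟩. -/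
theorem synthesis_g (v : V → Spinor k) (x : V) : synthesis v (M.g x) =
    synthesis (fun u => planeWave u ((1 / (2 * k + 1) : ℝ) • M.axis) • v (M.A u)) x := by
  refine (finsum_comp_equiv M.A.toEquiv).symm.trans (finsum_congr fun u => ?_)
  change planeWave (M.A u) (M.g x) • v (M.A u) = _
  have h1 : planeWave (M.A u) (M.g x) =
      planeWave u x * planeWave u ((1 / (2 * k + 1) : ℝ) • M.axis) := by
    rw [g_eq, planeWave_add, mul_comm]
    simp only [planeWave, inner_smul_right, inner_A_axis, inner_A]
  rw [h1, mul_smul]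

theorem synthesis_mem_spinors {hw : ∀ x : V, (w : CliffordAlgebra (cliffordForm V)) * ι _ x *
      star (w : CliffordAlgebra _) = ι _ (M.A x)} (hp : M.ActsWithParity w h) {v : V → Spinor k}
    (hv : v ∈ M.spectralModel w l) : synthesis v ∈ spinors (M.spinStructureOf w hw) := by
  have hS := fun u => mem_eigenFreq_of_spectralModel hp hv (u := u)
  refine (mem_spinors_spinStructureOf hw).2 ⟨synthesis_contDiff hS, fun j hj x => ?_, fun x => ?_⟩
  · refine finsum_congr fun u => ?_
    rw [planeWave_add, mul_comm, mul_smul, hv.1 j hj]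
  · rw [synthesis_g, funext hv.2.2, synthesis_eq_sum hS, Matrix.mulVec_sum, synthesis_eq_sum
      (S := M.eigenFreq l) fun u hu => hS u fun h0 => hu (by simp [h0])]
    simp only [Matrix.mulVec_smul]

/-- Each transformation law of the spinor says that a finite combination of plane waves vanishes, so
it holds coefficient by coefficient. -/
theorem mem_spectralModel_of_synthesis {S : Finset V} {v : V → Spinor k}
    (hS : ∀ u, v u ≠ 0 → u ∈ S)
    (hc : ∀ u, (2 * Real.pi * I : ℂ) • (cliffordMul M.e u).mulVec (v u) = (l : ℂ) • v u)
    (ha : ∀ j : Fin (2 * k + 1), (j : ℕ) < 2 * k → ∀ x, synthesis v (M.a j + x) = synthesis v x)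
    (hg : ∀ x, synthesis v (M.g x) =
      (spinRep M.e (w : CliffordAlgebra (cliffordForm V))).mulVec (synthesis v x)) :
    v ∈ M.spectralModel w l := by
  classical
  refine ⟨fun j hj u => ?_, hc, fun u => ?_⟩
  · have hS' : ∀ u, planeWave u (M.a j) • v u - v u ≠ 0 → u ∈ S := fun u hu =>
      hS u fun h0 => hu (by simp [h0])
    have := eq_zero_of_synthesis_eq_zero hS' (v := fun u => planeWave u (M.a j) • v u - v u)
      fun x => by
        have h1 := ha j hj x
        rw [synthesis_eq_sum hS, synthesis_eq_sum hS, ← sub_eq_zero, ← Finset.sum_sub_distrib] at h1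
        rw [synthesis_eq_sum hS', ← h1]
        refine Finset.sum_congr rfl fun u _ => ?_
        rw [planeWave_add, mul_comm (planeWave u _), mul_smul, smul_sub]
    exact sub_eq_zero.1 (congrFun this u)
  · set N := spinRep M.e (w : CliffordAlgebra (cliffordForm V))
    set c : V → ℂ := fun u => planeWave u ((1 / (2 * k + 1) : ℝ) • M.axis) with hcdef
    -- Both `v` and `v ∘ A` must be supported in the common finite set.
    set T : Finset V := S ∪ S.image M.A.symm with hT
    have hST : ∀ u, v u ≠ 0 → u ∈ T := fun u hu => Finset.mem_union_left _ (hS u hu)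
    have hAT : ∀ u, v (M.A u) ≠ 0 → u ∈ T := fun u hu =>
      Finset.mem_union_right _ (Finset.mem_image.2 ⟨M.A u, hS _ hu, M.A.symm_apply_apply u⟩)
    have hS' : ∀ u, c u • v (M.A u) - N.mulVec (v u) ≠ 0 → u ∈ T := fun u hu => by
      by_contra hu'
      refine hu ?_
      have h1 : v u = 0 := by_contra fun h => hu' (hST u h)
      have h2 : v (M.A u) = 0 := by_contra fun h => hu' (hAT u h)
      simp [h1, h2]
    have := eq_zero_of_synthesis_eq_zero hS' (v := fun u => c u • v (M.A u) - N.mulVec (v u))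
      fun x => by
        have h1 := hg x
        rw [synthesis_g, synthesis_eq_sum (S := T) (fun u hu => hAT u fun h0 => hu
            (by simp only [h0, smul_zero])),
          synthesis_eq_sum hST, ← sub_eq_zero, Matrix.mulVec_sum, ← Finset.sum_sub_distrib] at h1
        rw [synthesis_eq_sum hS', ← h1]
        refine Finset.sum_congr rfl fun u _ => ?_
        rw [Matrix.mulVec_smul, smul_sub]
    exact sub_eq_zero.1 (congrFun this u)

/-- The coefficients are the lattice Fourier coefficients, extended by 0 to frequencies outside the
dual lattice. The eigenvalue equation already holds coefficientwise, so only finitely many are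
nonzero and the expansion is exact. -/
theorem exists_synthesis_eq {hw : ∀ x : V, (w : CliffordAlgebra (cliffordForm V)) * ι _ x *
      star (w : CliffordAlgebra _) = ι _ (M.A x)} (hp : M.ActsWithParity w h) {φ : V → Spinor k}
    (hφ : φ ∈ spinors (M.spinStructureOf w hw)) (hl : M.diracFun φ = (l : ℂ) • φ) :
    ∃ v ∈ M.spectralModel w l, synthesis v = φ := by
  classical
  obtain ⟨hs, ha, hg⟩ := (mem_spinors_spinStructureOf hw).1 hφ
  set b := M.periodBasis with hb
  have hper := periodic_of_mem_spinors hp hφ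
  have hs1 : ContDiff ℝ 1 φ := hs.of_le (by exact_mod_cast le_top)
  set v : V → Spinor k := Function.extend (dualFreq b) (latticeCoeff b φ) 0 with hv
  have hvm : ∀ m, v (dualFreq b m) = latticeCoeff b φ m := fun m =>
    (dualFreq_injective b).extend_apply _ _ m
  have hv0 : ∀ u, (¬ ∃ m, dualFreq b m = u) → v u = 0 := fun u hu =>
    Function.extend_apply' _ _ _ hu
  have hcl : ∀ u, (2 * Real.pi * I : ℂ) • (cliffordMul M.e u).mulVec (v u) = (l : ℂ) • v u := by
    intro u
    by_cases hu : ∃ m, dualFreq b m = u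
    · obtain ⟨m, rfl⟩ := hu
      rw [hvm]
      have h1 : latticeCoeff b ((l : ℂ) • φ) m = (l : ℂ) • latticeCoeff b φ m := by
        have := latticeCoeff_sum_mulVec b (fun _ : Unit => (l : ℂ) • (1 : SpinorEnd k))
          (φ := fun _ => φ) (fun _ => hs.continuous) m
        simp only [Finset.univ_unique, Finset.sum_singleton, Matrix.smul_mulVec,
          Matrix.one_mulVec] at this
        exact this
      rw [← h1, ← hl]
      have h2 := latticeCoeff_sum_mulVec b (cliffordMatrix k)
        (φ := fun j x => fderiv ℝ φ x (M.e j))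
        (fun j => (hs1.continuous_fderiv one_ne_zero).clm_apply continuous_const) m
      have h3 : M.diracFun φ = fun x => ∑ j, (cliffordMatrix k j).mulVec (fderiv ℝ φ x (M.e j)) :=
        rfl
      rw [h3, h2, cliffordMul_apply, Matrix.sum_mulVec, Finset.smul_sum]
      refine Finset.sum_congr rfl fun j _ => ?_
      rw [latticeCoeff_fderiv b hper hs1, Matrix.mulVec_smul, Matrix.smul_mulVec,
        mul_smul (2 * Real.pi * I : ℂ), Complex.coe_smul, real_inner_comm]
    · rw [hv0 u hu]; simp
  have hS : ∀ u, v u ≠ 0 → u ∈ M.eigenFreq l := fun u hu => by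
    refine M.mem_eigenFreq.2 ⟨?_, M.norm_eq_of_clifford_eigen (hcl u) hu⟩
    by_contra hu'
    refine hu (hv0 u ?_)
    rintro ⟨m, rfl⟩
    exact hu' (M.dualFreq_mem_span m)
  have hsyn : synthesis v = φ := by
    funext x
    have hfin := (M.eigenFreq l).finite_toSet.preimage (dualFreq_injective b).injOn
    rw [eq_sum_latticeCoeff b hper hs.continuous hfin.toFinset
      (fun m hm => by
        by_contra h0
        refine hm (hfin.mem_toFinset.2 (hS _ ?_))
        rwa [hvm]) x,
      synthesis_eq_sum (S := hfin.toFinset.image (dualFreq b)),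
      Finset.sum_image (dualFreq_injective b).injOn]
    · simp only [hvm]
    · intro u hu
      have hu' : ∃ m, dualFreq b m = u := by_contra fun h => hu (hv0 u h)
      obtain ⟨m, rfl⟩ := hu'
      exact Finset.mem_image_of_mem _ (hfin.mem_toFinset.2 (hS _ hu))
  refine ⟨v, ?_, hsyn⟩
  rw [← hsyn] at ha hg
  exact mem_spectralModel_of_synthesis hS hcl ha hg

/-- The eigenspace of the Dirac operator in terms of Fourier coefficients. -/
theorem nonempty_spectralModel_equiv (hw : ∀ x : V, (w : CliffordAlgebra (cliffordForm V)) * ι _ x *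
      star (w : CliffordAlgebra _) = ι _ (M.A x)) (hp : M.ActsWithParity w h) (l : ℝ) :
    Nonempty (M.spectralModel w l ≃ₗ[ℂ] (dirac (M.spinStructureOf w hw)).eigenspace (l : ℂ)) := by
  have hS := fun (v : M.spectralModel w l) u => mem_eigenFreq_of_spectralModel hp v.2 (u := u)
  let f₀ : M.spectralModel w l →ₗ[ℂ] spinors (M.spinStructureOf w hw) :=
    { toFun := fun v => ⟨synthesis v, synthesis_mem_spinors hp v.2⟩
      map_add' := fun v v' => by
        ext1
        funext x
        change synthesis ((v + v' : M.spectralModel w l) : V → Spinor k) x =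
          synthesis v x + synthesis v' x
        rw [synthesis_eq_sum (hS _), synthesis_eq_sum (hS _), synthesis_eq_sum (hS _),
          ← Finset.sum_add_distrib]
        exact Finset.sum_congr rfl fun u _ => smul_add _ _ _
      map_smul' := fun c v => by
        ext1
        funext x
        change synthesis ((c • v : M.spectralModel w l) : V → Spinor k) x = c • synthesis v x
        rw [synthesis_eq_sum (hS _), synthesis_eq_sum (hS _), Finset.smul_sum]
        exact Finset.sum_congr rfl fun u _ => smul_comm (planeWave u x) c ((v : V → Spinor k) u) }
  have hmem : ∀ v, f₀ v ∈ (dirac (M.spinStructureOf w hw)).eigenspace (l : ℂ) := fun v => by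
    rw [Module.End.mem_eigenspace_iff]
    ext1
    change M.diracFun (synthesis v) = (l : ℂ) • synthesis v
    rw [diracFun_synthesis (hS v), funext v.2.2.1]
    have := congrArg Subtype.val (f₀.map_smul (l : ℂ) v)
    exact this
  refine ⟨LinearEquiv.ofBijective (f₀.codRestrict _ hmem) ⟨?_, ?_⟩⟩
  · rw [injective_iff_map_eq_zero]
    intro v hv
    have h1 : synthesis (v : V → Spinor k) = 0 :=
      congrArg (fun y => ((y : spinors (M.spinStructureOf w hw)) : V → Spinor k))
        (congrArg Subtype.val hv)
    exact Subtype.ext (eq_zero_of_synthesis_eq_zero (hS v) fun x => congrFun h1 x)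
  · rintro ⟨φ, hφ⟩
    rw [Module.End.mem_eigenspace_iff] at hφ
    obtain ⟨v, hv, hvφ⟩ := exists_synthesis_eq hp φ.2 (l := l) (congrArg Subtype.val hφ)
    refine ⟨⟨v, hv⟩, ?_⟩
    ext1
    ext1
    exact hvφ

end CHDManifold
end FlatSpin

/-! ### Separation of the axis, and spectral symmetry off the axis -/

namespace FlatSpin
namespace CHDManifold

open Complex

variable {k : ℕ} {V : Type*} [NormedAddCommGroup V] [InnerProductSpace ℝ V]
  (M : CHDManifold k V)

/-- Elements of the spectral model that are supported in the set `L` of frequencies. -/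
def spectralModelOn (w : spinGroup (cliffordForm V)) (l : ℝ) (L : Set V) :
    Submodule ℂ (V → Spinor k) :=
  M.spectralModel w l ⊓
    { carrier := {v | ∀ u ∉ L, v u = 0}
      zero_mem' := fun _ _ => rfl
      add_mem' := fun {v v'} hv hv' u hu => by rw [Pi.add_apply, hv u hu, hv' u hu, add_zero]
      smul_mem' := fun c v hv u hu => by rw [Pi.smul_apply, hv u hu, smul_zero] }

/-- The line through the axis direction. -/
def axisLine : Set V := {u | ∃ t : ℝ, u = t • M.axis}

theorem A_smul_axis (t : ℝ) : M.A (t • M.axis) = t • M.axis := by rw [map_smul, A_axis]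

theorem A_mem_axisLine {u : V} : M.A u ∈ M.axisLine ↔ u ∈ M.axisLine := by
  constructor
  · rintro ⟨t, ht⟩
    exact ⟨t, M.A.injective (by rw [ht, A_smul_axis])⟩
  · rintro ⟨t, rfl⟩
    exact ⟨t, M.A_smul_axis t⟩

variable {M} {w : spinGroup (cliffordForm V)} {h : ℤ} {l : ℝ}

open Classical in
theorem indicator_mem_spectralModelOn {L : Set V} (hL : ∀ u, M.A u ∈ L ↔ u ∈ L)
    {v : V → Spinor k} (hv : v ∈ M.spectralModel w l) :
    L.indicator v ∈ M.spectralModelOn w l L := by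
  refine ⟨⟨fun j hj u => ?_, fun u => ?_, fun u => ?_⟩, fun u hu => Set.indicator_of_notMem hu v⟩
  · by_cases hu : u ∈ L
    · rw [Set.indicator_of_mem hu, hv.1 j hj]
    · rw [Set.indicator_of_notMem hu, smul_zero]
  · by_cases hu : u ∈ L
    · rw [Set.indicator_of_mem hu, hv.2.1]
    · rw [Set.indicator_of_notMem hu, Matrix.mulVec_zero, smul_zero, smul_zero]
  · by_cases hu : u ∈ L
    · rw [Set.indicator_of_mem hu, Set.indicator_of_mem ((hL u).2 hu), hv.2.2]
    · rw [Set.indicator_of_notMem hu, Set.indicator_of_notMem (fun h => hu ((hL u).1 h)),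
        Matrix.mulVec_zero, smul_zero]

/-- This gives finite multiplicities and also the bound of the multiplicity by the number of lattice
points on a sphere, needed for convergence. -/
theorem exists_injective_restriction (hp : M.ActsWithParity w h) :
    ∃ f : M.spectralModel w l →ₗ[ℂ] (M.eigenFreq l → Spinor k), Function.Injective f := by
  refine ⟨(LinearMap.funLeft ℂ (Spinor k) (Subtype.val : M.eigenFreq l → V)).comp
    (M.spectralModel w l).subtype, ?_⟩
  rw [injective_iff_map_eq_zero]
  intro v hv
  ext1
  funext u
  by_contra hu
  exact hu (congrFun hv ⟨u, mem_eigenFreq_of_spectralModel hp v.2 hu⟩)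

theorem finiteDimensional_spectralModel (hp : M.ActsWithParity w h) (l : ℝ) :
    FiniteDimensional ℂ (M.spectralModel w l) := by
  obtain ⟨f, hf⟩ := exists_injective_restriction hp (l := l)
  exact FiniteDimensional.of_injective f hf

theorem finrank_spectralModel_le (hp : M.ActsWithParity w h) (l : ℝ) :
    Module.finrank ℂ (M.spectralModel w l) ≤ (M.eigenFreq l).card * 2 ^ k := by
  obtain ⟨f, hf⟩ := exists_injective_restriction hp (l := l)
  refine (LinearMap.finrank_le_finrank_of_injective hf).trans (le_of_eq ?_)
  rw [Module.finrank_pi_fintype]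
  simp

theorem finiteDimensional_spectralModelOn (hp : M.ActsWithParity w h) (l : ℝ) (L : Set V) :
    FiniteDimensional ℂ (M.spectralModelOn w l L) := by
  have := finiteDimensional_spectralModel hp l
  exact Submodule.finiteDimensional_of_le (inf_le_left : M.spectralModelOn w l L ≤ _)

/-- The only relation between different frequencies links u to Au, and A preserves the axis and its
complement, so a family may be cut into its two parts. -/
theorem finrank_spectralModel_eq_add (hp : M.ActsWithParity w h) (l : ℝ) :
    Module.finrank ℂ (M.spectralModel w l) =
      Module.finrank ℂ (M.spectralModelOn w l M.axisLine) +
      Module.finrank ℂ (M.spectralModelOn w l M.axisLineᶜ) := by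
  have := finiteDimensional_spectralModelOn hp l M.axisLine
  have := finiteDimensional_spectralModelOn hp l M.axisLineᶜ
  have hsup : M.spectralModelOn w l M.axisLine ⊔ M.spectralModelOn w l M.axisLineᶜ =
      M.spectralModel w l := by
    refine le_antisymm (sup_le inf_le_left inf_le_left) fun v hv => ?_
    rw [← Set.indicator_self_add_compl M.axisLine v]
    exact Submodule.add_mem_sup
      (indicator_mem_spectralModelOn (fun u => M.A_mem_axisLine) hv)
      (indicator_mem_spectralModelOn (fun u => not_congr M.A_mem_axisLine) hv)
  have hinf : M.spectralModelOn w l M.axisLine ⊓ M.spectralModelOn w l M.axisLineᶜ = ⊥ := by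
    rw [eq_bot_iff]
    rintro v ⟨h1, h2⟩
    rw [Submodule.mem_bot]
    funext u
    by_cases hu : u ∈ M.axisLine
    · exact h2.2 u fun h => h hu
    · exact h1.2 u hu
  have := Submodule.finrank_sup_add_finrank_inf_eq (M.spectralModelOn w l M.axisLine)
    (M.spectralModelOn w l M.axisLineᶜ)
  rw [hsup, hinf, finrank_bot, add_zero] at this
  exact this

theorem cliffordMul_anticomm {x y : V} (hxy : inner ℝ x y = (0 : ℝ)) :
    cliffordMul M.e x * cliffordMul M.e y = -(cliffordMul M.e y * cliffordMul M.e x) := by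
  rw [← spinRep_ι, ← spinRep_ι, ← map_mul (spinRep M.e), ← map_mul (spinRep M.e),
    ← map_neg (spinRep M.e)]
  congr 1
  rw [eq_neg_iff_add_eq_zero, ι_mul_ι_add_swap]
  have : QuadraticMap.polar (cliffordForm V) x y = 0 := by
    simp only [QuadraticMap.polar, cliffordForm_apply, norm_add_sq_real, hxy]
    ring
  rw [this, map_zero]

theorem cliffordMul_A_mul (hw : ∀ x : V, (w : CliffordAlgebra (cliffordForm V)) * ι _ x *
      star (w : CliffordAlgebra _) = ι _ (M.A x)) (x : V) :
    cliffordMul M.e (M.A x) * spinRep M.e (w : CliffordAlgebra (cliffordForm V)) =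
      spinRep M.e (w : CliffordAlgebra (cliffordForm V)) * cliffordMul M.e x := by
  rw [← spinRep_ι, ← spinRep_ι, ← map_mul (spinRep M.e), ← map_mul (spinRep M.e), ← hw, mul_assoc,
    spinGroup.coe_star_mul_self, mul_one]

variable (M) in
/-- A vector orthogonal to `u` in the plane of `u` and the axis. -/
def axialNormal (u : V) : V :=
  ‖u - inner ℝ u M.axis • M.axis‖ ^ 2 • M.axis -
    inner ℝ u M.axis • (u - inner ℝ u M.axis • M.axis)

/-- The vector is built from `u` and the axis by inner products alone, and A is an isometry that
fixes the axis. -/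
theorem axialNormal_A (u : V) : M.axialNormal (M.A u) = M.A (M.axialNormal u) := by
  have h1 : M.A u - inner ℝ (M.A u) M.axis • M.axis = M.A (u - inner ℝ u M.axis • M.axis) := by
    rw [inner_A_axis, map_sub, A_smul_axis]
  rw [axialNormal, h1, LinearIsometryEquiv.norm_map, inner_A_axis, axialNormal, map_sub M.A (_ • _),
    A_smul_axis, map_smul]

theorem inner_sub_axis (u : V) : inner ℝ (u - inner ℝ u M.axis • M.axis) M.axis = (0 : ℝ) := by
  rw [inner_sub_left, inner_smul_left, inner_axis_self]
  simp

theorem inner_axialNormal (u : V) : inner ℝ u (M.axialNormal u) = (0 : ℝ) := by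
  set u' := u - inner ℝ u M.axis • M.axis with hu'
  have hu : inner ℝ u u' = ‖u'‖ ^ 2 := by
    have h1 : u = u' + inner ℝ u M.axis • M.axis := by rw [hu']; abel
    conv_lhs => rw [h1]
    rw [inner_add_left, inner_smul_left, real_inner_comm u' M.axis, show inner ℝ u' M.axis = (0 : ℝ) from
      inner_sub_axis u, mul_zero, add_zero, real_inner_self_eq_norm_sq]
  rw [axialNormal, inner_sub_right, inner_smul_right, inner_smul_right, ← hu', hu]
  ring

/-- Its component along the axis is the squared norm of the part of `u` orthogonal to the axis. -/
theorem axialNormal_ne_zero {u : V} (hu : u ∉ M.axisLine) : M.axialNormal u ≠ 0 := by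
  intro h0
  have h1 : inner ℝ (M.axialNormal u) M.axis = ‖u - inner ℝ u M.axis • M.axis‖ ^ 2 := by
    rw [axialNormal, inner_sub_left, inner_smul_left, inner_smul_left, inner_sub_axis,
      inner_axis_self]
    simp
  rw [h0, inner_zero_left] at h1
  have h2 := norm_eq_zero.1 (pow_eq_zero_iff (two_ne_zero)|>.1 h1.symm)
  exact hu ⟨_, sub_eq_zero.1 h2⟩

/-- Multiply each v_u by `axialNormal u`. Anticommutation with `u` changes l into -l, equivariance
under A and w preserves the g-condition, and the map is injective because a nonzero vector squares
to a nonzero scalar. -/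
theorem finrank_off_axis_le (hw : ∀ x : V, (w : CliffordAlgebra (cliffordForm V)) * ι _ x *
      star (w : CliffordAlgebra _) = ι _ (M.A x)) (hp : M.ActsWithParity w h) (l : ℝ) :
    Module.finrank ℂ (M.spectralModelOn w l M.axisLineᶜ) ≤
      Module.finrank ℂ (M.spectralModelOn w (-l) M.axisLineᶜ) := by
  have := finiteDimensional_spectralModelOn hp (-l) M.axisLineᶜ
  let f₀ : (V → Spinor k) →ₗ[ℂ] (V → Spinor k) :=
    { toFun := fun v u => (cliffordMul M.e (M.axialNormal u)).mulVec (v u)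
      map_add' := fun v v' => by funext u; simp [Matrix.mulVec_add]
      map_smul' := fun c v => by funext u; simp [Matrix.mulVec_smul] }
  have hf₀ : ∀ v ∈ M.spectralModelOn w l M.axisLineᶜ,
      f₀ v ∈ M.spectralModelOn w (-l) M.axisLineᶜ := by
    rintro v ⟨⟨h1, h2, h3⟩, h4⟩
    refine ⟨⟨fun j hj u => ?_, fun u => ?_, fun u => ?_⟩, fun u hu => ?_⟩
    · change _ • (cliffordMul M.e (M.axialNormal u)).mulVec (v u) = _
      rw [← Matrix.mulVec_smul, h1 j hj]
      rfl
    · change _ • (cliffordMul M.e u).mulVec ((cliffordMul M.e (M.axialNormal u)).mulVec (v u)) =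
        _ • (cliffordMul M.e (M.axialNormal u)).mulVec (v u)
      rw [Matrix.mulVec_mulVec, cliffordMul_anticomm (inner_axialNormal u), Matrix.neg_mulVec,
        ← Matrix.mulVec_mulVec, smul_neg, ← Matrix.mulVec_smul, h2, Matrix.mulVec_smul]
      simp
    · change _ • (cliffordMul M.e (M.axialNormal (M.A u))).mulVec (v (M.A u)) =
        (spinRep M.e _).mulVec ((cliffordMul M.e (M.axialNormal u)).mulVec (v u))
      rw [← Matrix.mulVec_smul, h3, axialNormal_A, Matrix.mulVec_mulVec, cliffordMul_A_mul hw,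
        Matrix.mulVec_mulVec]
    · change (cliffordMul M.e (M.axialNormal u)).mulVec (v u) = 0
      rw [h4 u hu, Matrix.mulVec_zero]
  refine LinearMap.finrank_le_finrank_of_injective (f := f₀.restrict hf₀) ?_
  rw [injective_iff_map_eq_zero]
  rintro ⟨v, hv⟩ hv0
  ext1
  funext u
  by_cases hu : u ∈ M.axisLine
  · exact hv.2 u fun h => h hu
  · have h1 : (cliffordMul M.e (M.axialNormal u)).mulVec (v u) = 0 :=
      congrFun (congrArg Subtype.val hv0) u
    have h2 := congrArg (cliffordMul M.e (M.axialNormal u)).mulVec h1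
    rw [cliffordMul_mulVec_mulVec, Matrix.mulVec_zero] at h2
    refine (smul_eq_zero.1 h2).resolve_left ?_
    have := norm_ne_zero_iff.2 (axialNormal_ne_zero hu)
    simpa using this

theorem finrank_off_axis_neg (hw : ∀ x : V, (w : CliffordAlgebra (cliffordForm V)) * ι _ x *
      star (w : CliffordAlgebra _) = ι _ (M.A x)) (hp : M.ActsWithParity w h) (l : ℝ) :
    Module.finrank ℂ (M.spectralModelOn w (-l) M.axisLineᶜ) =
      Module.finrank ℂ (M.spectralModelOn w l M.axisLineᶜ) := by
  refine le_antisymm ?_ (finrank_off_axis_le hw hp l)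
  have := finrank_off_axis_le hw hp (-l)
  rwa [neg_neg] at this

/-! ### The spectrum carried by the axis -/

/-- The eigenvalues of the Dirac operator on the spinors that depend only on the last coordinate. -/
def axisEigenvalue (h : ℤ) (ε : Fin k → ℤˣ) (q : ℤ) : ℝ :=
  2 * Real.pi * ((∏ j, ε j : ℤˣ) : ℤ) * ((mu ε : ℝ) / 2 - (2 * k + 1) * h / 2 + (2 * k + 1) * q)

/-- The position on the axis of the frequency of the eigenspinor of type `ε`. -/
def axisFreq (l : ℝ) (ε : Fin k → ℤˣ) : ℝ := -(l * ((∏ j, ε j : ℤˣ) : ℤ)) / (2 * Real.pi)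

theorem units_coe_mul_self (s : ℤˣ) : ((s : ℤ) : ℝ) * ((s : ℤ) : ℝ) = 1 := by
  rcases Int.units_eq_one_or s with rfl | rfl <;> simp

/-- The Clifford equation fixes the axis coordinate t = `axisFreq l ε`, and the g-condition reads
e^{2πi t/n} = e^{πi(h - μ/n)}. Solving it for t modulo n and returning to l = -2π t ∏ ε_j yields the
progression. -/
theorem exists_axisEigenvalue_eq_iff (h : ℤ) (l : ℝ) (ε : Fin k → ℤˣ) :
    (∃ q, axisEigenvalue h ε q = l) ↔
      cexp (2 * Real.pi * I * (axisFreq l ε / (2 * k + 1) : ℝ)) =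
        cexp (Real.pi * I * (h - mu ε / (2 * k + 1))) := by
  have hs := units_coe_mul_self (∏ j, ε j)
  set s : ℝ := (((∏ j, ε j : ℤˣ) : ℤ) : ℝ) with hsdef
  have hπ := Real.pi_ne_zero
  have hk : (2 * (k : ℝ) + 1) ≠ 0 := by positivity
  have hl : axisFreq l ε = -(l * s) / (2 * Real.pi) := rfl
  rw [Complex.exp_eq_exp_iff_exists_int]
  -- The minus sign before `q` comes from the one in `axisFreq`.
  have key : ∀ q : ℤ, axisEigenvalue h ε (-q) = l ↔
      axisFreq l ε / (2 * k + 1) * 2 = (h - mu ε / (2 * k + 1)) + q * 2 := fun q => by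
    rw [hl, axisEigenvalue, ← hsdef]
    push_cast
    constructor
    · intro e
      rw [← e]
      field_simp
      linear_combination (-(mu ε : ℝ) + (2 * k + 1) * h + 2 * (2 * k + 1) * q) * hs
    · intro e
      field_simp at e
      linear_combination s * e + l * hs
  have key2 : ∀ q : ℤ, (2 * Real.pi * I * (axisFreq l ε / (2 * k + 1) : ℝ) : ℂ) =
      Real.pi * I * (h - mu ε / (2 * k + 1)) + q * (2 * Real.pi * I) ↔
      axisFreq l ε / (2 * k + 1) * 2 = (h - mu ε / (2 * k + 1)) + q * 2 := fun q => by
    have e1 : ((axisFreq l ε / (2 * k + 1) * 2 : ℝ) : ℂ) =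
        (((h - mu ε / (2 * k + 1)) + q * 2 : ℝ) : ℂ) ↔
        axisFreq l ε / (2 * k + 1) * 2 = (h - mu ε / (2 * k + 1)) + q * 2 := ofReal_inj
    rw [← e1]
    have hπI : (Real.pi * I : ℂ) ≠ 0 := mul_ne_zero (by exact_mod_cast hπ) I_ne_zero
    constructor
    · intro e
      apply mul_left_cancel₀ hπI
      push_cast at e ⊢
      linear_combination e
    · intro e
      push_cast at e ⊢
      linear_combination (Real.pi * I : ℂ) * e
  constructor
  · rintro ⟨q, hq⟩
    refine ⟨-q, ?_⟩
    have := (key2 (-q)).2 ((key (-q)).1 (by rwa [neg_neg]))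
    exact this
  · rintro ⟨q, hq⟩
    exact ⟨-q, (key q).2 ((key2 q).1 hq)⟩

theorem cliffordMul_smul_axis_mulVec (t : ℝ) (ε : Fin k → ℤˣ) :
    (cliffordMul M.e (t • M.axis)).mulVec (eigVec ε) =
      (t * (I * ((∏ j, ε j : ℤˣ) : ℤ))) • eigVec ε := by
  rw [map_smul, axis, ← M.e_last, cliffordMul_e, Matrix.smul_mulVec, cliffordMatrix_last_mulVec,
    mul_smul (t : ℂ), Complex.coe_smul]

theorem planeWave_smul_axis (t s : ℝ) :
    planeWave (t • M.axis) (s • M.axis) = cexp (2 * Real.pi * I * (t * s : ℝ)) := by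
  rw [planeWave, inner_smul_left, inner_smul_right, inner_axis_self]
  simp

/-- On the axis A acts trivially, so both conditions become scalar equations for each coordinate. A
nonzero coordinate can be cancelled, which determines its frequency and restricts l. -/
theorem axis_coord_eq_zero (hp : M.ActsWithParity w h) {v : V → Spinor k}
    (hv : v ∈ M.spectralModel w l) (t : ℝ) (ε : Fin k → ℤˣ)
    (hc : (eigBasis k).repr (v (t • M.axis)) ε ≠ 0) :
    t = axisFreq l ε ∧ ∃ q, axisEigenvalue h ε q = l := by
  obtain ⟨-, h2, h3⟩ := hv
  have e2 := congrArg (fun y => (eigBasis k).repr y ε) (h2 (t • M.axis))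
  have e3 := congrArg (fun y => (eigBasis k).repr y ε) (h3 (t • M.axis))
  simp only [LinearEquiv.map_smul, Finsupp.smul_apply, smul_eq_mul,
    mulVec_eigBasis_repr (fun ε => cliffordMul_smul_axis_mulVec t ε),
    mulVec_eigBasis_repr hp, A_smul_axis, planeWave_smul_axis] at e2 e3
  rw [← mul_assoc] at e2
  have e2' := mul_right_cancel₀ hc e2
  have e3' := mul_right_cancel₀ hc e3
  have hs := units_coe_mul_self (∏ j, ε j)
  have ht : t = axisFreq l ε := by
    have hr : -(2 * Real.pi * t * (((∏ j, ε j : ℤˣ) : ℤ) : ℝ)) = l := by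
      have : ((-(2 * Real.pi * t * (((∏ j, ε j : ℤˣ) : ℤ) : ℝ)) : ℝ) : ℂ) = (l : ℂ) := by
        rw [← e2']
        simp only [ofReal_neg, ofReal_mul, ofReal_intCast, ofReal_ofNat]
        linear_combination (-2 * Real.pi * t * (((∏ j, ε j : ℤˣ) : ℤ) : ℂ)) * I_sq
      exact_mod_cast this
    rw [axisFreq, ← hr]
    field_simp
    linear_combination -t * hs
  refine ⟨ht, (exists_axisEigenvalue_eq_iff h l ε).2 ?_⟩
  rw [← e3', ht]
  congr 3
  ring

open Classical in
theorem single_mem_spectralModelOn (hp : M.ActsWithParity w h) {ε : Fin k → ℤˣ}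
    (hε : ∃ q, axisEigenvalue h ε q = l) :
    (Pi.single (axisFreq l ε • M.axis) (eigVec ε) : V → Spinor k) ∈
      M.spectralModelOn w l M.axisLine := by
  have hval : ∀ u, u ≠ axisFreq l ε • M.axis →
      (Pi.single (axisFreq l ε • M.axis) (eigVec ε) : V → Spinor k) u = 0 := fun u hu =>
    Pi.single_eq_of_ne hu _
  refine ⟨⟨fun j hj u => ?_, fun u => ?_, fun u => ?_⟩, fun u hu => ?_⟩
  · by_cases hu : u = axisFreq l ε • M.axis
    · subst hu
      rw [planeWave, inner_smul_left, real_inner_comm, M.inner_a_axis j hj]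
      simp
    · rw [hval u hu, smul_zero]
  · by_cases hu : u = axisFreq l ε • M.axis
    · subst hu
      rw [Pi.single_eq_same, cliffordMul_smul_axis_mulVec, smul_smul]
      congr 1
      have hs : ((((∏ j, ε j : ℤˣ) : ℤ) : ℂ)) * (((∏ j, ε j : ℤˣ) : ℤ) : ℂ) = 1 := by
        exact_mod_cast congrArg (fun x : ℝ => (x : ℂ)) (units_coe_mul_self (∏ j, ε j))
      have hπ : (Real.pi : ℂ) ≠ 0 := by exact_mod_cast Real.pi_ne_zero
      simp only [axisFreq, ofReal_div, ofReal_neg, ofReal_mul, ofReal_intCast, ofReal_ofNat]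
      field_simp
      linear_combination (-l * (((∏ j, ε j : ℤˣ) : ℤ) : ℂ) ^ 2) * I_sq + l * hs
    · rw [hval u hu, Matrix.mulVec_zero, smul_zero, smul_zero]
  · by_cases hu : u = axisFreq l ε • M.axis
    · subst hu
      rw [A_smul_axis, Pi.single_eq_same, hp ε, planeWave_smul_axis,
        ← (exists_axisEigenvalue_eq_iff h l ε).1 hε, mul_one_div]
    · rw [hval u hu, hval (M.A u) (fun hu' => hu (M.A.injective (by rw [hu', A_smul_axis]))),
        Matrix.mulVec_zero, smul_zero]
  · exact hval u fun hu' => hu ⟨_, hu'⟩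

-- For given l, a type `ε` lives at the single frequency `axisFreq l ε`, where its coordinate is
-- free if l lies in the progression of `ε` and zero otherwise.
open Classical in
theorem finrank_axis (hp : M.ActsWithParity w h) (l : ℝ) :
    Module.finrank ℂ (M.spectralModelOn w l M.axisLine) =
      Fintype.card {ε : Fin k → ℤˣ // ∃ q, axisEigenvalue h ε q = l} := by
  let f : M.spectralModelOn w l M.axisLine →ₗ[ℂ]
      ({ε : Fin k → ℤˣ // ∃ q, axisEigenvalue h ε q = l} → ℂ) :=
    { toFun := fun v ε => (eigBasis k).repr ((v : V → Spinor k) (axisFreq l ε.1 • M.axis)) ε.1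
      map_add' := fun v v' => by funext ε; simp
      map_smul' := fun c v => by funext ε; simp }
  have hf : Function.Bijective f := by
    constructor
    · rw [injective_iff_map_eq_zero]
      intro v hv
      ext1
      funext u
      by_cases hu : u ∈ M.axisLine
      · obtain ⟨t, rfl⟩ := hu
        refine (eigBasis k).repr.injective ?_
        ext ε
        by_contra hc
        have hc' : (eigBasis k).repr ((v : V → Spinor k) (t • M.axis)) ε ≠ 0 := by simpa using hc
        obtain ⟨ht, hε⟩ := axis_coord_eq_zero hp v.2.1 t ε hc'
        have := congrFun hv ⟨ε, hε⟩
        rw [ht] at hc'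
        exact hc' this
      · exact v.2.2 u hu
    · intro c
      refine ⟨∑ ε, c ε • ⟨_, single_mem_spectralModelOn hp ε.2⟩, ?_⟩
      rw [map_sum]
      funext δ
      rw [Finset.sum_apply, Finset.sum_eq_single δ]
      · simp only [map_smul, Pi.smul_apply, smul_eq_mul]
        change c δ * (eigBasis k).repr ((Pi.single (axisFreq l δ.1 • M.axis) (eigVec δ.1) :
          V → Spinor k) (axisFreq l δ.1 • M.axis)) δ.1 = c δ
        rw [Pi.single_eq_same, ← eigBasis_apply, Module.Basis.repr_self, Finsupp.single_eq_same,
          mul_one]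
      · intro ε _ hε
        simp only [map_smul, Pi.smul_apply, smul_eq_mul]
        change c ε * (eigBasis k).repr ((Pi.single (axisFreq l ε.1 • M.axis) (eigVec ε.1) :
          V → Spinor k) (axisFreq l δ.1 • M.axis)) δ.1 = 0
        by_cases h1 : axisFreq l δ.1 • M.axis = axisFreq l ε.1 • M.axis
        · rw [h1, Pi.single_eq_same, ← eigBasis_apply, Module.Basis.repr_self,
            Finsupp.single_eq_of_ne (fun h => hε (Subtype.ext h.symm)), mul_zero]
        · rw [Pi.single_eq_of_ne h1, map_zero, Finsupp.zero_apply, mul_zero]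
      · simp
  rw [(LinearEquiv.ofBijective f hf).finrank_eq, Module.finrank_fintype_fun_eq_card]

end CHDManifold
end FlatSpin

/-! ### The eta series of the axis part -/

namespace FlatSpin
namespace CHDManifold

open Complex HurwitzZeta

variable {k : ℕ} {V : Type*} [NormedAddCommGroup V] [InnerProductSpace ℝ V]

/-- The contribution `sgn l |l|^{-z}` of the eigenvalue `l` to the eta function. -/
def etaTerm (z : ℂ) (l : ℝ) : ℂ := ((Real.sign l : ℝ) : ℂ) * ((|l| : ℝ) : ℂ) ^ (-z)

theorem etaTerm_zero (z : ℂ) : etaTerm z 0 = 0 := by simp [etaTerm]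

theorem etaTerm_neg (z : ℂ) (l : ℝ) : etaTerm z (-l) = -etaTerm z l := by
  simp [etaTerm, Real.sign_neg]

theorem norm_etaTerm_le (z : ℂ) (l : ℝ) : ‖etaTerm z l‖ ≤ |l| ^ (-z.re) := by
  rcases eq_or_ne l 0 with rfl | hl
  · rw [etaTerm_zero, norm_zero]
    positivity
  · have h1 : ‖((Real.sign l : ℝ) : ℂ)‖ ≤ 1 := by
      rcases Real.sign_apply_eq l with h | h | h <;> rw [h] <;> simp
    rw [etaTerm, norm_mul, norm_cpow_eq_rpow_re_of_pos (abs_pos.2 hl), neg_re]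
    exact mul_le_of_le_one_left (by positivity) h1

theorem etaTerm_mul_unit {c : ℝ} (hc : 0 < c) (s : ℤˣ) (z : ℂ) (x : ℝ) :
    etaTerm z (c * ((s : ℤ) : ℝ) * x) =
      ((s : ℤ) : ℂ) * (c : ℂ) ^ (-z) * (SignType.sign x / ((|x| : ℝ) : ℂ) ^ z) := by
  have hpos : ∀ x : ℝ, etaTerm z (c * x) =
      (c : ℂ) ^ (-z) * (SignType.sign x / ((|x| : ℝ) : ℂ) ^ z) := fun x => by
    have h1 : Real.sign (c * x) = ((SignType.sign x : SignType) : ℝ) := by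
      rcases lt_trichotomy x 0 with h | rfl | h
      · rw [Real.sign_of_neg (mul_neg_of_pos_of_neg hc h), sign_neg h]; simp
      · simp
      · rw [Real.sign_of_pos (mul_pos hc h), sign_pos h]; simp
    rw [etaTerm, h1, abs_mul, abs_of_pos hc, ofReal_mul, mul_cpow_ofReal_nonneg hc.le (abs_nonneg _),
      cpow_neg ((|x| : ℝ) : ℂ)]
    have h2 : (((SignType.sign x : SignType) : ℝ) : ℂ) = ((SignType.sign x : SignType) : ℂ) := by
      cases SignType.sign x <;> simp
    rw [h2]
    ring
  rcases Int.units_eq_one_or s with rfl | rfl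
  · simp [hpos]
  · have : c * (((-1 : ℤˣ) : ℤ) : ℝ) * x = -(c * x) := by simp
    rw [this, etaTerm_neg, hpos]
    simp

/-- The class modulo `1` of the frequencies of type `ε`, divided by `n`. -/
def axisShift (h : ℤ) (ε : Fin k → ℤˣ) : ℝ := ((mu ε : ℝ) / 2 - (2 * k + 1) * h / 2) / (2 * k + 1)

theorem axisEigenvalue_eq (h : ℤ) (ε : Fin k → ℤˣ) (q : ℤ) : axisEigenvalue h ε q =
    2 * Real.pi * (2 * k + 1) * ((∏ j, ε j : ℤˣ) : ℤ) * (q + axisShift h ε) := by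
  have hk : (2 * (k : ℝ) + 1) ≠ 0 := by positivity
  rw [axisEigenvalue, axisShift]
  field_simp
  ring

theorem axisEigenvalue_injective (h : ℤ) (ε : Fin k → ℤˣ) :
    Function.Injective (axisEigenvalue h ε) := by
  intro q q' hq
  rw [axisEigenvalue_eq, axisEigenvalue_eq] at hq
  have hs : (((∏ j, ε j : ℤˣ) : ℤ) : ℝ) ≠ 0 := fun h0 => by
    have := units_coe_mul_self (∏ j, ε j)
    rw [h0] at this
    simp at this
  have hc : 2 * Real.pi * (2 * k + 1) * ((∏ j, ε j : ℤˣ) : ℤ) ≠ 0 :=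
    mul_ne_zero (by positivity) hs
  have := mul_left_cancel₀ hc hq
  exact_mod_cast add_right_cancel this

/-- The eta function of the spinors of type `ε` that depend only on the last coordinate. -/
def axisEta (h : ℤ) (ε : Fin k → ℤˣ) (z : ℂ) : ℂ :=
  (((∏ j, ε j : ℤˣ) : ℤ) : ℂ) * ((2 * Real.pi * (2 * k + 1) : ℝ) : ℂ) ^ (-z) *
    (2 * hurwitzZetaOdd (axisShift h ε : UnitAddCircle) z)

/-- The two-sided series of the odd Hurwitz zeta function carries a factor 1/2, undone by the 2 in
`axisEta`. -/
theorem hasSum_axisEta (h : ℤ) (ε : Fin k → ℤˣ) {z : ℂ} (hz : 1 < z.re) :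
    HasSum (fun q => etaTerm z (axisEigenvalue h ε q)) (axisEta h ε z) := by
  have h1 := ((hasSum_int_hurwitzZetaOdd (axisShift h ε) hz).mul_left 2).mul_left
    ((((∏ j, ε j : ℤˣ) : ℤ) : ℂ) * ((2 * Real.pi * (2 * k + 1) : ℝ) : ℂ) ^ (-z))
  refine h1.congr_fun fun q => ?_
  rw [axisEigenvalue_eq, etaTerm_mul_unit (by positivity)]
  ring

-- The multiplicity of l counts the types whose progression contains l. Each progression meets l at
-- most once, so summing over l type by type is summing over `q`.
open Classical in
theorem hasSum_axis (h : ℤ) {z : ℂ} (hz : 1 < z.re) :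
    HasSum (fun l => (Fintype.card {ε : Fin k → ℤˣ // ∃ q, axisEigenvalue h ε q = l} : ℂ) *
      etaTerm z l) (∑ ε : Fin k → ℤˣ, axisEta h ε z) := by
  have h1 : ∀ ε : Fin k → ℤˣ, HasSum (fun l => if ∃ q, axisEigenvalue h ε q = l then etaTerm z l
      else 0) (axisEta h ε z) := fun ε => by
    rw [← (axisEigenvalue_injective h ε).hasSum_iff]
    · refine (hasSum_axisEta h ε hz).congr_fun fun q => ?_
      rw [Function.comp_apply, if_pos ⟨q, rfl⟩]
    · intro l hl
      exact if_neg hl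
  refine (hasSum_sum fun ε _ => h1 ε).congr_fun fun l => ?_
  rw [Fintype.card_subtype, ← Finset.sum_filter, Finset.sum_const, nsmul_eq_mul]

theorem differentiable_axisEta (h : ℤ) (ε : Fin k → ℤˣ) : Differentiable ℂ (axisEta h ε) := by
  have hc : ((2 * Real.pi * (2 * k + 1) : ℝ) : ℂ) ≠ 0 := by
    rw [ofReal_ne_zero]; positivity
  exact ((differentiable_id.neg.const_cpow (Or.inl hc)).const_mul _).mul
    ((differentiable_hurwitzZetaOdd _).const_mul 2)

/-! ### Absolute convergence, and vanishing of the off-axis contribution -/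

variable (M : CHDManifold k V)

/-- Grouping the dual lattice into spheres reduces this to convergence of ∑ ‖u‖^{-s} over a lattice
for s larger than its rank. -/
theorem exists_summable_eigenFreq : ∃ σ : ℝ, ∀ s : ℝ, σ < s →
    Summable fun l : ℝ => ((M.eigenFreq l).card : ℝ) * |l| ^ (-s) := by
  have : FiniteDimensional ℝ V := M.a.finiteDimensional_of_finite
  set Λ := Submodule.span ℤ (Set.range (innerDual M.periodBasis)) with hΛ
  have : DiscreteTopology Λ := inferInstance
  refine ⟨Module.finrank ℤ Λ, fun s hs => ?_⟩
  set f : Λ → ℝ := fun u => 2 * Real.pi * ‖u‖ with hf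
  have h1 : Summable fun u : Λ => (f u) ^ (-s) := by
    have := (ZLattice.summable_norm_rpow Λ (-s) (by linarith)).mul_left ((2 * Real.pi) ^ (-s))
    refine this.congr fun u => ?_
    rw [hf, Real.mul_rpow (by positivity) (norm_nonneg _)]
  have h2 : Summable fun y : ℝ => ∑' u : {u : Λ // f u = y}, (f u) ^ (-s) :=
    ((Equiv.sigmaFiberEquiv f).summable_iff.2 h1).sigma
  have h3 : ∀ l : ℝ, ((M.eigenFreq l).card : ℝ) * |l| ^ (-s) =
      ∑' u : {u : Λ // f u = |l|}, (f u) ^ (-s) := fun l => by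
    let e : M.eigenFreq l ≃ {u : Λ // f u = |l|} :=
      { toFun := fun u => ⟨⟨u, (M.mem_eigenFreq.1 u.2).1⟩, (M.mem_eigenFreq.1 u.2).2⟩
        invFun := fun u => ⟨u.1.1, M.mem_eigenFreq.2 ⟨u.1.2, u.2⟩⟩
        left_inv := fun _ => rfl
        right_inv := fun _ => rfl }
    rw [← e.tsum_eq, tsum_fintype, Finset.sum_congr rfl fun u _ => by rw [(e u).2]]
    simp
  have h4 : ∀ y : ℝ, 0 ≤ ∑' u : {u : Λ // f u = y}, (f u) ^ (-s) := fun y =>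
    tsum_nonneg fun u => Real.rpow_nonneg (by positivity) _
  -- Each sphere is used for both l and -l, so the fibre sums are added to their reflection.
  refine Summable.of_nonneg_of_le (fun l => by positivity) (fun l => ?_)
    (h2.add ((Equiv.neg ℝ).summable_iff.2 h2))
  rw [h3]
  rcases abs_cases l with ⟨h, -⟩ | ⟨h, -⟩ <;> rw [h]
  · exact le_add_of_nonneg_right (h4 _)
  · exact le_add_of_nonneg_left (h4 _)

variable {M} {w : spinGroup (cliffordForm V)} {h : ℤ}

/-- The series converges absolutely, since multiplicities are at most 2^k times the number of
frequencies. Substituting -l for l shows that its sum equals its own negative. -/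
theorem hasSum_off_axis (hw : ∀ x : V, (w : CliffordAlgebra (cliffordForm V)) * ι _ x *
      star (w : CliffordAlgebra _) = ι _ (M.A x)) (hp : M.ActsWithParity w h) {z : ℂ}
    (hz : Summable fun l : ℝ => ((M.eigenFreq l).card : ℝ) * |l| ^ (-z.re)) :
    HasSum (fun l : ℝ => (Module.finrank ℂ (M.spectralModelOn w l M.axisLineᶜ) : ℂ) *
      etaTerm z l) 0 := by
  have hs : Summable fun l : ℝ => (Module.finrank ℂ (M.spectralModelOn w l M.axisLineᶜ) : ℂ) *
      etaTerm z l := by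
    refine Summable.of_norm_bounded (hz.mul_left (2 ^ k)) fun l => ?_
    rw [norm_mul, ← mul_assoc]
    refine mul_le_mul ?_ (norm_etaTerm_le z l) (norm_nonneg _) (by positivity)
    rw [Complex.norm_natCast, mul_comm]
    have h1 := finrank_spectralModel_le hp l
    have h2 := finrank_spectralModel_eq_add hp l
    exact_mod_cast (le_of_add_le_right (h2.symm.le.trans h1))
  have h1 := (Equiv.neg ℝ).hasSum_iff.2 hs.hasSum
  have h2 := hs.hasSum.neg
  have h3 : ((fun l : ℝ => (Module.finrank ℂ (M.spectralModelOn w l M.axisLineᶜ) : ℂ) *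
      etaTerm z l) ∘ (Equiv.neg ℝ)) = fun l : ℝ =>
      -((Module.finrank ℂ (M.spectralModelOn w l M.axisLineᶜ) : ℂ) * etaTerm z l) := by
    funext l
    rw [Function.comp_apply, Equiv.neg_apply, finrank_off_axis_neg hw hp, etaTerm_neg, mul_neg]
  rw [h3] at h1
  have h4 := h1.unique h2
  have h5 := hs.hasSum
  rwa [self_eq_neg.1 h4] at h5

/-- The eta invariant of a flat manifold in terms of the odd Hurwitz zeta function. -/
theorem hasEtaInvariant_spinStructureOf
    (hw : ∀ x : V, (w : CliffordAlgebra (cliffordForm V)) * ι _ x *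
      star (w : CliffordAlgebra _) = ι _ (M.A x)) (hp : M.ActsWithParity w h) {v : ℝ}
    (hv : ∑ ε : Fin k → ℤˣ, axisEta h ε 0 = v) :
    HasEtaInvariant (M.spinStructureOf w hw) v := by
  classical
  obtain ⟨σ, hσ⟩ := M.exists_summable_eigenFreq
  have hd : Differentiable ℂ fun z => ∑ ε : Fin k → ℤˣ, axisEta h ε z :=
    Differentiable.fun_sum fun ε _ => differentiable_axisEta h ε
  refine ⟨fun l => ?_, max σ 1, fun z => ∑ ε : Fin k → ℤˣ, axisEta h ε z, fun z hz => ?_,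
    fun z => (hd.analyticAt z).meromorphicAt, hd.analyticAt 0, hv⟩
  · obtain ⟨e⟩ := nonempty_spectralModel_equiv hw hp l
    have := finiteDimensional_spectralModel hp l
    exact e.finiteDimensional
  · have h1 := (hasSum_axis (k := k) h ((le_max_right _ _).trans_lt hz)).add
      (hasSum_off_axis hw hp (hσ z.re ((le_max_left _ _).trans_lt hz)))
    rw [add_zero] at h1
    have h2 : ∀ l : ℝ, (Module.finrank ℂ
        ((dirac (M.spinStructureOf w hw)).eigenspace (l : ℂ)) : ℂ) *
        ((Real.sign l : ℝ) : ℂ) * ((|l| : ℝ) : ℂ) ^ (-z) =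
        (Fintype.card {ε : Fin k → ℤˣ // ∃ q, axisEigenvalue h ε q = l} : ℂ) * etaTerm z l +
        (Module.finrank ℂ (M.spectralModelOn w l M.axisLineᶜ) : ℂ) * etaTerm z l := fun l => by
      obtain ⟨e⟩ := nonempty_spectralModel_equiv hw hp l
      rw [← e.finrank_eq, finrank_spectralModel_eq_add hp, finrank_axis hp, etaTerm]
      push_cast
      ring
    rw [← funext h2] at h1
    -- The term at l = 0 vanishes because `Real.sign 0 = 0`, so the kernel may be included in the
    -- sum.
    refine (hasSum_subtype_iff_of_support_subset (s := {l : ℝ | l ≠ 0}) fun l hl => ?_).2 h1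
    rintro rfl
    simp at hl

end CHDManifold
end FlatSpin

/-! ### Residues modulo n -/

namespace FlatSpin

open HurwitzZeta

/-- Regrouping a sum according to the residues of an integer-valued function. -/
theorem sum_ncard_mul_eq_sum_filter {ι : Type*} [Fintype ι] (p : ι → Prop) [DecidablePred p]
    {P : ι → ℕ → Prop} {R : ι → ℤ} {n : ℕ} (hn : 0 < n)
    (hP : ∀ i, ∀ r < n, P i r ↔ R i % n = r) (g : ℕ → ℝ) :
    ∑ r ∈ Finset.range n, ({i | p i ∧ P i r}.ncard : ℝ) * g r =
      ∑ i with p i, g (R i % n).toNat := by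
  classical
  have h0 : ∀ i, 0 ≤ R i % n := fun i => Int.emod_nonneg _ (by omega)
  have h1 : ∀ i, R i % n < n := fun i => Int.emod_lt_of_pos _ (by omega)
  rw [← Finset.sum_fiberwise_of_maps_to (t := Finset.range n) (g := fun i => (R i % n).toNat)
    (fun i _ => by have := h0 i; have := h1 i; rw [Finset.mem_range]; omega)]
  refine Finset.sum_congr rfl fun r hr => ?_
  rw [Finset.mem_range] at hr
  have hs : {i | p i ∧ P i r} =
      (({i | p i} : Finset ι).filter fun i => (R i % n).toNat = r : Finset ι) := by
    ext i
    have := h0 i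
    simp only [Set.mem_ofPred_eq, Finset.coe_filter, Finset.mem_filter, Finset.mem_univ, true_and,
      hP i r hr]
    refine and_congr_right fun _ => ?_
    omega
  rw [hs, Set.ncard_coe_finset, ← nsmul_eq_mul, ← Finset.sum_const]
  exact Finset.sum_congr rfl fun i hi => by rw [(Finset.mem_filter.1 hi).2]

theorem modEq_natCast_iff {n r : ℕ} (hr : r < n) {x : ℚ} {R : ℤ} (hx : x = R) :
    x ≡ (r : ℚ) [PMOD (n : ℚ)] ↔ R % n = r := by
  have h1 := AddCommGroup.intCast_modEq_intCast (G := ℚ) (a := R) (b := r) (z := n)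
  push_cast at h1
  rw [hx, h1, AddCommGroup.modEq_iff_intModEq, Int.ModEq,
    Int.emod_eq_of_lt (a := (r : ℤ)) (by omega) (by omega)]

/-- The angle `(R + δ) / n` of the circle only depends on the residue of `R`. -/
theorem coe_add_div_sub_intCast (R m : ℤ) {n : ℕ} (hn : 0 < n) (δ : ℝ) :
    ((((R : ℝ) + δ) / n - m : ℝ) : UnitAddCircle) =
      (((((R % n).toNat : ℕ) + δ) / n : ℝ) : UnitAddCircle) := by
  have hn' : (n : ℝ) ≠ 0 := by positivity
  have h1 : (((R % n).toNat : ℕ) : ℝ) = (R : ℝ) - n * ((R / n : ℤ) : ℝ) := by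
    have h2 : (((R % n).toNat : ℕ) : ℤ) = R - n * (R / n) := by
      rw [Int.toNat_of_nonneg (Int.emod_nonneg _ (by omega)), Int.emod_def]
    exact_mod_cast congrArg (Int.cast : ℤ → ℝ) h2
  rw [h1, QuotientAddGroup.eq]
  refine AddSubgroup.mem_zmultiples_iff.2 ⟨m - R / n, ?_⟩
  rw [zsmul_one]
  push_cast
  field_simp
  ring

variable {k : ℕ}

theorem mu_neg (ε : Fin k → ℤˣ) : mu (-ε) = -mu ε := by
  simp [mu]

theorem sum_fin_add_one (k : ℕ) : ∑ j : Fin k, ((j : ℤ) + 1) = (k * (k + 1) / 2 : ℕ) := by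
  rw [Fin.sum_univ_eq_sum_range (fun j => (j : ℤ) + 1)]
  have h := Finset.sum_range_succ' (fun i : ℕ => i) k
  rw [add_zero, Finset.sum_range_id] at h
  simp only [Nat.add_sub_cancel] at h
  rw [mul_comm k, h]
  push_cast
  rfl

/-- Reversing a sign ε_j changes μ_ε by 2j, so its parity is that of 1 + ⋯ + k. -/
theorem two_dvd_mu_sub (ε : Fin k → ℤˣ) : (2 : ℤ) ∣ mu ε - (k * (k + 1) / 2 : ℕ) := by
  rw [← sum_fin_add_one, mu, ← Finset.sum_sub_distrib]
  refine Finset.dvd_sum fun j _ => ?_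
  rcases Int.units_eq_one_or (ε j) with h | h
  · simp [h]
  · refine ⟨-((j : ℤ) + 1), ?_⟩
    rw [h]
    push_cast
    ring

/-- The term c(k) n is a half-integer exactly when μ_ε is odd, because n is odd. -/
theorem exists_residue (ε : Fin k → ℤˣ) :
    ∃ R : ℤ, (mu ε : ℚ) / 2 + c k * (2 * k + 1) = R := by
  obtain ⟨m, hm⟩ := two_dvd_mu_sub ε
  have hm' : (mu ε : ℚ) = (k * (k + 1) / 2 : ℕ) + 2 * m := by
    rw [sub_eq_iff_eq_add'] at hm
    have := congrArg (Int.cast : ℤ → ℚ) hm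
    push_cast at this ⊢
    exact this
  rw [c, hm']
  split_ifs with h
  · obtain ⟨q, hq⟩ := h
    exact ⟨q + m, by rw [hq]; push_cast; ring⟩
  · obtain ⟨q, hq⟩ := Nat.not_even_iff_odd.1 h
    exact ⟨q + m + k + 1, by rw [hq]; push_cast; ring⟩

/-- This integer is the discrepancy between `axisShift` and the residue divided by n. -/
theorem exists_half_add_c (k : ℕ) : ∃ m : ℤ, ((k * (k + 1) / 2 : ℕ) : ℝ) / 2 + (c k : ℝ) = m := by
  rw [c]
  split_ifs with h
  · obtain ⟨q, hq⟩ := h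
    exact ⟨q, by rw [hq]; push_cast; ring⟩
  · obtain ⟨q, hq⟩ := Nat.not_even_iff_odd.1 h
    exact ⟨q + 1, by rw [hq]; push_cast; ring⟩

/-! ### Evaluation of the axis part at 0 -/

namespace CHDManifold

theorem axisShift_neg (h : ℤ) (ε : Fin k → ℤˣ) : axisShift h (-ε) = -axisShift h ε - h := by
  rw [axisShift, axisShift, mu_neg]
  have : (2 * (k : ℝ) + 1) ≠ 0 := by positivity
  field_simp
  push_cast
  ring

/-- Two signs cancel: for odd k the product of the signs changes, and so does the odd zeta function
when its argument is negated modulo 1. -/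
theorem axisEta_neg (hk : Odd k) (h : ℤ) (ε : Fin k → ℤˣ) (z : ℂ) :
    axisEta h (-ε) z = axisEta h ε z := by
  have h1 : ((axisShift h (-ε) : ℝ) : UnitAddCircle) = -(axisShift h ε : UnitAddCircle) := by
    rw [axisShift_neg, ← AddCircle.coe_neg, QuotientAddGroup.eq]
    exact AddSubgroup.mem_zmultiples_iff.2 ⟨h, by simp⟩
  have h2 : ∏ j, (-ε) j = -∏ j, ε j := by
    simp [Finset.prod_neg, hk.neg_one_pow]
  rw [axisEta, axisEta, h1, h2, hurwitzZetaOdd_neg]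
  push_cast
  ring

theorem sum_axisEta_zero (hk : Odd k) (h : ℤ) : ∑ ε : Fin k → ℤˣ, axisEta h ε 0 =
    2 * ∑ ε : Fin k → ℤˣ with ∏ j, ε j = 1,
      2 * hurwitzZetaOdd (axisShift h ε : UnitAddCircle) 0 := by
  have h0 : ∀ ε : Fin k → ℤˣ, ∏ j, ε j = 1 →
      axisEta h ε 0 = 2 * hurwitzZetaOdd (axisShift h ε : UnitAddCircle) 0 := fun ε hε => by
    simp [axisEta, hε]
  have h1 : ∑ ε : Fin k → ℤˣ with ¬ ∏ j, ε j = 1, axisEta h ε 0 =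
      ∑ ε : Fin k → ℤˣ with ∏ j, ε j = 1, axisEta h ε 0 := by
    refine Finset.sum_equiv (Equiv.neg _) (fun ε => ?_)
      (fun ε _ => by rw [Equiv.neg_apply, axisEta_neg hk])
    have h2 : ∏ j, (-ε) j = -∏ j, ε j := by
      simp [Finset.prod_neg, hk.neg_one_pow]
    simp only [Finset.mem_filter, Finset.mem_univ, true_and, Equiv.neg_apply, h2]
    rcases Int.units_eq_one_or (∏ j, ε j) with h | h <;> simp [h]
  rw [← Finset.sum_filter_add_sum_filter_not _ fun ε : Fin k → ℤˣ => ∏ j, ε j = 1, h1, ← two_mul]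
  congr 1
  exact Finset.sum_congr rfl fun ε hε => h0 ε (Finset.mem_filter.1 hε).2

theorem sum_axisEta_plus (hk : Odd k) :
    ∑ ε : Fin k → ℤˣ, axisEta ((k * (k + 1) / 2 : ℕ) : ℤ) ε 0 =
      ((∑ r ∈ Finset.Icc 1 (2 * k),
        (countPlus k r : ℝ) * (1 - 2 * (r : ℝ) / (2 * (k : ℝ) + 1)) : ℝ) : ℂ) := by
  choose R hR using exists_residue (k := k)
  obtain ⟨m, hm⟩ := exists_half_add_c k
  -- The value 0 at r = 0 is that of the odd zeta function at the trivial class; it lets the sum run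
  -- over all residues although the formula starts at r = 1.
  set g : ℕ → ℝ := fun r => if r = 0 then 0 else 1 - 2 * (r : ℝ) / (2 * (k : ℝ) + 1) with hg
  have h1 : ∑ r ∈ Finset.Icc 1 (2 * k),
      (countPlus k r : ℝ) * (1 - 2 * (r : ℝ) / (2 * (k : ℝ) + 1)) =
      2 * ∑ ε : Fin k → ℤˣ with ∏ j, ε j = 1, g (R ε % (2 * k + 1 : ℕ)).toNat := by
    rw [← sum_ncard_mul_eq_sum_filter _ (by omega) (fun ε r hr => modEq_natCast_iff hr (hR ε)),
      Finset.mul_sum, Finset.range_eq_Ico, Finset.sum_eq_sum_Ico_succ_bot (by omega)]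
    simp only [hg, if_true, mul_zero, zero_add]
    refine Finset.sum_congr (by ext; simp) fun r hr => ?_
    have : r ≠ 0 := by rw [Finset.mem_Ico] at hr; omega
    rw [if_neg this, countPlus]
    push_cast
    ring
  rw [h1, sum_axisEta_zero hk, Complex.ofReal_mul, Complex.ofReal_ofNat, Complex.ofReal_sum]
  congr 1
  refine Finset.sum_congr rfl fun ε _ => ?_
  -- With h = k(k+1)/2 the shift is (R - c n)/n - h/2 = R/n - (h/2 + c), and the last bracket is the
  -- integer `m`.
  have h2 : axisShift ((k * (k + 1) / 2 : ℕ) : ℤ) ε =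
      ((R ε : ℝ) + 0) / (2 * k + 1 : ℕ) - m := by
    have h3 : ((mu ε : ℝ)) / 2 + (c k : ℝ) * (2 * k + 1) = R ε := by
      exact_mod_cast congrArg (Rat.cast : ℚ → ℝ) (hR ε)
    rw [axisShift, ← h3, ← hm, Int.cast_natCast]
    push_cast
    field_simp
    ring
  have h4 : (R ε % (2 * k + 1 : ℕ)).toNat < 2 * k + 1 := by
    have := Int.emod_lt_of_pos (R ε) (b := (2 * k + 1 : ℕ)) (by omega)
    omega
  rw [h2, coe_add_div_sub_intCast _ _ (by omega)]
  set r := (R ε % (2 * k + 1 : ℕ)).toNat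
  rw [hg, add_zero]
  dsimp only
  split_ifs with hr
  · simp [hr, hurwitzZetaOdd_zero_zero]
  · have hr' : 0 < r := Nat.pos_of_ne_zero hr
    rw [hurwitzZetaOdd_zero ⟨by positivity, (div_lt_one (by positivity)).2 (by exact_mod_cast h4)⟩]
    push_cast
    ring

theorem sum_axisEta_minus (hk : Odd k) :
    ∑ ε : Fin k → ℤˣ, axisEta ((k * (k + 1) / 2 : ℕ) + 1 : ℤ) ε 0 =
      ((∑ r ∈ Finset.range (2 * k + 1),
        (countMinus k r : ℝ) * (1 - (2 * (r : ℝ) + 1) / (2 * (k : ℝ) + 1)) : ℝ) : ℂ) := by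
  choose R hR using exists_residue (k := k)
  obtain ⟨m, hm⟩ := exists_half_add_c k
  have hR' : ∀ ε : Fin k → ℤˣ, (mu ε : ℚ) / 2 + c k * (2 * k + 1) + k = (R ε + k : ℤ) :=
    fun ε => by rw [hR]; push_cast; rfl
  set g : ℕ → ℝ := fun r => 1 - (2 * (r : ℝ) + 1) / (2 * (k : ℝ) + 1) with hg
  have h1 : ∑ r ∈ Finset.range (2 * k + 1),
      (countMinus k r : ℝ) * (1 - (2 * (r : ℝ) + 1) / (2 * (k : ℝ) + 1)) =
      2 * ∑ ε : Fin k → ℤˣ with ∏ j, ε j = 1, g ((R ε + k) % (2 * k + 1 : ℕ)).toNat := by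
    rw [← sum_ncard_mul_eq_sum_filter _ (by omega) (fun ε r hr => modEq_natCast_iff hr (hR' ε)),
      Finset.mul_sum]
    refine Finset.sum_congr rfl fun r _ => ?_
    rw [hg, countMinus]
    push_cast
    ring
  rw [h1, sum_axisEta_zero hk, Complex.ofReal_mul, Complex.ofReal_ofNat, Complex.ofReal_sum]
  congr 1
  refine Finset.sum_congr rfl fun ε _ => ?_
  -- Raising h by 1 subtracts a further 1/2, and 1/2 = (k + 1/2)/n. This is the origin of the
  -- summand k in the definition of A_r^-.
  have h2 : axisShift ((k * (k + 1) / 2 : ℕ) + 1 : ℤ) ε =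
      (((R ε + k : ℤ) : ℝ) + 1 / 2) / (2 * k + 1 : ℕ) - (m + 1 : ℤ) := by
    have h3 : ((mu ε : ℝ)) / 2 + (c k : ℝ) * (2 * k + 1) = R ε := by
      exact_mod_cast congrArg (Rat.cast : ℚ → ℝ) (hR ε)
    rw [axisShift, Int.cast_add (R ε), ← h3, Int.cast_add m, ← hm, Int.cast_add, Int.cast_natCast]
    push_cast
    field_simp
    ring
  have h4 : ((R ε + k) % (2 * k + 1 : ℕ)).toNat < 2 * k + 1 := by
    have := Int.emod_lt_of_pos (R ε + k) (b := (2 * k + 1 : ℕ)) (by omega)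
    omega
  rw [h2, coe_add_div_sub_intCast _ _ (by omega)]
  set r := ((R ε + k) % (2 * k + 1 : ℕ)).toNat
  have h5 : (r : ℝ) + 1 ≤ (2 * k + 1 : ℕ) := by exact_mod_cast h4
  -- The point (r + 1/2)/n is never an integer, so no residue needs separate treatment.
  rw [hurwitzZetaOdd_zero ⟨by positivity, (div_lt_one (by positivity)).2 (by linarith)⟩, hg]
  push_cast
  ring

end CHDManifold
end FlatSpin

end

theorem theorem1 {V : Type*} [NormedAddCommGroup V] [InnerProductSpace ℝ V]
    (k : ℕ) (hk : Odd k) (M : FlatSpin.CHDManifold k V) :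
    FlatSpin.CHDManifold.HasEtaInvariant M.spinPlus
      (∑ r ∈ Finset.Icc 1 (2 * k),
        (FlatSpin.countPlus k r : ℝ) * (1 - 2 * (r : ℝ) / (2 * (k : ℝ) + 1))) ∧
    FlatSpin.CHDManifold.HasEtaInvariant M.spinMinus
      (∑ r ∈ Finset.range (2 * k + 1),
        (FlatSpin.countMinus k r : ℝ) * (1 - (2 * (r : ℝ) + 1) / (2 * (k : ℝ) + 1))) := by
  exact ⟨FlatSpin.CHDManifold.hasEtaInvariant_spinStructureOf M.αPlus_conj
      M.αPlus_actsWithParity (FlatSpin.CHDManifold.sum_axisEta_plus hk),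
    FlatSpin.CHDManifold.hasEtaInvariant_spinStructureOf M.αMinus_conj
      M.αMinus_actsWithParity (FlatSpin.CHDManifold.sum_axisEta_minus hk)⟩
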